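/- **Theorem (Connection between CPT-value and Multi-objective Reachability).** *Setting.* An MDP $\mathcal M=(S,s_0,A,\delta)$ has finitely many states and actions, a non-empty set $A(s)$ of available actions in each state $s$, and a distribution $\delta(s,a)$ over successors for each $a\in A(s)$; a state $s$ is absorbing if $\delta(s,a)(s)=1$ for all $a\in A(s)$. A strategy $\sigma$ maps finite paths to distributions over the available actions and induces a probability measure $\mathbb P^\sigma_{\mathcal M}$ on infinite paths; $\lozenge T$ is the event that $T\subseteq S$ is visited. A weighted-reachability objective $\Phi=(F,r)$ consists of a set $F\subseteq S$ of absorbing target states and rewards $r:F\to\mathbb Q\setminus\{0\}$; the value $\Phi(\rho)$ of a path is the reward of its first target state, and $0$ if it visits none. Its outcomes are the $k$ elements $o_1<\dots<o_k$ of $r(F)\cup\{0\}$, and $\vec o=(o_1,\dots,o_k)$. Given an increasing continuous utility function $u:\mathbb R\to\mathbb R$ and increasing continuous probability weighting functions $w^+,w^-:[0,1]\to[0,1]$, the CPT-function is $\mathsf{cpt}((\vec o,\vec p))=\sum_{i=1}^k u(o_i)\,\pi_i$ with $$\pi_i=\begin{cases} w^+\bigl(\sum_{m\ge i}p_m\bigr)-w^+\bigl(\sum_{m>i}p_m\bigr)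 & o_i>0,\\ 0 & o_i=0,\\ w^-\bigl(\sum_{m\le i}p_m\bigr)-w^-\bigl(\sum_{m<i}p_m\bigr) & o_i<0,\end{cases}$$ and the CPT-value is $$\mathsf{CPT\text{-}val}(\mathcal M,\Phi)=\sup_\sigma\Bigl(\sum_{o_i>0}u(o_i)\bigl(w^+(\mathbb P^\sigma_{\mathcal M}(\Phi\ge o_i))-w^+(\mathbb P^\sigma_{\mathcal M}(\Phi>o_i))\bigr)+\sum_{o_i<0}u(o_i)\bigl(w^-(\mathbb P^\sigma_{\mathcal M}(\Phi\le o_i))-w^-(\mathbb P^\sigma_{\mathcal M}(\Phi<o_i))\bigr)\Bigr).$$ For target sets $\mathcal Q=(F_1,\dots,F_k)$, the achievable set $\mathcal A^{\mathcal Q}_{\mathcal M}$ consists of all $\vec p\in\mathbb R^k$ such that some strategy $\sigma$ satisfies $p_i\le\mathbb P^\sigma_{\mathcal M}(\lozenge F_i)$ for all $i$, and the Pareto frontier $\mathcal P^{\mathcal Q}_{\mathcal M}$ is the set of its maximal elements for the componentwise order. *Statement.* There is a construction that assigns to every MDP $\mathcal M$ with weighted-reachability objective $\Phi=(F,r)$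 with $k$ outcomes an MDP $\widehat{\mathcal M}$ that carries the same objective (its target states correspond one-to-one to those of $\Phi$, with the same rewards; we write $\Phi=(F,r)$ again), a state $\mathsf z\notin F$ of $\widehat{\mathcal M}$, and a $k$-dimensional multi-objective reachability query $\mathcal Q=(F_1,\dots,F_k)$ on $\widehat{\mathcal M}$, such that the following holds. 1. $\widehat{\mathcal M}$ is stopping: $\mathbb P^{\sigma}_{\widehat{\mathcal M}}(\lozenge(F\cup\{\mathsf z\}))=1$ for every strategy $\sigma$ of $\widehat{\mathcal M}$. 2. $F_i=\{s\in F\mid r(s)=o_i\}$ if $o_i\ne0$, and $F_i=\{\mathsf z\}$ if $o_i=0$; all states in $F_1\cup\dots\cup F_k$ are absorbing. 3. For all $u,w^+,w^-$ as above, $$\mathsf{CPT\text{-}val}(\mathcal M,\Phi)=\sup_{\vec p\in\mathcal P^{\mathcal Q}_{\widehat{\mathcal M}}}\mathsf{cpt}((\vec o,\vec p)),$$ where both suprema are taken over non-empty bounded sets of reals. 4. On inputs with rational transition probabilities (numbers in binary, as quotients of integers), a single algorithm computes $\widehat{\mathcal M}$, $\Phi$ on $\widehat{\mathcal M}$, $\mathsf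 z$ and $\mathcal Q$ in time polynomial in the bit size of the input. -/

import Mathlib

open MeasureTheory ProbabilityTheory

namespace CPTReach

noncomputable section

/-! ## Markov decision processes -/

/-- A finite Markov decision process. States and actions are numbered; `avail s` is the non-empty
set of actions available in `s`. The transition function is only relevant at available actions
(its values at the other actions play no role anywhere). Probabilities are arbitrary reals. -/
structure MDP where
  numStates : ℕ
  numActions : ℕ
  init : Fin numStates
  avail : Fin numStates → Finset (Fin numActions)
  avail_nonempty : ∀ s, (avail s).Nonempty
  trans : Fin numStates → Fin numActions → PMF (Fin numStates)

abbrev MDP.State (M : MDP) : Type := Fin M.numStates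

abbrev MDP.Action (M : MDP) : Type := Fin M.numActions

/-- A history-dependent randomized strategy: `act h s` is the distribution over actions after the
finite path that consists of the state-action pairs `h` and ends in the state `s`. -/
structure Strategy (M : MDP) where
  act : List (M.State × M.Action) → M.State → PMF M.Action
  support_subset : ∀ h s, (act h s).support ⊆ M.avail s

/-- The joint law of the next state and the action chosen there, after the history `x`, whose last
entry is the current state with the action chosen in it. -/
def Strategy.stepPMF {M : MDP} (σ : Strategy M) (n : ℕ)
    (x : (i : Finset.Iic n) → M.State × M.Action) : PMF (M.State × M.Action) :=
  let last := x ⟨n, by simp⟩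
  let hist := List.ofFn fun i : Fin (n + 1) =>
    x ⟨i, Finset.mem_Iic.2 (Nat.lt_succ_iff.1 i.isLt)⟩
  (M.trans last.1 last.2).bind fun s => (σ.act hist s).map fun a => (s, a)

def Strategy.stepKernel {M : MDP} (σ : Strategy M) (n : ℕ) :
    Kernel ((i : Finset.Iic n) → M.State × M.Action) (M.State × M.Action) where
  toFun x := (σ.stepPMF n x).toMeasure
  measurable' := measurable_of_countable _

instance {M : MDP} (σ : Strategy M) (n : ℕ) : IsMarkovKernel (σ.stepKernel n) :=
  ⟨fun x => PMF.toMeasure.isProbabilityMeasure (σ.stepPMF n x)⟩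

/-- The law of the state and action at time `0`. -/
def Strategy.initPMF {M : MDP} (σ : Strategy M) : PMF (M.State × M.Action) :=
  (σ.act [] M.init).map fun a => (M.init, a)

/-- An infinite path `s₀ a₀ s₁ a₁ …`. -/
abbrev MDP.Path (M : MDP) : Type := ℕ → M.State × M.Action

/-- The probability measure on infinite paths that the strategy induces (Ionescu-Tulcea). -/
def Strategy.law {M : MDP} (σ : Strategy M) : Measure M.Path :=
  Kernel.trajMeasure (X := fun _ => M.State × M.Action) σ.initPMF.toMeasure σ.stepKernel

/-- The set of infinite paths that visit `T`. -/
def MDP.reach (M : MDP) (T : Finset M.State) : Set M.Path :=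
  {ρ | ∃ j, (ρ j).1 ∈ T}

/-- A state that no available action leaves. -/
def MDP.Absorbing (M : MDP) (s : M.State) : Prop :=
  ∀ a ∈ M.avail s, M.trans s a s = 1

/-! ## Weighted reachability -/

/-- A weighted-reachability objective: absorbing target states with non-zero rational rewards
(the values of `reward` outside `targets` play no role). -/
structure WRObjective (M : MDP) where
  targets : Finset M.State
  reward : M.State → ℚ
  absorbing : ∀ s ∈ targets, M.Absorbing s
  reward_ne_zero : ∀ s ∈ targets, reward s ≠ 0

namespace WRObjective

variable {M : MDP} (Φ : WRObjective M)

open Classical in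
/-- The value of a path: the reward of the first visited target state, and `0` if there is none. -/
def value (ρ : M.Path) : ℚ :=
  if h : ∃ i, (ρ i).1 ∈ Φ.targets then Φ.reward (ρ (Nat.find h)).1 else 0

/-- The set of outcomes; `0` always belongs to it. -/
def outcomes : Finset ℚ := insert 0 (Φ.targets.image Φ.reward)

/-- The number `k` of outcomes. -/
def numOutcomes : ℕ := Φ.outcomes.card

/-- The vector of outcomes, in increasing order. -/
def outcomeVec : Fin Φ.numOutcomes → ℚ := Φ.outcomes.orderEmbOfFin rfl

/-- The states in which the outcome `o` is obtained; `z` is the sink for the outcome `0`. -/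
def obtainSet (z : M.State) (o : ℚ) : Finset M.State :=
  if o = 0 then {z} else Φ.targets.filter fun s => Φ.reward s = o

/-- Under every strategy, a target state or the sink `z` is reached almost surely. -/
def Stopping (z : M.State) : Prop :=
  ∀ σ : Strategy M, σ.law (M.reach (insert z Φ.targets)) = 1

end WRObjective

/-! ## Cumulative prospect theory -/

/-- The ingredients of a CPT-function: a utility function and two probability weighting functions
`[0,1] → [0,1]`, all of them increasing and continuous. -/
structure CPT where
  u : ℝ → ℝ
  wPos : ℝ → ℝ
  wNeg : ℝ → ℝ
  u_mono : Monotone u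
  u_cont : Continuous u
  wPos_maps : Set.MapsTo wPos (Set.Icc 0 1) (Set.Icc 0 1)
  wPos_mono : MonotoneOn wPos (Set.Icc 0 1)
  wPos_cont : ContinuousOn wPos (Set.Icc 0 1)
  wNeg_maps : Set.MapsTo wNeg (Set.Icc 0 1) (Set.Icc 0 1)
  wNeg_mono : MonotoneOn wNeg (Set.Icc 0 1)
  wNeg_cont : ContinuousOn wNeg (Set.Icc 0 1)

/-- The probability of an outcome strictly better than the `i`-th one. -/
def gainRank {k : ℕ} (p : Fin k → ℝ) (i : Fin k) : ℝ := ∑ m ∈ Finset.Ioi i, p m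

/-- The probability of an outcome strictly worse than the `i`-th one. -/
def lossRank {k : ℕ} (p : Fin k → ℝ) (i : Fin k) : ℝ := ∑ m ∈ Finset.Iio i, p m

/-- The decision weight of the `i`-th outcome of the prospect `(o, p)`. -/
def CPT.decisionWeight (C : CPT) {k : ℕ} (o p : Fin k → ℝ) (i : Fin k) : ℝ :=
  if 0 < o i then C.wPos (p i + gainRank p i) - C.wPos (gainRank p i)
  else if o i < 0 then C.wNeg (p i + lossRank p i) - C.wNeg (lossRank p i)
  else 0

/-- The CPT-function on the prospect `(o, p)`, where `o` is increasing. -/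
def CPT.cpt (C : CPT) {k : ℕ} (o p : Fin k → ℝ) : ℝ :=
  ∑ i, C.u (o i) * C.decisionWeight o p i

/-- The CPT-value that a strategy obtains. -/
def CPT.strategyValue (C : CPT) {M : MDP} (Φ : WRObjective M) (σ : Strategy M) : ℝ :=
  (∑ o ∈ Φ.outcomes with 0 < o, C.u o *
    (C.wPos (σ.law.real {ρ | o ≤ Φ.value ρ}) - C.wPos (σ.law.real {ρ | o < Φ.value ρ}))) +
  ∑ o ∈ Φ.outcomes with o < 0, C.u o *
    (C.wNeg (σ.law.real {ρ | Φ.value ρ ≤ o}) - C.wNeg (σ.law.real {ρ | Φ.value ρ < o}))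

/-- The CPT-value of an MDP: the supremum over all strategies. -/
def CPT.val (C : CPT) {M : MDP} (Φ : WRObjective M) : ℝ :=
  ⨆ σ : Strategy M, C.strategyValue Φ σ

/-! ## Multi-objective reachability -/

/-- The points that some strategy achieves, for the query with target sets `Q 0, …, Q (k - 1)`. -/
def achievable (M : MDP) {k : ℕ} (Q : Fin k → Finset M.State) : Set (Fin k → ℝ) :=
  {p | ∃ σ : Strategy M, ∀ i, p i ≤ σ.law.real (M.reach (Q i))}

/-- The Pareto frontier. -/
def paretoFrontier (M : MDP) {k : ℕ} (Q : Fin k → Finset M.State) : Set (Fin k → ℝ) :=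
  {p | p ∈ achievable M Q ∧ ¬ ∃ q ∈ achievable M Q, p ≠ q ∧ p ≤ q}

/-! ## Polynomial time

A structured machine model over binary trees whose leaves are integers in binary, with logarithmic
cost: every elementary step is charged the bit sizes of the data that it reads, copies and writes.
Running time in this model and on Turing machines agree up to a polynomial. -/

/-- The data of the machine. -/
inductive Val : Type
  | int : ℤ → Val
  | pair : Val → Val → Val

namespace Val

/-- The bit size of a datum. -/
def size : Val → ℕ
  | int z => 1 + z.natAbs.size
  | pair a b => 1 + a.size + b.size

def list : List Val → Val
  | [] => int 0
  | v :: l => pair v (list l)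

end Val

/-- Elementary operations. The arithmetic ones take a pair of integers; ill-formed arguments give
`0`. Tests return `1` for true and `0` for false. -/
inductive PrimOp : Type
  | id | fst | snd | isPair | add | sub | mul | div | le
  | const : Val → PrimOp

def PrimOp.eval : PrimOp → Val → Val
  | .id, v => v
  | .const c, _ => c
  | .fst, .pair a _ => a
  | .snd, .pair _ b => b
  | .isPair, .pair _ _ => .int 1
  | .add, .pair (.int x) (.int y) => .int (x + y)
  | .sub, .pair (.int x) (.int y) => .int (x - y)
  | .mul, .pair (.int x) (.int y) => .int (x * y)
  | .div, .pair (.int x) (.int y) => .int (x / y)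
  | .le, .pair (.int x) (.int y) => .int (if x ≤ y then 1 else 0)
  | _, _ => .int 0

/-- Programs; each one transforms a datum into a datum. -/
inductive Prog : Type
  | prim : PrimOp → Prog
  | seq : Prog → Prog → Prog
  | fork : Prog → Prog → Prog
  | cond : Prog → Prog → Prog → Prog
  | loop : Prog → Prog → Prog

/-- `Runs P v w t`: started on `v`, the program `P` halts with the result `w` after time `t`.
`seq f g` runs `f` and then `g`; `fork f g` runs both on the same input and pairs the results;
`cond c f g` runs `f` or `g` according to the test `c`; `loop c f` repeats `f` as long as the test
`c` holds. A test holds if its result is not `0`. -/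
inductive Runs : Prog → Val → Val → ℕ → Prop
  | prim (op : PrimOp) (v : Val) : Runs (.prim op) v (op.eval v) (1 + v.size + (op.eval v).size)
  | seq {f g : Prog} {v w x : Val} {t₁ t₂ : ℕ} : Runs f v w t₁ → Runs g w x t₂ →
      Runs (.seq f g) v x (1 + t₁ + t₂)
  | fork {f g : Prog} {v w x : Val} {t₁ t₂ : ℕ} : Runs f v w t₁ → Runs g v x t₂ →
      Runs (.fork f g) v (.pair w x) (1 + v.size + t₁ + t₂)
  | cond_true {c f g : Prog} {v b w : Val} {t₁ t₂ : ℕ} : Runs c v b t₁ → b ≠ .int 0 →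
      Runs f v w t₂ → Runs (.cond c f g) v w (1 + v.size + t₁ + t₂)
  | cond_false {c f g : Prog} {v w : Val} {t₁ t₂ : ℕ} : Runs c v (.int 0) t₁ →
      Runs g v w t₂ → Runs (.cond c f g) v w (1 + v.size + t₁ + t₂)
  | loop_stop {c f : Prog} {v : Val} {t₁ : ℕ} : Runs c v (.int 0) t₁ →
      Runs (.loop c f) v v (1 + v.size + t₁)
  | loop_step {c f : Prog} {v b w x : Val} {t₁ t₂ t₃ : ℕ} : Runs c v b t₁ → b ≠ .int 0 →
      Runs f v w t₂ → Runs (.loop c f) w x t₃ →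
      Runs (.loop c f) v x (1 + v.size + t₁ + t₂ + t₃)

/-- One program computes `f` in time polynomial in the bit size of the input: on every code of
every `a`, it halts within the time bound and returns a code of `f a`. Objects without a code
(those with irrational probabilities) impose no condition. -/
def PolyTimeComputable {α : Type} {β : α → Type} (codeIn : Val → α → Prop)
    (codeOut : ∀ a, Val → β a → Prop) (f : ∀ a, β a) : Prop :=
  ∃ (P : Prog) (p : Polynomial ℕ), ∀ a v, codeIn v a →
    ∃ w t, Runs P v w t ∧ t ≤ p.eval v.size ∧ codeOut a w (f a)

/-! ### Codes -/

/-- `v` is a list of `n` entries, the `i`-th of which satisfies `R i`. -/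
def IsTable {n : ℕ} (R : Fin n → Val → Prop) (v : Val) : Prop :=
  ∃ c : Fin n → Val, (∀ i, R i (c i)) ∧ v = Val.list (List.ofFn c)

/-- A rational number is coded by an integer numerator and a positive integer denominator. -/
def CodesReal (v : Val) (x : ℝ) : Prop :=
  ∃ a b : ℤ, 0 < b ∧ v = .pair (.int a) (.int b) ∧ x = (a : ℝ) / (b : ℝ)

/-- A set of states is coded by a bit vector. -/
def CodesSet {n : ℕ} (v : Val) (T : Finset (Fin n)) : Prop :=
  IsTable (fun i w => w = .int (if i ∈ T then 1 else 0)) v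

/-- The entry of the transition table for a state `s` and an action `a`: `0` if `a` is not
available in `s`, and else the marker `1` with the list of the transition probabilities. -/
def CodesTrans (M : MDP) (s : M.State) (a : M.Action) (v : Val) : Prop :=
  (a ∉ M.avail s ∧ v = .int 0) ∨
  (a ∈ M.avail s ∧ ∃ w, v = .pair (.int 1) w ∧
    IsTable (fun t x => CodesReal x (M.trans s a t).toReal) w)

/-- An MDP is coded by its numbers of states and actions, its initial state and its transition
table. -/
def CodesMDP (v : Val) (M : MDP) : Prop :=
  ∃ w, IsTable (fun s x => IsTable (fun a y => CodesTrans M s a y) x) w ∧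
    v = Val.list [.int M.numStates, .int M.numActions, .int (M.init : ℕ), w]

/-- An objective is coded by the table of its rewards, with the entry `0` at non-targets. -/
def CodesObjective {M : MDP} (v : Val) (Φ : WRObjective M) : Prop :=
  IsTable (fun s x => (s ∉ Φ.targets ∧ x = .int 0) ∨
    (s ∈ Φ.targets ∧ CodesReal x (Φ.reward s))) v

/-! ## The reduction -/

/-- An MDP with a weighted-reachability objective. -/
structure Problem where
  mdp : MDP
  obj : WRObjective mdp

/-- An MDP with a weighted-reachability objective, a sink state, and a multi-objective
reachability query of dimension `k`. -/
structure Reduct (k : ℕ) where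
  mdp : MDP
  obj : WRObjective mdp
  sink : mdp.State
  query : Fin k → Finset mdp.State

def CodesProblem (v : Val) (I : Problem) : Prop :=
  ∃ a b, CodesMDP a I.mdp ∧ CodesObjective b I.obj ∧ v = .pair a b

def CodesReduct {k : ℕ} (v : Val) (R : Reduct k) : Prop :=
  ∃ a b c, CodesMDP a R.mdp ∧ CodesObjective b R.obj ∧
    IsTable (fun i x => CodesSet x (R.query i)) c ∧
    v = Val.list [a, b, .int (R.sink : ℕ), c]

/-- The objective `Ψ` is the objective `Φ`, transported to another MDP: the target states
correspond to each other, with the same rewards. -/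
def SameObjective {M N : MDP} (Φ : WRObjective M) (Ψ : WRObjective N) : Prop :=
  ∃ e : {s // s ∈ Φ.targets} ≃ {s // s ∈ Ψ.targets}, ∀ s, Ψ.reward (e s) = Φ.reward s

end

end CPTReach

open CPTReach

open MeasureTheory ProbabilityTheory

namespace CPTReach

/-! ## Finite-dimensional marginals of the path measure -/

namespace Strategy

variable {M : MDP} (σ : Strategy M)

/-! The CPT-value of a strategy is `cpt` of its outcome distribution (`CPT.strategyValue_eq_cpt`),
and that distribution depends only on the probabilities of reaching the individual target states. So
it suffices to build a stopping MDP whose strategies realize exactly the same vectors of target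
probabilities. In it the sets of the query partition the targets and the sink, so every vector of
query probabilities has sum 1. Among vectors of equal sum none dominates another, hence the Pareto
frontier is the whole set of realized vectors (`Problem.paretoFrontier_eq`), and both suprema are
taken over the same set of reals.

The stopping MDP treats the maximal end components that avoid the targets as if they were collapsed,
but without merging states: every state of a component may directly choose any action that leaves
the component from any of its states, or quit to a fresh sink. Quitting replaces staying in the
component for ever. No end component survives outside the targets and the sink
(`collapse.inner_eq_empty`), which makes the MDP stopping.

Strategies of the two MDPs are compared through plans, the expected numbers of uses of the outer
actions, i.e. of those that belong to no end component. A strategy induces a flow of state-action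
marginals, and every flow is the flow of a Markov strategy. A potential that is constant on
components and grows in expectation by a fixed amount with every outer action
(`MDP.exists_potential`) shows that these numbers are finite. They satisfy the linear conditions
`IsPlan`, and the probability of a target is the inflow into it. Conversely, every plan is realized
(`MDP.IsPlan.exists_flow`): exits are taken greedily, the remaining mass explores its component, and
the potential excludes that a part of the plan is never carried out. Plans of the collapsed MDP
become plans of the original one by summing over the states that call an exit; in the other
direction, exits are split in proportion to the inflow. Neither direction changes the inflow into
targets.

For the running time, the functions computable in polynomial time on codes are closed under
composition, pairing, case distinction and folds whose accumulators stay polynomially bounded. End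
components are computed as a greatest fixed point, by repeatedly discarding actions with a successor
that cannot return. -/

instance : IsProbabilityMeasure σ.initPMF.toMeasure := PMF.toMeasure.isProbabilityMeasure _

instance : IsProbabilityMeasure σ.law := by
  unfold law; infer_instance

/-- The defining property of the Ionescu-Tulcea measure, evaluated on a rectangle. The facts below
about a single step come from it by a choice of `A` and `B`. -/
theorem law_step (n : ℕ) (A : Set ((i : Finset.Iic n) → M.State × M.Action))
    (B : Set (M.State × M.Action)) :
    σ.law {ρ | Preorder.frestrictLe n ρ ∈ A ∧ ρ (n + 1) ∈ B} =
      ∫⁻ x in A, (σ.stepPMF n x).toMeasure B ∂(σ.law.map (Preorder.frestrictLe n)) := by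
  have hA : MeasurableSet A := A.to_countable.measurableSet
  have hB : MeasurableSet B := B.to_countable.measurableSet
  have h := Kernel.map_frestrictLe_trajMeasure_compProd_eq_map_trajMeasure
    (X := fun _ => M.State × M.Action) (μ₀ := σ.initPMF.toMeasure) (κ := σ.stepKernel) (a := n)
  have h1 := congrArg (fun ν => ν (A ×ˢ B)) h
  rw [Measure.compProd_apply_prod hA hB, Measure.map_apply (by fun_prop) (hA.prod hB)] at h1
  exact h1.symm

theorem law_zero (x : M.State × M.Action) : σ.law {ρ | ρ 0 = x} = σ.initPMF x := by
  have h : σ.law.map (fun ρ => ρ 0) = σ.initPMF.toMeasure := by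
    -- The trajectory kernel started at time `0` leaves the first coordinate alone; `piUnique`
    -- identifies functions on the single time `0` with their value.
    have h1 : σ.law.map (Preorder.frestrictLe 0) = σ.initPMF.toMeasure.map
        (MeasurableEquiv.piUnique (fun _ : Finset.Iic 0 => M.State × M.Action)).symm := by
      unfold law Kernel.trajMeasure
      rw [Measure.map_comp _ _ (by fun_prop), Kernel.traj_map_frestrictLe,
        Kernel.partialTraj_self, Measure.id_comp]
    have h2 : (fun ρ : M.Path => ρ 0) =
        (MeasurableEquiv.piUnique (fun _ : Finset.Iic 0 => M.State × M.Action)) ∘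
          (Preorder.frestrictLe (π := fun _ => M.State × M.Action) 0) := by
      funext ρ; rfl
    rw [h2, ← Measure.map_map (by fun_prop) (by fun_prop), h1,
      Measure.map_map (by fun_prop) (by fun_prop), MeasurableEquiv.self_comp_symm, Measure.map_id]
  have h3 := congrArg (fun ν => ν {x}) h
  rw [Measure.map_apply (by fun_prop) (measurableSet_singleton x),
    PMF.toMeasure_apply_singleton _ _ (measurableSet_singleton x)] at h3
  exact h3

theorem stepPMF_apply (n : ℕ) (x : (i : Finset.Iic n) → M.State × M.Action) (s : M.State)
    (a : M.Action) :
    σ.stepPMF n x (s, a) =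
      M.trans (x ⟨n, by simp⟩).1 (x ⟨n, by simp⟩).2 s *
        σ.act (List.ofFn fun i : Fin (n + 1) =>
          x ⟨i, Finset.mem_Iic.2 (Nat.lt_succ_iff.1 i.isLt)⟩) s a := by
  classical
  simp only [stepPMF, PMF.bind_apply, PMF.map_apply, tsum_fintype]
  rw [Finset.sum_eq_single s]
  · congr 1
    rw [Finset.sum_eq_single a] <;> simp +contextual
    intro b hb h; exact absurd h.symm hb
  · intro b _ hb
    simp [Ne.symm hb]
  · simp

/-- The action probabilities in `s` sum to one, so the strategy drops out of the law of the next
state. -/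
theorem stepPMF_fst (n : ℕ) (x : (i : Finset.Iic n) → M.State × M.Action) (s : M.State) :
    (σ.stepPMF n x).toMeasure {y | y.1 = s} =
      M.trans (x ⟨n, by simp⟩).1 (x ⟨n, by simp⟩).2 s := by
  classical
  rw [PMF.toMeasure_apply_fintype, Fintype.sum_prod_type]
  rw [Finset.sum_eq_single s]
  · simp only [Set.indicator, Set.mem_ofPred_eq, if_true, stepPMF_apply]
    rw [← Finset.mul_sum, ← tsum_fintype (L := .unconditional _), PMF.tsum_coe, mul_one]
  · intro b _ hb
    simp [Set.indicator, hb]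
  · simp

theorem law_transition (n : ℕ) (x : M.State × M.Action) (s : M.State) :
    σ.law {ρ | ρ n = x ∧ (ρ (n + 1)).1 = s} = σ.law {ρ | ρ n = x} * M.trans x.1 x.2 s := by
  have h := σ.law_step n {h | h ⟨n, by simp⟩ = x} {y | y.1 = s}
  have hm : MeasurableSet {h : (i : Finset.Iic n) → M.State × M.Action | h ⟨n, by simp⟩ = x} :=
    (Set.to_countable _).measurableSet
  simp only [stepPMF_fst] at h
  rw [setLIntegral_congr_fun (g := fun _ => M.trans x.1 x.2 s) hm
    (fun y hy => by rw [Set.mem_ofPred_eq] at hy; simp only [hy])] at h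
  rw [lintegral_const, Measure.restrict_apply MeasurableSet.univ, Set.univ_inter,
    Measure.map_apply (by fun_prop) hm, mul_comm] at h
  exact h

/-- A rule that sees the history only through its length factors out of the integral over histories.
The history before time `n + 1` has length `n + 1`. -/
theorem law_succ_of_markov {g : ℕ → M.State → PMF M.Action}
    (hg : ∀ h s, σ.act h s = g h.length s) (n : ℕ) (s : M.State) (a : M.Action) :
    σ.law {ρ | ρ (n + 1) = (s, a)} = σ.law {ρ | (ρ (n + 1)).1 = s} * g (n + 1) s a := by
  have h1 := σ.law_step n Set.univ {(s, a)}
  have h2 := σ.law_step n Set.univ {y | y.1 = s}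
  simp only [Set.mem_univ, true_and, Measure.restrict_univ, Set.mem_singleton_iff,
    Set.mem_ofPred_eq, stepPMF_fst] at h1 h2
  rw [h1, h2, ← lintegral_mul_const _ (measurable_of_countable _)]
  refine lintegral_congr fun x => ?_
  rw [PMF.toMeasure_apply_singleton _ _ (measurableSet_singleton _), stepPMF_apply, hg,
    List.length_ofFn]

theorem law_unavailable (n : ℕ) (s : M.State) (a : M.Action) (ha : a ∉ M.avail s) :
    σ.law {ρ | ρ n = (s, a)} = 0 := by
  classical
  have hz : ∀ h, σ.act h s a = 0 := fun h =>
    (PMF.apply_eq_zero_iff _ _).2 fun hs => ha (σ.support_subset h s hs)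
  cases n with
  | zero =>
    rw [law_zero, initPMF, PMF.map_apply, tsum_fintype]
    refine Finset.sum_eq_zero fun b _ => ?_
    split_ifs with h
    · obtain ⟨rfl, rfl⟩ := Prod.mk.inj h
      exact hz _
    · rfl
  | succ n =>
    have h1 := σ.law_step n Set.univ {(s, a)}
    simp only [Set.mem_univ, true_and, Measure.restrict_univ, Set.mem_singleton_iff] at h1
    rw [h1]
    simp [PMF.toMeasure_apply_singleton _ _ (measurableSet_singleton _), stepPMF_apply, hz]

end Strategy

end CPTReach

namespace CPTReach

open Filter Topology

/-! ## Flows: the marginals of strategies -/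

/-- The real-valued transition probabilities. -/
noncomputable def MDP.prob (M : MDP) (s : M.State) (a : M.Action) (t : M.State) : ℝ :=
  (M.trans s a t).toReal

theorem MDP.prob_nonneg (M : MDP) (s : M.State) (a : M.Action) (t : M.State) :
    0 ≤ M.prob s a t := ENNReal.toReal_nonneg

theorem sum_toReal_pmf {α : Type*} [Fintype α] (p : PMF α) : ∑ x, (p x).toReal = 1 := by
  rw [← ENNReal.toReal_sum fun x _ => p.apply_ne_top x, ← tsum_fintype (L := .unconditional _),
    p.tsum_coe, ENNReal.toReal_one]

theorem MDP.sum_prob (M : MDP) (s : M.State) (a : M.Action) : ∑ t, M.prob s a t = 1 :=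
  sum_toReal_pmf _

theorem MDP.prob_eq_zero_iff (M : MDP) (s : M.State) (a : M.Action) (t : M.State) :
    M.prob s a t = 0 ↔ M.trans s a t = 0 := by
  simp [MDP.prob, ENNReal.toReal_eq_zero_iff, PMF.apply_ne_top]

theorem MDP.Absorbing.prob_eq {M : MDP} {s : M.State} (h : M.Absorbing s) {a : M.Action}
    (ha : a ∈ M.avail s) (t : M.State) : M.prob s a t = if t = s then 1 else 0 := by
  have h1 : M.prob s a s = 1 := by simp [MDP.prob, h a ha]
  split_ifs with hts
  · rw [hts, h1]
  · have h2 := M.sum_prob s a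
    rw [← Finset.add_sum_erase _ _ (Finset.mem_univ s), h1] at h2
    have h3 : ∑ x ∈ Finset.univ.erase s, M.prob s a x = 0 := by linarith
    exact (Finset.sum_eq_zero_iff_of_nonneg fun x _ => M.prob_nonneg s a x).1 h3 t (by simp [hts])

/-- The sequences of joint laws of state and action that obey the dynamics of the MDP. -/
structure Flow (M : MDP) where
  w : ℕ → M.State → M.Action → ℝ
  nonneg : ∀ n s a, 0 ≤ w n s a
  unavailable : ∀ n s a, a ∉ M.avail s → w n s a = 0
  zero : ∀ s, ∑ a, w 0 s a = if s = M.init then 1 else 0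
  succ : ∀ n s, ∑ a, w (n + 1) s a = ∑ t, ∑ a, w n t a * M.prob t a s

namespace Flow

variable {M : MDP} (μ : Flow M)

/-- The probability of being in the state `s` at time `n`. -/
noncomputable def mass (n : ℕ) (s : M.State) : ℝ := ∑ a, μ.w n s a

theorem mass_nonneg (n : ℕ) (s : M.State) : 0 ≤ μ.mass n s :=
  Finset.sum_nonneg fun a _ => μ.nonneg n s a

theorem le_mass (n : ℕ) (s : M.State) (a : M.Action) : μ.w n s a ≤ μ.mass n s :=
  Finset.single_le_sum (fun a _ => μ.nonneg n s a) (Finset.mem_univ a)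

theorem sum_mass (n : ℕ) : ∑ s, μ.mass n s = 1 := by
  induction n with
  | zero => simp [mass, μ.zero]
  | succ n ih =>
    simp only [mass, μ.succ] at ih ⊢
    rw [Finset.sum_comm, ← ih]
    refine Finset.sum_congr rfl fun t _ => ?_
    rw [Finset.sum_comm]
    refine Finset.sum_congr rfl fun a _ => ?_
    rw [← Finset.mul_sum, M.sum_prob, mul_one]

end Flow

namespace Strategy

variable {M : MDP} (σ : Strategy M)

theorem measurableSet_path {N : ℕ} {p : M.State × M.Action → Prop} :
    MeasurableSet {ρ : M.Path | p (ρ N)} :=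
  measurable_pi_apply N ((Set.to_countable {x | p x}).measurableSet)

theorem law_real_state (n : ℕ) (s : M.State) :
    σ.law.real {ρ | (ρ n).1 = s} = ∑ a, σ.law.real {ρ | ρ n = (s, a)} := by
  rw [← measureReal_biUnion_finset]
  · congr 1
    ext ρ
    simp [Prod.ext_iff]
  · intro a _ b _ hab
    simp only [Function.onFun]
    rw [Set.disjoint_left]
    intro ρ h1 h2
    simp only [Set.mem_ofPred_eq] at h1 h2
    rw [h1] at h2
    exact hab (Prod.mk.inj h2).2
  · exact fun a _ => measurableSet_path (p := fun x => x = (s, a))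

/-- The flow of a strategy. -/
noncomputable def flow : Flow M where
  w n s a := σ.law.real {ρ | ρ n = (s, a)}
  nonneg _ _ _ := measureReal_nonneg
  unavailable n s a ha := by simp [measureReal_def, σ.law_unavailable n s a ha]
  zero s := by
    simp only [measureReal_def, law_zero, initPMF, PMF.map_apply, tsum_fintype]
    by_cases hs : s = M.init
    · subst hs
      rw [if_pos rfl, ← sum_toReal_pmf (σ.act [] M.init)]
      refine Finset.sum_congr rfl fun a _ => ?_
      congr 1
      rw [Finset.sum_eq_single a] <;> simp +contextual
      intro b hb h; exact absurd h.symm hb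
    · simp [hs]
  succ n s := by
    rw [← law_real_state, ← Fintype.sum_prod_type']
    have h : {ρ : M.Path | (ρ (n + 1)).1 = s} =
        ⋃ x ∈ (Finset.univ : Finset (M.State × M.Action)),
          {ρ | ρ n = x ∧ (ρ (n + 1)).1 = s} := by
      ext ρ; simp
    rw [h, measureReal_biUnion_finset]
    · refine Finset.sum_congr rfl fun x _ => ?_
      rw [measureReal_def, law_transition, ENNReal.toReal_mul]; rfl
    · intro a _ b _ hab
      simp only [Function.onFun]
      rw [Set.disjoint_left]
      rintro ρ ⟨h1, _⟩ ⟨h2, _⟩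
      exact hab (h1.symm.trans h2)
    · exact fun x _ => (measurableSet_path (p := fun y => y = x)).inter
        (measurableSet_path (p := fun y => y.1 = s))

theorem flow_mass (n : ℕ) (s : M.State) : σ.flow.mass n s = σ.law.real {ρ | (ρ n).1 = s} :=
  (σ.law_real_state n s).symm

end Strategy

theorem MDP.exists_strategy (M : MDP) : Nonempty (Strategy M) :=
  ⟨{ act := fun _ s => PMF.pure (M.avail_nonempty s).choose
     support_subset := fun _ s => by
      rw [PMF.support_pure, Set.singleton_subset_iff]
      exact (M.avail_nonempty s).choose_spec }⟩

namespace Flow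

variable {M : MDP} (μ : Flow M)

open Classical in
/-- The conditional distribution of the action at time `n` in the state `s`. -/
noncomputable def rule (n : ℕ) (s : M.State) : PMF M.Action :=
  if h : μ.mass n s = 0 then PMF.pure (M.avail_nonempty s).choose
  else PMF.ofFintype (fun a => ENNReal.ofReal (μ.w n s a / μ.mass n s)) (by
    rw [← ENNReal.ofReal_sum_of_nonneg
      fun a _ => div_nonneg (μ.nonneg n s a) (μ.mass_nonneg n s), ← Finset.sum_div]
    change ENNReal.ofReal (μ.mass n s / μ.mass n s) = 1
    rw [div_self h, ENNReal.ofReal_one])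

/-- Where the mass vanishes the rule is an arbitrary default, but there the flow vanishes as well.
-/
theorem mass_mul_rule (n : ℕ) (s : M.State) (a : M.Action) :
    μ.mass n s * (μ.rule n s a).toReal = μ.w n s a := by
  unfold rule
  split_ifs with h
  · rw [h, zero_mul]
    exact le_antisymm (μ.nonneg n s a) (h ▸ μ.le_mass n s a)
  · rw [PMF.ofFintype_apply,
      ENNReal.toReal_ofReal (div_nonneg (μ.nonneg n s a) (μ.mass_nonneg n s)),
      mul_div_cancel₀ _ h]

/-- The Markov strategy with a given flow. -/
noncomputable def strategy : Strategy M where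
  act h s := μ.rule h.length s
  support_subset h s a ha := by
    unfold rule at ha
    split_ifs at ha with h0
    · rw [PMF.support_pure, Set.mem_singleton_iff] at ha
      exact ha ▸ (M.avail_nonempty s).choose_spec
    · by_contra hn
      rw [PMF.mem_support_iff, PMF.ofFintype_apply, μ.unavailable _ _ _ hn] at ha
      simp at ha

/-- The weights at time `n` determine the masses at time `n + 1`, and the rule splits these masses
into weights again. Hence as far as marginals are concerned, Markov strategies suffice. -/
theorem strategy_flow_w (n : ℕ) (s : M.State) (a : M.Action) :
    μ.strategy.flow.w n s a = μ.w n s a := by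
  induction n generalizing s a with
  | zero =>
    rw [← μ.mass_mul_rule, mass, μ.zero]
    change (μ.strategy.law {ρ | ρ 0 = (s, a)}).toReal = _
    rw [Strategy.law_zero, Strategy.initPMF, PMF.map_apply, tsum_fintype]
    by_cases hs : s = M.init
    · subst hs
      rw [if_pos rfl, one_mul, Finset.sum_eq_single a] <;> simp +contextual
      · rfl
      · intro b hb h; exact absurd h.symm hb
    · simp [hs]
  | succ n ih =>
    have h := μ.strategy.law_succ_of_markov (g := μ.rule) (fun _ _ => rfl) n s a
    change (μ.strategy.law {ρ | ρ (n + 1) = (s, a)}).toReal = _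
    rw [h, ENNReal.toReal_mul]
    change μ.strategy.law.real _ * _ = _
    rw [← Strategy.flow_mass, ← μ.mass_mul_rule]
    congr 1
    simp only [mass, Flow.succ, ih]

end Flow

/-! ## Reachability of absorbing states -/

namespace Strategy

variable {M : MDP} (σ : Strategy M)

theorem ae_absorbing {s : M.State} (hs : M.Absorbing s) :
    ∀ᵐ ρ ∂σ.law, ∀ n, (ρ n).1 = s → (ρ (n + 1)).1 = s := by
  rw [ae_all_iff]
  intro n
  have h1 : ∀ a t, t ≠ s → σ.law {ρ | ρ n = (s, a) ∧ (ρ (n + 1)).1 = t} = 0 := by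
    intro a t ht
    rw [law_transition]
    by_cases ha : a ∈ M.avail s
    · have := hs.prob_eq ha t
      rw [if_neg ht, MDP.prob_eq_zero_iff] at this
      simp [this]
    · simp [σ.law_unavailable n s a ha]
  have h2 : ∀ᵐ ρ ∂σ.law, ∀ a t, t ≠ s → ¬(ρ n = (s, a) ∧ (ρ (n + 1)).1 = t) := by
    rw [ae_all_iff]; intro a
    rw [ae_all_iff]; intro t
    by_cases ht : t = s
    · simp [ht]
    · simp only [ne_eq, ht, not_false_eq_true, true_implies]
      rw [ae_iff]
      simpa using h1 a t ht
  filter_upwards [h2] with ρ hρ hn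
  by_contra hc
  exact hρ (ρ n).2 _ hc ⟨Prod.ext hn rfl, rfl⟩

theorem ae_absorbing_of_le {T : Finset M.State} (hT : ∀ s ∈ T, M.Absorbing s) :
    ∀ᵐ ρ ∂σ.law, ∀ m n, m ≤ n → (ρ m).1 ∈ T → (ρ n).1 = (ρ m).1 := by
  have h : ∀ᵐ ρ ∂σ.law, ∀ s ∈ T, ∀ n, (ρ n).1 = s → (ρ (n + 1)).1 = s :=
    (Finset.eventually_all T).2 fun s hs => σ.ae_absorbing (hT s hs)
  filter_upwards [h] with ρ hρ m n hmn hm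
  induction n, hmn using Nat.le_induction with
  | base => rfl
  | succ n _ ih => exact hρ _ hm n ih

theorem law_real_mem (n : ℕ) (T : Finset M.State) :
    σ.law.real {ρ | (ρ n).1 ∈ T} = ∑ s ∈ T, σ.flow.mass n s := by
  simp only [flow_mass]
  rw [← measureReal_biUnion_finset]
  · congr 1
    ext ρ
    simp
  · intro a _ b _ hab
    simp only [Function.onFun]
    rw [Set.disjoint_left]
    intro ρ h1 h2
    exact hab (h1.symm.trans h2)
  · exact fun a _ => measurableSet_path (p := fun x => x.1 = a)

theorem measurableSet_reach (T : Finset M.State) : MeasurableSet (M.reach T) := by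
  have : M.reach T = ⋃ n, {ρ : M.Path | (ρ n).1 ∈ T} := by ext ρ; simp [MDP.reach]
  rw [this]
  exact MeasurableSet.iUnion fun n => measurableSet_path (p := fun x => x.1 ∈ T)

/-- To have visited an absorbing set by time `n` is almost surely the same as to be in it at time
`n`; the rest is continuity from below. -/
theorem tendsto_mass_reach {T : Finset M.State} (hT : ∀ s ∈ T, M.Absorbing s) :
    Tendsto (fun n => ∑ s ∈ T, σ.flow.mass n s) atTop (𝓝 (σ.law.real (M.reach T))) := by
  have h1 : M.reach T = ⋃ n, {ρ : M.Path | ∃ j ≤ n, (ρ j).1 ∈ T} := by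
    ext ρ
    simp only [MDP.reach, Set.mem_ofPred_eq, Set.mem_iUnion]
    exact ⟨fun ⟨j, hj⟩ => ⟨j, j, le_rfl, hj⟩, fun ⟨_, j, _, hj⟩ => ⟨j, hj⟩⟩
  have h2 : Monotone fun n => {ρ : M.Path | ∃ j ≤ n, (ρ j).1 ∈ T} :=
    fun m n hmn ρ ⟨j, hj, h⟩ => ⟨j, hj.trans hmn, h⟩
  have h3 := tendsto_measure_iUnion_atTop (μ := σ.law) h2
  rw [← h1] at h3
  have h4 := (ENNReal.tendsto_toReal (measure_ne_top σ.law _)).comp h3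
  refine h4.congr fun n => ?_
  rw [← law_real_mem]
  refine measureReal_congr ?_
  filter_upwards [σ.ae_absorbing_of_le hT] with ρ hρ
  refine propext ⟨fun ⟨j, hj, h⟩ => ?_, fun h => ⟨n, le_rfl, h⟩⟩
  change (ρ n).1 ∈ T
  rw [hρ j n hj h]; exact h

theorem law_reach_eq_one {T : Finset M.State} (hT : ∀ s ∈ T, M.Absorbing s)
    (h : ∀ s ∉ T, Tendsto (fun n => σ.flow.mass n s) atTop (𝓝 0)) :
    σ.law (M.reach T) = 1 := by
  have h1 : Tendsto (fun n => ∑ s ∈ Tᶜ, σ.flow.mass n s) atTop (𝓝 0) := by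
    have := tendsto_finsetSum Tᶜ fun s hs => h s (Finset.mem_compl.1 hs)
    simpa using this
  have h2 : Tendsto (fun _ : ℕ => (1 : ℝ)) atTop (𝓝 (σ.law.real (M.reach T) + 0)) := by
    refine ((σ.tendsto_mass_reach hT).add h1).congr fun n => ?_
    rw [Finset.sum_add_sum_compl, Flow.sum_mass]
  have h3 := tendsto_nhds_unique h2 tendsto_const_nhds
  rw [add_zero, measureReal_def] at h3
  exact (ENNReal.toReal_eq_one_iff _).1 h3

/-- Masses are additive in the set of states, and the limit inherits this. -/
theorem law_real_reach {T : Finset M.State} (hT : ∀ s ∈ T, M.Absorbing s) :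
    σ.law.real (M.reach T) = ∑ s ∈ T, σ.law.real (M.reach {s}) := by
  refine tendsto_nhds_unique (σ.tendsto_mass_reach hT) (tendsto_finsetSum T fun s hs => ?_)
  simpa using σ.tendsto_mass_reach (T := {s}) (by simpa using hT s hs)

end Strategy

end CPTReach

namespace CPTReach

open Filter Topology

/-! ## The CPT-value in terms of the outcome distribution -/

namespace WRObjective

variable {M : MDP} (Φ : WRObjective M)

theorem value_mem_outcomes (ρ : M.Path) : Φ.value ρ ∈ Φ.outcomes := by
  classical
  unfold value outcomes
  split_ifs with h
  · exact Finset.mem_insert_of_mem (Finset.mem_image_of_mem _ (Nat.find_spec h))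
  · exact Finset.mem_insert_self _ _

theorem measurableSet_value_eq (o : ℚ) : MeasurableSet {ρ | Φ.value ρ = o} := by
  classical
  -- Split by the first time at which a target is visited; paths without such a time have the value
  -- `0`.
  have h : {ρ | Φ.value ρ = o} = (⋃ n, ({ρ : M.Path | (ρ n).1 ∈ Φ.targets ∧
      Φ.reward (ρ n).1 = o} ∩ ⋂ j ∈ Finset.range n, {ρ : M.Path | (ρ j).1 ∉ Φ.targets})) ∪
      ((M.reach Φ.targets)ᶜ ∩ {_ρ : M.Path | o = 0}) := by
    ext ρ
    simp only [Set.mem_ofPred_eq, Set.mem_union, Set.mem_iUnion, Set.mem_inter_iff,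
      Set.mem_iInter, Finset.mem_range, Set.mem_compl_iff, MDP.reach]
    constructor
    · intro hv
      unfold value at hv
      split_ifs at hv with hr
      · exact Or.inl ⟨Nat.find hr, ⟨Nat.find_spec hr, hv⟩, fun j hj => Nat.find_min hr hj⟩
      · exact Or.inr ⟨hr, hv.symm⟩
    · rintro (⟨n, ⟨hn, hv⟩, hj⟩ | ⟨hr, h0⟩)
      · have hr : ∃ i, (ρ i).1 ∈ Φ.targets := ⟨n, hn⟩
        have : Nat.find hr = n := (Nat.find_eq_iff hr).2 ⟨hn, hj⟩
        rw [value, dif_pos hr, this, hv]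
      · rw [value, dif_neg hr, h0]
  rw [h]
  refine MeasurableSet.union (MeasurableSet.iUnion fun n => MeasurableSet.inter ?_
    (Finset.measurableSet_biInter _ fun j _ => ?_)) (MeasurableSet.inter ?_ (.const _))
  · exact Strategy.measurableSet_path
      (p := fun x => x.1 ∈ Φ.targets ∧ Φ.reward x.1 = o)
  · exact Strategy.measurableSet_path (p := fun x => x.1 ∉ Φ.targets)
  · exact (Strategy.measurableSet_reach _).compl

/-- The distribution of the outcomes under a strategy. -/
noncomputable def outcomeProb (σ : Strategy M) (i : Fin Φ.numOutcomes) : ℝ :=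
  σ.law.real {ρ | Φ.value ρ = Φ.outcomeVec i}

theorem image_outcomeVec : Finset.univ.map (Φ.outcomes.orderEmbOfFin rfl).toEmbedding =
    Φ.outcomes := Φ.outcomes.map_orderEmbOfFin_univ rfl

theorem outcomeVec_strictMono : StrictMono Φ.outcomeVec := (Φ.outcomes.orderEmbOfFin rfl).strictMono

theorem sum_outcomes {β : Type*} [AddCommMonoid β] (f : ℚ → β) (p : ℚ → Prop) [DecidablePred p] :
    ∑ o ∈ Φ.outcomes with p o, f o =
      ∑ i with p (Φ.outcomeVec i), f (Φ.outcomeVec i) := by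
  rw [Finset.sum_filter, Finset.sum_filter]
  conv_lhs => rw [← Φ.image_outcomeVec]
  rw [Finset.sum_map]
  rfl

theorem law_real_value (σ : Strategy M) (p : ℚ → Prop) [DecidablePred p] :
    σ.law.real {ρ | p (Φ.value ρ)} = ∑ i with p (Φ.outcomeVec i), Φ.outcomeProb σ i := by
  refine Eq.trans ?_ (Φ.sum_outcomes (fun o => σ.law.real {ρ | Φ.value ρ = o}) p)
  rw [← measureReal_biUnion_finset]
  · congr 1
    ext ρ
    simp [Φ.value_mem_outcomes]
  · intro a _ b _ hab
    simp only [Function.onFun]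
    rw [Set.disjoint_left]
    intro ρ h1 h2
    exact hab (h1.symm.trans h2)
  · exact fun o _ => Φ.measurableSet_value_eq o

theorem sum_outcomeProb (σ : Strategy M) : ∑ i, Φ.outcomeProb σ i = 1 := by
  have h := Φ.law_real_value σ (fun _ => True)
  simp only [Finset.filter_true] at h
  rw [← h]
  exact probReal_univ

theorem outcomeProb_nonneg (σ : Strategy M) (i : Fin Φ.numOutcomes) : 0 ≤ Φ.outcomeProb σ i :=
  measureReal_nonneg

/-- Almost surely, the value is `o ≠ 0` iff a state with reward `o` is reached. -/
theorem outcomeProb_eq (σ : Strategy M) (i : Fin Φ.numOutcomes) (hi : Φ.outcomeVec i ≠ 0) :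
    Φ.outcomeProb σ i = ∑ s ∈ Φ.targets with Φ.reward s = Φ.outcomeVec i,
      σ.law.real (M.reach {s}) := by
  classical
  have hab : ∀ s ∈ {s ∈ Φ.targets | Φ.reward s = Φ.outcomeVec i}, M.Absorbing s :=
    fun s hs => Φ.absorbing s (Finset.mem_filter.1 hs).1
  rw [← σ.law_real_reach hab]
  refine measureReal_congr ?_
  filter_upwards [σ.ae_absorbing_of_le Φ.absorbing] with ρ hρ
  refine propext ?_
  change Φ.value ρ = Φ.outcomeVec i ↔ ∃ j, (ρ j).1 ∈ _
  unfold value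
  split_ifs with h
  · constructor
    · exact fun hv => ⟨Nat.find h, Finset.mem_filter.2 ⟨Nat.find_spec h, hv⟩⟩
    · rintro ⟨j, hj⟩
      obtain ⟨hj1, hj2⟩ := Finset.mem_filter.1 hj
      rw [← hj2, hρ _ j (Nat.find_min' h hj1) (Nat.find_spec h)]
  · refine ⟨fun h0 => absurd h0.symm hi, ?_⟩
    rintro ⟨j, hj⟩
    exact absurd ⟨j, (Finset.mem_filter.1 hj).1⟩ h

end WRObjective

namespace CPT

variable (C : CPT) {M : MDP} (Φ : WRObjective M)

/-- Since `outcomeVec` is strictly increasing, the tail events of the value correspond to intervals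
of indices, and their probabilities are the partial sums inside the decision weights. -/
theorem strategyValue_eq_cpt (σ : Strategy M) :
    C.strategyValue Φ σ = C.cpt (fun i => (Φ.outcomeVec i : ℝ)) (Φ.outcomeProb σ) := by
  have hge : ∀ i, σ.law.real {ρ | Φ.outcomeVec i ≤ Φ.value ρ} =
      Φ.outcomeProb σ i + gainRank (Φ.outcomeProb σ) i := fun i => by
    rw [Φ.law_real_value σ (fun q => Φ.outcomeVec i ≤ q), gainRank, ← Finset.sum_cons (by simp),
      Finset.cons_eq_insert, Finset.Ioi_insert]
    refine Finset.sum_congr ?_ fun _ _ => rfl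
    ext m; simp [Φ.outcomeVec_strictMono.le_iff_le]
  have hgt : ∀ i, σ.law.real {ρ | Φ.outcomeVec i < Φ.value ρ} =
      gainRank (Φ.outcomeProb σ) i := fun i => by
    rw [Φ.law_real_value σ (fun q => Φ.outcomeVec i < q), gainRank]
    refine Finset.sum_congr ?_ fun _ _ => rfl
    ext m; simp [Φ.outcomeVec_strictMono.lt_iff_lt]
  have hle : ∀ i, σ.law.real {ρ | Φ.value ρ ≤ Φ.outcomeVec i} =
      Φ.outcomeProb σ i + lossRank (Φ.outcomeProb σ) i := fun i => by
    rw [Φ.law_real_value σ (fun q => q ≤ Φ.outcomeVec i), lossRank, ← Finset.sum_cons (by simp),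
      Finset.cons_eq_insert, Finset.Iio_insert]
    refine Finset.sum_congr ?_ fun _ _ => rfl
    ext m; simp [Φ.outcomeVec_strictMono.le_iff_le]
  have hlt : ∀ i, σ.law.real {ρ | Φ.value ρ < Φ.outcomeVec i} =
      lossRank (Φ.outcomeProb σ) i := fun i => by
    rw [Φ.law_real_value σ (fun q => q < Φ.outcomeVec i), lossRank]
    refine Finset.sum_congr ?_ fun _ _ => rfl
    ext m; simp [Φ.outcomeVec_strictMono.lt_iff_lt]
  have e1 := Φ.sum_outcomes (fun o => C.u o *
    (C.wPos (σ.law.real {ρ | o ≤ Φ.value ρ}) - C.wPos (σ.law.real {ρ | o < Φ.value ρ})))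
    (fun o => 0 < o)
  have e2 := Φ.sum_outcomes (fun o => C.u o *
    (C.wNeg (σ.law.real {ρ | Φ.value ρ ≤ o}) - C.wNeg (σ.law.real {ρ | Φ.value ρ < o})))
    (fun o => o < 0)
  rw [strategyValue, e1, e2, cpt]
  simp only [hge, hgt, hle, hlt, Finset.sum_filter, ← Finset.sum_add_distrib]
  refine Finset.sum_congr rfl fun i _ => ?_
  simp only [decisionWeight, Rat.cast_pos, Rat.cast_lt_zero]
  rcases lt_trichotomy (Φ.outcomeVec i) 0 with h | h | h
  · simp [h, h.not_gt]
  · simp [h]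
  · simp [h, h.not_gt]

/-- A decision weight is zero or a difference of two numbers in the unit interval. -/
theorem cpt_le {k : ℕ} (o : Fin k → ℝ) {p : Fin k → ℝ} (h0 : ∀ i, 0 ≤ p i) (h1 : ∑ i, p i = 1) :
    C.cpt o p ≤ ∑ i, |C.u (o i)| := by
  have hmem : ∀ T : Finset (Fin k), ∑ m ∈ T, p m ∈ Set.Icc (0 : ℝ) 1 := fun T =>
    ⟨Finset.sum_nonneg fun i _ => h0 i,
      h1 ▸ Finset.sum_le_sum_of_subset_of_nonneg (Finset.subset_univ T) fun i _ _ => h0 i⟩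
  refine Finset.sum_le_sum fun i _ => ?_
  refine (le_abs_self _).trans ?_
  rw [abs_mul]
  refine mul_le_of_le_one_right (abs_nonneg _) ?_
  have hsub : ∀ x ∈ Set.Icc (0 : ℝ) 1, ∀ y ∈ Set.Icc (0 : ℝ) 1, |x - y| ≤ 1 :=
    fun x hx y hy => abs_sub_le_iff.2 ⟨by linarith [hx.2, hy.1], by linarith [hx.1, hy.2]⟩
  unfold decisionWeight gainRank lossRank
  split_ifs
  · refine hsub _ (C.wPos_maps ?_) _ (C.wPos_maps (hmem _))
    rw [← Finset.sum_cons (by simp)]; exact hmem _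
  · refine hsub _ (C.wNeg_maps ?_) _ (C.wNeg_maps (hmem _))
    rw [← Finset.sum_cons (by simp)]; exact hmem _
  · simp

end CPT

end CPTReach

namespace CPTReach

open Relation

/-! ## End components -/

/-- A repetition among the iterates would persist. So if the last step still changed the set, every
earlier step added an element, and the set would have outgrown the type. -/
theorem iterate_card_fixed {α : Type*} [Fintype α] {T : Finset α → Finset α}
    (hT : ∀ X, X ⊆ T X) (X : Finset α) :
    T (T^[Fintype.card α] X) = T^[Fintype.card α] X := by
  by_contra hne
  have hstep : ∀ k ≤ Fintype.card α, T^[k] X ≠ T^[k + 1] X := by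
    intro k hk he
    apply hne
    have hst : ∀ j, T^[k + j] X = T^[k] X := by
      intro j
      induction j with
      | zero => rfl
      | succ j ih => rw [← add_assoc, Function.iterate_succ_apply', ih,
          ← Function.iterate_succ_apply' T k X, ← he]
    obtain ⟨j, hj⟩ := Nat.exists_eq_add_of_le hk
    rw [hj, hst, ← Function.iterate_succ_apply' T]
    exact he.symm
  have hcard : ∀ k ≤ Fintype.card α + 1, k ≤ (T^[k] X).card := by
    intro k
    induction k with
    | zero => simp
    | succ k ih =>
      intro hk
      have h1 := ih (by omega)
      have h2 : T^[k] X ⊂ T^[k + 1] X :=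
        Finset.ssubset_iff_subset_ne.2
          ⟨by rw [Function.iterate_succ_apply']; exact hT _, hstep k (by omega)⟩
      have := Finset.card_lt_card h2
      omega
  have := (hcard _ le_rfl).trans (Finset.card_le_univ _)
  omega

theorem exists_pos_lower_bound {ι : Type*} [Fintype ι] (f : ι → ℝ) (hf : ∀ i, 0 ≤ f i) :
    ∃ δ, 0 < δ ∧ δ ≤ 1 ∧ ∀ i, f i ≠ 0 → δ ≤ f i := by
  classical
  -- The extra index `none` with the value `1` makes the index set non-empty and caps the bound at
  -- `1`; vanishing entries are also counted as `1`.
  obtain ⟨o, _, ho⟩ := Finset.exists_min_image (Finset.univ : Finset (Option ι))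
    (fun o => o.elim 1 fun i => if f i = 0 then 1 else f i) ⟨none, Finset.mem_univ _⟩
  refine ⟨_, ?_, ho none (Finset.mem_univ _), fun i hi => ?_⟩
  · cases o with
    | none => exact one_pos
    | some i =>
      simp only [Option.elim_some]
      split_ifs with h
      · exact one_pos
      · exact lt_of_le_of_ne (hf i) (Ne.symm h)
  · have := ho (some i) (Finset.mem_univ _)
    rwa [Option.elim_some (a := i), if_neg hi] at this

namespace MDP

variable (M : MDP) (F : Finset M.State)

/-- The graph of the state-action pairs in `E`. -/
def Edge (E : Set (M.State × M.Action)) (s t : M.State) : Prop :=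
  ∃ a, (s, a) ∈ E ∧ M.prob s a t ≠ 0

theorem Edge.mono {M : MDP} {E E' : Set (M.State × M.Action)} (h : E ⊆ E') {s t : M.State} :
    M.Edge E s t → M.Edge E' s t := fun ⟨a, ha, hp⟩ => ⟨a, h ha, hp⟩

/-- A union of end components that avoid `F`, given as a set of state-action pairs. -/
def IsEndPairs (E : Set (M.State × M.Action)) : Prop :=
  ∀ s a, (s, a) ∈ E → a ∈ M.avail s ∧ s ∉ F ∧
    ∀ t, M.prob s a t ≠ 0 → ReflTransGen (M.Edge E) t s

/-- The state-action pairs that belong to some end component that avoids `F`. -/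
def inner : Set (M.State × M.Action) := ⋃₀ {E | M.IsEndPairs F E}

theorem IsEndPairs.subset_inner {M : MDP} {F : Finset M.State} {E : Set (M.State × M.Action)}
    (h : M.IsEndPairs F E) : E ⊆ M.inner F := Set.subset_sUnion_of_mem h

theorem isEndPairs_inner : M.IsEndPairs F (M.inner F) := by
  rintro s a ⟨E, hE, hsa⟩
  obtain ⟨h1, h2, h3⟩ := hE s a hsa
  exact ⟨h1, h2, fun t ht => ReflTransGen.mono (fun _ _ =>
    Edge.mono (IsEndPairs.subset_inner hE)) _ _ (h3 t ht)⟩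

/-- Two states are connected if they belong to the same maximal end component or are equal. -/
def Conn : M.State → M.State → Prop := ReflTransGen (M.Edge (M.inner F))

/-- The state-action pairs outside `F` that belong to no end component. -/
def Outer (s : M.State) (a : M.Action) : Prop :=
  a ∈ M.avail s ∧ s ∉ F ∧ (s, a) ∉ M.inner F

variable {M F}

theorem conn_of_inner {s t : M.State} {a : M.Action} (h : (s, a) ∈ M.inner F)
    (ht : M.prob s a t ≠ 0) : M.Conn F s t := ReflTransGen.single ⟨a, h, ht⟩

@[refl] theorem Conn.refl (s : M.State) : M.Conn F s s := ReflTransGen.refl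

/-- Each successor of an inner pair has a path back along inner edges. -/
theorem Conn.symm {s t : M.State} (h : M.Conn F s t) : M.Conn F t s := by
  induction h with
  | refl => exact ReflTransGen.refl
  | tail _ h ih =>
    obtain ⟨a, ha, hp⟩ := h
    exact ((M.isEndPairs_inner F _ a ha).2.2 _ hp).trans ih

theorem Conn.trans {s t u : M.State} (h : M.Conn F s t) (h' : M.Conn F t u) : M.Conn F s u :=
  ReflTransGen.trans h h'

theorem conn_comm {s t : M.State} : M.Conn F s t ↔ M.Conn F t s := ⟨Conn.symm, Conn.symm⟩

/-- A state without inner actions is only connected to itself. -/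
theorem Conn.eq_of_forall_not_inner {s t : M.State} (hs : ∀ a, (s, a) ∉ M.inner F)
    (h : M.Conn F s t) : t = s := by
  rcases ReflTransGen.cases_head h with h | ⟨_, ⟨a, ha, _⟩, _⟩
  · exact h.symm
  · exact absurd ha (hs a)

theorem not_inner_of_mem {s : M.State} (hs : s ∈ F) (a : M.Action) : (s, a) ∉ M.inner F :=
  fun h => (M.isEndPairs_inner F s a h).2.1 hs

theorem Conn.eq_of_mem {s t : M.State} (hs : s ∈ F) (h : M.Conn F s t) : t = s :=
  h.eq_of_forall_not_inner (not_inner_of_mem hs)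

theorem Conn.mem_iff {s t : M.State} (h : M.Conn F s t) : s ∈ F ↔ t ∈ F :=
  ⟨fun hs => h.eq_of_mem hs ▸ hs, fun ht => h.symm.eq_of_mem ht ▸ ht⟩

open Classical in
/-- One step of the attractor computation. -/
noncomputable def attract (F U : Finset M.State) : Finset M.State :=
  U ∪ Finset.univ.filter fun s => ∀ t a, M.Conn F s t → M.Outer F t a → ∃ u ∈ U, M.prob t a u ≠ 0

/-- The condition in `attract` ranges over a whole class, so every stage is a union of classes; `F`
is one because targets are only connected to themselves. -/
theorem attract_conn (k : ℕ) {s t : M.State} (h : M.Conn F s t)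
    (hs : s ∈ (attract F)^[k] F) : t ∈ (attract F)^[k] F := by
  classical
  induction k generalizing s t with
  | zero => exact h.mem_iff.1 hs
  | succ k ih =>
    rw [Function.iterate_succ_apply'] at hs ⊢
    rcases Finset.mem_union.1 hs with hs | hs
    · exact Finset.mem_union_left _ (ih h hs)
    · refine Finset.mem_union_right _ (Finset.mem_filter.2 ⟨Finset.mem_univ _, ?_⟩)
      exact fun u a hu ho => (Finset.mem_filter.1 hs).2 u a (h.trans hu) ho

/-- A set that is closed under some outer action in each of its classes contains a bottom strongly
connected component, which is an end component with an outer action. -/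
theorem not_trap {X : Set M.State} (hne : X.Nonempty)
    (hconn : ∀ s t, M.Conn F s t → s ∈ X → t ∈ X)
    (hX : ∀ s ∈ X, ∃ t a, M.Conn F s t ∧ M.Outer F t a ∧ ∀ u, M.prob t a u ≠ 0 → u ∈ X) :
    False := by
  classical
  let G : Set (M.State × M.Action) := {p | p.1 ∈ X ∧
    (p ∈ M.inner F ∨ M.Outer F p.1 p.2 ∧ ∀ u, M.prob p.1 p.2 u ≠ 0 → u ∈ X)}
  have hGX : ∀ s t, M.Edge G s t → t ∈ X := by
    rintro s t ⟨a, ⟨hs, h | h⟩, hp⟩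
    · exact hconn s t (conn_of_inner h hp) hs
    · exact h.2 t hp
  let D : M.State → Finset M.State := fun x =>
    Finset.univ.filter fun y => ReflTransGen (M.Edge G) x y
  have hD : ∀ x y, y ∈ D x ↔ ReflTransGen (M.Edge G) x y := fun x y => by simp [D]
  -- A state with a reachable set of minimal size lies in a bottom strongly connected component:
  -- whatever it reaches leads back to it.
  obtain ⟨x, hxX, hmin⟩ := Finset.exists_min_image (Finset.univ.filter fun x => x ∈ X)
    (fun x => (D x).card) (by obtain ⟨x, hx⟩ := hne; exact ⟨x, by simpa using hx⟩)
  have hxX : x ∈ X := by simpa using hxX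
  have hDX : ∀ y ∈ D x, y ∈ X := fun y hy => by
    rcases ReflTransGen.cases_tail ((hD x y).1 hy) with h | ⟨z, _, h⟩
    · exact h ▸ hxX
    · exact hGX z y h
  have hback : ∀ y ∈ D x, ReflTransGen (M.Edge G) y x := fun y hy => by
    have hsub : D y ⊆ D x := fun z hz =>
      (hD x z).2 (((hD x y).1 hy).trans ((hD y z).1 hz))
    have heq := Finset.eq_of_subset_of_card_le hsub (hmin y (by simpa using hDX y hy))
    exact (hD y x).1 (heq ▸ (hD x x).2 ReflTransGen.refl)
  let G' : Set (M.State × M.Action) := {p | p ∈ G ∧ p.1 ∈ D x}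
  have hlift : ∀ t s, t ∈ D x → ReflTransGen (M.Edge G) t s →
      ReflTransGen (M.Edge G') t s := by
    intro t s ht h
    induction h using ReflTransGen.head_induction_on with
    | refl => exact ReflTransGen.refl
    | @head t u h1 _ ih =>
      obtain ⟨a, ha, hp⟩ := h1
      refine ReflTransGen.head ⟨a, ⟨ha, ht⟩, hp⟩
        (ih ((hD x u).2 (((hD x t).1 ht).tail ⟨a, ha, hp⟩)))
  have hG' : M.IsEndPairs F G' := by
    rintro s a ⟨hG, hs⟩
    refine ⟨?_, ?_, fun t ht => ?_⟩
    · rcases hG.2 with h | h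
      · exact (M.isEndPairs_inner F s a h).1
      · exact h.1.1
    · rcases hG.2 with h | h
      · exact (M.isEndPairs_inner F s a h).2.1
      · exact h.1.2.1
    · have hst : M.Edge G s t := ⟨a, hG, ht⟩
      have htD : t ∈ D x := (hD x t).2 (((hD x s).1 hs).tail hst)
      exact hlift t s htD ((hback t htD).trans ((hD x s).1 hs))
  obtain ⟨t, a, hxt, ho, hu⟩ := hX x hxX
  have hlift' : ∀ s, M.Conn F x s → s ∈ D x := by
    intro s h
    rw [hD]
    induction h with
    | refl => exact ReflTransGen.refl
    | @tail s u h1 h2 ih =>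
      obtain ⟨b, hb, hp⟩ := h2
      exact ih.tail ⟨b, ⟨hconn x s h1 hxX, Or.inl hb⟩, hp⟩
  -- The outer pair `(t, a)` starts in the bottom component and stays in it, so it belongs to an end
  -- component after all.
  exact ho.2.2 (hG'.subset_inner
    ⟨⟨hconn x t hxt hxX, Or.inr ⟨ho, hu⟩⟩, hlift' t hxt⟩)

/-- The complement of the stationary attractor satisfies the hypotheses of `not_trap`: each of its
states has in its class an outer action whose successors all stay in the complement. -/
theorem attract_eq_univ (s : M.State) : s ∈ (attract F)^[Fintype.card M.State] F := by
  classical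
  by_contra hs
  set U := (attract F)^[Fintype.card M.State] F with hU
  have hfix : attract F U = U :=
    iterate_card_fixed (T := attract F) (fun X => Finset.subset_union_left) F
  refine not_trap (F := F) (X := {x | x ∉ U}) ⟨s, hs⟩
    (fun x y hxy hx hy => hx (attract_conn _ hxy.symm hy)) fun x hx => ?_
  have hx' : x ∉ attract F U := by rw [hfix]; exact hx
  simp only [attract, Finset.mem_union, Finset.mem_filter, Finset.mem_univ, true_and, not_or,
    not_forall, not_exists, not_and] at hx'
  obtain ⟨_, t, a, h1, h2, h3⟩ := hx'
  exact ⟨t, a, h1, h2, fun u hu hmem => h3 u hmem hu⟩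

/-- A bounded function that is constant on end components and increases in expectation whenever an
outer action is taken. -/
theorem exists_potential (M : MDP) (F : Finset M.State) :
    ∃ (φ : M.State → ℝ) (c : ℝ), 0 < c ∧ (∀ s, 0 ≤ φ s ∧ φ s ≤ 1) ∧
      (∀ s t, M.Conn F s t → φ s = φ t) ∧ (∀ s ∉ F, φ s < 1) ∧
      ∀ s a, M.Outer F s a → φ s + c ≤ ∑ t, M.prob s a t * φ t := by
  classical
  obtain ⟨δ, hδ0, hδ1, hδ⟩ := exists_pos_lower_bound
    (fun x : M.State × M.Action × M.State => M.prob x.1 x.2.1 x.2.2)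
    (fun x => M.prob_nonneg _ _ _)
  have hex : ∀ s, ∃ k, s ∈ (attract F)^[k] F := fun s => ⟨_, attract_eq_univ s⟩
  let rk : M.State → ℕ := fun s => Nat.find (hex s)
  have hrk : ∀ s, s ∈ (attract F)^[rk s] F := fun s => Nat.find_spec (hex s)
  have hrk_le : ∀ s k, s ∈ (attract F)^[k] F → rk s ≤ k := fun s k h => Nat.find_min' _ h
  have hrkN : ∀ s, rk s ≤ Fintype.card M.State := fun s => hrk_le s _ (attract_eq_univ s)
  have he0 : 0 < δ / 2 := by positivity
  have he1 : δ / 2 < 1 := by linarith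
  have hpos : ∀ s ∉ F, rk s ≠ 0 := fun s hs h => hs (by simpa [h] using hrk s)
  -- An outer action at a state of rank `k + 1` leads with probability at least `δ` to rank at most
  -- `k`. So the expectation of `φ` is at least `δ * (δ / 2) ^ k`, twice the value at the state, and
  -- the gain is at least the smallest value that `φ` can take.
  refine ⟨fun s => (δ / 2) ^ rk s, (δ / 2) ^ Fintype.card M.State, by positivity,
    fun s => ⟨by positivity, pow_le_one₀ he0.le he1.le⟩, fun s t h => ?_,
    fun s hs => pow_lt_one₀ he0.le he1 (hpos s hs), fun s a ho => ?_⟩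
  · have : rk s = rk t := le_antisymm (hrk_le s _ (attract_conn _ h.symm (hrk t)))
      (hrk_le t _ (attract_conn _ h (hrk s)))
    simp only [this]
  · obtain ⟨k, hk⟩ := Nat.exists_eq_succ_of_ne_zero (hpos s ho.2.1)
    have hs := hrk s
    rw [hk, Function.iterate_succ_apply'] at hs
    rcases Finset.mem_union.1 hs with hs | hs
    · exact absurd (hrk_le s k hs) (by omega)
    obtain ⟨u, hu, hp⟩ := (Finset.mem_filter.1 hs).2 s a (Conn.refl s) ho
    have h1 : δ * (δ / 2) ^ k ≤ M.prob s a u * (δ / 2) ^ rk u :=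
      mul_le_mul (hδ (s, a, u) hp) (pow_le_pow_of_le_one he0.le he1.le (hrk_le u k hu))
        (by positivity) (M.prob_nonneg _ _ _)
    have h2 : M.prob s a u * (δ / 2) ^ rk u ≤ ∑ t, M.prob s a t * (δ / 2) ^ rk t :=
      Finset.single_le_sum (f := fun t => M.prob s a t * (δ / 2) ^ rk t)
        (fun t _ => mul_nonneg (M.prob_nonneg _ _ _) (by positivity)) (Finset.mem_univ u)
    have h3 : (δ / 2) ^ Fintype.card M.State ≤ (δ / 2) ^ rk s :=
      pow_le_pow_of_le_one he0.le he1.le (hrkN s)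
    have h4 : (δ / 2) ^ rk s = δ / 2 * (δ / 2) ^ k := by rw [hk, pow_succ]; ring
    change (δ / 2) ^ rk s + _ ≤ ∑ t, M.prob s a t * (δ / 2) ^ rk t
    linarith

end MDP

end CPTReach

namespace CPTReach

open Filter Topology

/-! ## Plans: expected numbers of outer actions -/

namespace MDP

variable (M : MDP) (F : Finset M.State)

open Classical in
/-- The sum of `f` over the maximal end component of `s`. -/
noncomputable def classSum (s : M.State) (f : M.State → ℝ) : ℝ :=
  ∑ t with M.Conn F s t, f t

/-- The expected number of entries into `s`, if `x` gives the expected numbers of outer actions. -/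
noncomputable def inflow (x : M.State → M.Action → ℝ) (s : M.State) : ℝ :=
  (if s = M.init then 1 else 0) + ∑ t, ∑ a, x t a * M.prob t a s

/-- Expected numbers of outer actions that are consistent with the dynamics. -/
structure IsPlan (x : M.State → M.Action → ℝ) : Prop where
  nonneg : ∀ s a, 0 ≤ x s a
  supp : ∀ s a, ¬ M.Outer F s a → x s a = 0
  -- Only an inequality, since mass may remain in an end component for ever; a non-target state
  -- without inner actions must be left at once, whence the equation in the next field.
  le : ∀ s ∉ F, M.classSum F s (fun t => ∑ a, x t a) ≤ M.classSum F s (M.inflow x)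
  eq : ∀ s ∉ F, (∀ a, (s, a) ∉ M.inner F) → ∑ a, x s a = M.inflow x s

variable {M F}

theorem classSum_of_forall_not_inner {s : M.State} (hs : ∀ a, (s, a) ∉ M.inner F)
    (f : M.State → ℝ) : M.classSum F s f = f s := by
  classical
  unfold classSum
  rw [Finset.sum_eq_single_of_mem s (by simp [Conn.refl])]
  intro t ht hts
  exact absurd ((Finset.mem_filter.1 ht).2.eq_of_forall_not_inner hs) hts

theorem classSum_mono {s : M.State} {f g : M.State → ℝ} (h : ∀ t, M.Conn F s t → f t ≤ g t) :
    M.classSum F s f ≤ M.classSum F s g := by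
  classical
  exact Finset.sum_le_sum fun t ht => h t (Finset.mem_filter.1 ht).2

theorem classSum_congr {s : M.State} {f g : M.State → ℝ} (h : ∀ t, M.Conn F s t → f t = g t) :
    M.classSum F s f = M.classSum F s g :=
  le_antisymm (classSum_mono fun t ht => (h t ht).le) (classSum_mono fun t ht => (h t ht).ge)

theorem classSum_eq_of_conn {s t : M.State} (h : M.Conn F s t) (f : M.State → ℝ) :
    M.classSum F s f = M.classSum F t f := by
  classical
  refine Finset.sum_congr (Finset.filter_congr fun u _ => ?_) fun _ _ => rfl
  exact ⟨fun hu => h.symm.trans hu, fun hu => h.trans hu⟩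

theorem classSum_add (s : M.State) (f g : M.State → ℝ) :
    M.classSum F s (fun t => f t + g t) = M.classSum F s f + M.classSum F s g :=
  Finset.sum_add_distrib

theorem classSum_sub (s : M.State) (f g : M.State → ℝ) :
    M.classSum F s (fun t => f t - g t) = M.classSum F s f - M.classSum F s g :=
  Finset.sum_sub_distrib _ _

theorem classSum_nonneg {s : M.State} {f : M.State → ℝ} (h : ∀ t, M.Conn F s t → 0 ≤ f t) :
    0 ≤ M.classSum F s f := by
  classical
  exact Finset.sum_nonneg fun t ht => h t (Finset.mem_filter.1 ht).2

theorem le_classSum {s t : M.State} {f : M.State → ℝ} (h : ∀ t, M.Conn F s t → 0 ≤ f t)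
    (ht : M.Conn F s t) : f t ≤ M.classSum F s f := by
  classical
  exact Finset.single_le_sum (f := f) (fun t ht => h t (Finset.mem_filter.1 ht).2)
    (Finset.mem_filter.2 ⟨Finset.mem_univ _, ht⟩)

theorem tendsto_classSum (s : M.State) {f : ℕ → M.State → ℝ} {g : M.State → ℝ}
    (h : ∀ t, M.Conn F s t → Tendsto (fun n => f n t) atTop (𝓝 (g t))) :
    Tendsto (fun n => M.classSum F s (f n)) atTop (𝓝 (M.classSum F s g)) := by
  classical
  exact tendsto_finsetSum _ fun t ht => h t (Finset.mem_filter.1 ht).2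

/-- An average over the classes: inequalities for all class sums can be weighted with functions
that are constant on classes. -/
theorem sum_mul_le_of_classSum_le {f g ψ : M.State → ℝ}
    (h : ∀ s, M.classSum F s f ≤ M.classSum F s g) (hψ : ∀ s, 0 ≤ ψ s)
    (hconst : ∀ s t, M.Conn F s t → ψ s = ψ t) : ∑ s, f s * ψ s ≤ ∑ s, g s * ψ s := by
  classical
  have h1 : ∀ s, 0 < M.classSum F s (fun _ => 1) := fun s =>
    lt_of_lt_of_le one_pos
      (le_classSum (f := fun _ => (1 : ℝ)) (fun _ _ => zero_le_one) (Conn.refl s))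
  -- Each class sum is spread evenly over its class; `classSum` of the constant `1` is the number of
  -- states in the class.
  have key : ∀ f : M.State → ℝ, ∑ s, f s * ψ s =
      ∑ s, ψ s / M.classSum F s (fun _ => 1) * M.classSum F s f := by
    intro f
    have e1 : ∀ s, ψ s / M.classSum F s (fun _ => 1) * M.classSum F s f =
        ∑ t, if M.Conn F s t then f t * (ψ t / M.classSum F t (fun _ => 1)) else 0 := by
      intro s
      have e2 : M.classSum F s f = ∑ t, if M.Conn F s t then f t else 0 :=
        Finset.sum_filter _ _
      rw [e2, Finset.mul_sum]
      refine Finset.sum_congr rfl fun t _ => ?_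
      split_ifs with hst
      · rw [hconst s t hst, classSum_eq_of_conn hst, mul_comm]
      · rw [mul_zero]
    rw [Finset.sum_congr rfl fun s _ => e1 s, Finset.sum_comm]
    refine Finset.sum_congr rfl fun t _ => ?_
    rw [← Finset.sum_filter]
    simp only [conn_comm (t := t)]
    rw [Finset.sum_const, nsmul_eq_mul]
    have : ((Finset.univ.filter fun s => M.Conn F t s).card : ℝ) =
        M.classSum F t (fun _ => 1) := by simp [classSum]
    rw [this]
    field_simp [(h1 t).ne']
  rw [key f, key g]
  exact Finset.sum_le_sum fun s _ =>
    mul_le_mul_of_nonneg_left (h s) (div_nonneg (hψ s) (h1 s).le)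

end MDP

namespace Flow

open MDP

variable {M : MDP} {F : Finset M.State} (μ : Flow M)

open Classical in
/-- The part of a flow that uses outer actions. -/
noncomputable def exits (F : Finset M.State) (n : ℕ) (s : M.State) (a : M.Action) : ℝ :=
  if M.Outer F s a then μ.w n s a else 0

theorem exits_nonneg (n : ℕ) (s : M.State) (a : M.Action) : 0 ≤ μ.exits F n s a := by
  unfold exits; split_ifs
  exacts [μ.nonneg n s a, le_rfl]

/-- Only outer actions change the expectation of a function that is constant on classes: inner
actions stay in the class, actions at targets stay in place, and unavailable actions carry no
weight. -/
theorem sum_mass_succ (hF : ∀ s ∈ F, M.Absorbing s) (n : ℕ) {g : M.State → ℝ}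
    (hg : ∀ s t, M.Conn F s t → g s = g t) :
    ∑ s, μ.mass (n + 1) s * g s = ∑ s, μ.mass n s * g s +
      ∑ t, ∑ a, μ.exits F n t a * (∑ s, M.prob t a s * g s - g t) := by
  classical
  have h1 : ∑ s, μ.mass (n + 1) s * g s = ∑ t, ∑ a, μ.w n t a * ∑ s, M.prob t a s * g s := by
    simp only [mass, μ.succ, Finset.sum_mul, Finset.mul_sum]
    rw [Finset.sum_comm]
    refine Finset.sum_congr rfl fun t _ => ?_
    rw [Finset.sum_comm]
    exact Finset.sum_congr rfl fun a _ => Finset.sum_congr rfl fun s _ => by ring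
  rw [h1, ← Finset.sum_add_distrib]
  refine Finset.sum_congr rfl fun t _ => ?_
  rw [mass, Finset.sum_mul, ← Finset.sum_add_distrib]
  refine Finset.sum_congr rfl fun a _ => ?_
  unfold exits
  split_ifs with ho
  · ring
  · rw [zero_mul, add_zero]
    by_cases ha : a ∈ M.avail t
    · congr 1
      by_cases ht : t ∈ F
      · simp [(hF t ht).prob_eq ha]
      · have hin : (t, a) ∈ M.inner F := by
          by_contra hn; exact ho ⟨ha, ht, hn⟩
        have : ∀ s, M.prob t a s * g s = M.prob t a s * g t := by
          intro s
          by_cases hp : M.prob t a s = 0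
          · simp [hp]
          · rw [hg t s (conn_of_inner hin hp)]
        rw [Finset.sum_congr rfl fun s _ => this s, ← Finset.sum_mul, M.sum_prob, one_mul]
    · rw [μ.unavailable n t a ha]; ring

theorem sum_mass_eq (hF : ∀ s ∈ F, M.Absorbing s) (N : ℕ) {g : M.State → ℝ}
    (hg : ∀ s t, M.Conn F s t → g s = g t) :
    ∑ s, μ.mass N s * g s = g M.init +
      ∑ t, ∑ a, (∑ n ∈ Finset.range N, μ.exits F n t a) * (∑ s, M.prob t a s * g s - g t) := by
  induction N with
  | zero => simp [mass, μ.zero]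
  | succ N ih =>
    rw [μ.sum_mass_succ hF N hg, ih, add_assoc, ← Finset.sum_add_distrib]
    simp only [Finset.sum_range_succ, add_mul, Finset.sum_add_distrib]

/-- Conservation of mass in a maximal end component. -/
theorem classSum_mass (hF : ∀ s ∈ F, M.Absorbing s) (N : ℕ) (s : M.State) :
    M.classSum F s (μ.mass N) = M.classSum F s (fun u =>
      M.inflow (fun t a => ∑ n ∈ Finset.range N, μ.exits F n t a) u -
        ∑ a, ∑ n ∈ Finset.range N, μ.exits F n u a) := by
  classical
  -- The indicator of the class of `s` is constant on classes.
  have h := μ.sum_mass_eq hF N (g := fun t => if M.Conn F s t then 1 else 0) (by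
    intro t u htu
    have : M.Conn F s t ↔ M.Conn F s u := ⟨fun h => h.trans htu, fun h => h.trans htu.symm⟩
    simp only [this])
  set U : M.State → M.Action → ℝ := fun t a => ∑ n ∈ Finset.range N, μ.exits F n t a with hU
  have e1 : M.classSum F s (μ.mass N) = ∑ t, μ.mass N t * (if M.Conn F s t then 1 else 0) := by
    simp [classSum, Finset.sum_filter]
  rw [e1, h]
  simp only [mul_sub, Finset.sum_sub_distrib, classSum_sub]
  rw [← add_sub_assoc]
  congr 1
  · change _ = M.classSum F s (fun u => _ + _)
    rw [classSum_add]
    congr 1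
    · simp [classSum]
    · change _ = ∑ u with M.Conn F s u, ∑ t, ∑ a, U t a * M.prob t a u
      refine Eq.trans (Finset.sum_congr rfl fun t _ => ?_) Finset.sum_comm
      refine Eq.trans (Finset.sum_congr rfl fun a _ => ?_) Finset.sum_comm
      rw [← Finset.mul_sum, Finset.sum_filter]
      simp [U]
  · simp only [classSum, Finset.sum_filter, mul_ite, mul_one, mul_zero]
    refine Finset.sum_congr rfl fun t _ => ?_
    split_ifs <;> simp

/-- Every outer action raises the expected potential by at least `c`, while this expectation stays
between `0` and `1`. -/
theorem exists_bound_sum_exits (hF : ∀ s ∈ F, M.Absorbing s) :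
    ∃ K : ℝ, ∀ N t a, ∑ n ∈ Finset.range N, μ.exits F n t a ≤ K := by
  obtain ⟨φ, c, hc, hφ, hconn, -, hout⟩ := M.exists_potential F
  refine ⟨1 / c, fun N t a => ?_⟩
  have h := μ.sum_mass_eq hF N hconn
  have hle : ∑ s, μ.mass N s * φ s ≤ 1 := by
    rw [← μ.sum_mass N]
    exact Finset.sum_le_sum fun s _ => mul_le_of_le_one_right (μ.mass_nonneg N s) (hφ s).2
  have hterm : ∀ t a, (∑ n ∈ Finset.range N, μ.exits F n t a) * c ≤
      (∑ n ∈ Finset.range N, μ.exits F n t a) * (∑ s, M.prob t a s * φ s - φ t) := by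
    intro t a
    by_cases ho : M.Outer F t a
    · exact mul_le_mul_of_nonneg_left (by linarith [hout t a ho])
        (Finset.sum_nonneg fun n _ => μ.exits_nonneg n t a)
    · simp [exits, ho]
  have h0 : ∀ t a, 0 ≤ (∑ n ∈ Finset.range N, μ.exits F n t a) * c := fun t a =>
    mul_nonneg (Finset.sum_nonneg fun n _ => μ.exits_nonneg n t a) hc.le
  have h1 : (∑ n ∈ Finset.range N, μ.exits F n t a) * c ≤
      ∑ t, ∑ a, (∑ n ∈ Finset.range N, μ.exits F n t a) * c :=
    (Finset.single_le_sum (f := fun a => (∑ n ∈ Finset.range N, μ.exits F n t a) * c)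
      (fun a _ => h0 t a) (Finset.mem_univ a)).trans
    (Finset.single_le_sum (f := fun t => ∑ a, (∑ n ∈ Finset.range N, μ.exits F n t a) * c)
      (fun t _ => Finset.sum_nonneg fun a _ => h0 t a) (Finset.mem_univ t))
  have h2 := Finset.sum_le_sum fun t (_ : t ∈ Finset.univ) =>
    Finset.sum_le_sum fun a (_ : a ∈ Finset.univ) => hterm t a
  rw [le_div_iff₀ hc]
  linarith [(hφ M.init).1]

/-- The expected number of times the outer action `a` is chosen in `s`. -/
noncomputable def exitCount (F : Finset M.State) (s : M.State) (a : M.Action) : ℝ :=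
  ∑' n, μ.exits F n s a

theorem hasSum_exits (hF : ∀ s ∈ F, M.Absorbing s) (s : M.State) (a : M.Action) :
    HasSum (fun n => μ.exits F n s a) (μ.exitCount F s a) := by
  obtain ⟨K, hK⟩ := μ.exists_bound_sum_exits hF
  exact (summable_of_sum_range_le (fun n => μ.exits_nonneg n s a) fun N => hK N s a).hasSum

theorem exits_tendsto_zero (hF : ∀ s ∈ F, M.Absorbing s) (s : M.State) (a : M.Action) :
    Tendsto (fun n => μ.exits F n s a) atTop (𝓝 0) :=
  (μ.hasSum_exits hF s a).summable.tendsto_atTop_zero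

theorem tendsto_classSum_mass (hF : ∀ s ∈ F, M.Absorbing s) (s : M.State) :
    Tendsto (fun n => M.classSum F s (μ.mass n)) atTop (𝓝 (M.classSum F s fun u =>
      M.inflow (μ.exitCount F) u - ∑ a, μ.exitCount F u a)) := by
  simp only [μ.classSum_mass hF]
  have h := fun t a => (μ.hasSum_exits hF t a).tendsto_sum_nat
  refine M.tendsto_classSum s fun u _ => Tendsto.sub (Tendsto.add tendsto_const_nhds ?_) ?_
  · exact tendsto_finsetSum _ fun t _ => tendsto_finsetSum _ fun a _ => (h t a).mul_const _
  · exact tendsto_finsetSum _ fun a _ => h u a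

/-- All available actions of such a state are outer, so its mass is a sum of exits, each the term of
a convergent series. -/
theorem mass_tendsto_zero (hF : ∀ s ∈ F, M.Absorbing s) {s : M.State} (hs : s ∉ F)
    (hin : ∀ a, (s, a) ∉ M.inner F) : Tendsto (fun n => μ.mass n s) atTop (𝓝 0) := by
  have h := tendsto_finsetSum Finset.univ fun a (_ : a ∈ Finset.univ) =>
    μ.exits_tendsto_zero hF s a
  rw [Finset.sum_const_zero] at h
  refine h.congr fun n => Finset.sum_congr rfl fun a _ => ?_
  unfold exits
  split_ifs with ho
  · rfl
  · exact (μ.unavailable n s a fun ha => ho ⟨ha, hs, hin a⟩).symm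

theorem exitCount_of_not_outer {s : M.State} {a : M.Action} (h : ¬ M.Outer F s a) :
    μ.exitCount F s a = 0 := by
  simp [exitCount, exits, h]

theorem exitCount_nonneg (s : M.State) (a : M.Action) : 0 ≤ μ.exitCount F s a :=
  tsum_nonneg fun n => μ.exits_nonneg n s a

/-- Inflow minus outflow of a class is the limit of its mass: non-negative, and zero at a non-target
state without inner actions. -/
theorem isPlan_exitCount (hF : ∀ s ∈ F, M.Absorbing s) : M.IsPlan F (μ.exitCount F) where
  nonneg := μ.exitCount_nonneg
  supp _ _ h := μ.exitCount_of_not_outer h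
  le s _ := by
    have := ge_of_tendsto' (μ.tendsto_classSum_mass hF s) fun n =>
      classSum_nonneg fun t _ => μ.mass_nonneg n t
    rw [classSum_sub] at this
    linarith
  eq s hs hin := by
    have h := μ.tendsto_classSum_mass hF s
    simp only [classSum_of_forall_not_inner hin] at h
    have := tendsto_nhds_unique h (μ.mass_tendsto_zero hF hs hin)
    linarith

/-- No outer action starts in a target, so all that ever flowed in is still there. -/
theorem tendsto_mass_target (hF : ∀ s ∈ F, M.Absorbing s) {f : M.State} (hf : f ∈ F) :
    Tendsto (fun n => μ.mass n f) atTop (𝓝 (M.inflow (μ.exitCount F) f)) := by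
  have h := μ.tendsto_classSum_mass hF f
  simp only [classSum_of_forall_not_inner (not_inner_of_mem hf)] at h
  rwa [Finset.sum_eq_zero fun a _ => μ.exitCount_of_not_outer fun ho => ho.2.1 hf, sub_zero] at h

end Flow

end CPTReach

namespace CPTReach

open Filter Topology

/-! ## Realizing a plan by a flow

The flow takes outer actions greedily, as long as the plan provides for them, and explores its
current end component with the remaining mass. -/

namespace MDP

variable {M : MDP} {F : Finset M.State}

/-- The outer actions taken with mass `m` and remaining plan `q`. -/
noncomputable def greedy (m : M.State → ℝ) (q : M.State → M.Action → ℝ) (s : M.State)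
    (a : M.Action) : ℝ :=
  q s a * min 1 (m s / ∑ b, q s b)

theorem greedy_nonneg {m : M.State → ℝ} {q : M.State → M.Action → ℝ} (hm : ∀ s, 0 ≤ m s)
    (hq : ∀ s a, 0 ≤ q s a) (s : M.State) (a : M.Action) : 0 ≤ greedy m q s a :=
  mul_nonneg (hq s a) (le_min zero_le_one (div_nonneg (hm s) (Finset.sum_nonneg fun b _ => hq s b)))

theorem greedy_le {m : M.State → ℝ} {q : M.State → M.Action → ℝ}
    (hq : ∀ s a, 0 ≤ q s a) (s : M.State) (a : M.Action) : greedy m q s a ≤ q s a :=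
  mul_le_of_le_one_right (hq s a) (min_le_left _ _)

/-- The exits at `s` use up either the remaining plan or the mass, whichever is smaller. If no plan
remains, both sides are zero. -/
theorem sum_greedy {m : M.State → ℝ} {q : M.State → M.Action → ℝ} (hm : ∀ s, 0 ≤ m s)
    (hq : ∀ s a, 0 ≤ q s a) (s : M.State) :
    ∑ a, greedy m q s a = min (∑ a, q s a) (m s) := by
  have h0 : 0 ≤ ∑ a, q s a := Finset.sum_nonneg fun b _ => hq s b
  simp only [greedy]
  rw [← Finset.sum_mul]
  rcases h0.eq_or_lt with h | h
  · rw [← h, zero_mul, min_eq_left (hm s)]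
  · rw [mul_min_of_nonneg _ _ h0, mul_one, mul_div_cancel₀ _ h.ne']

/-- Weights of a strategy that explores the end components. -/
theorem exists_explorer (M : MDP) (F : Finset M.State) :
    ∃ k : M.State → M.Action → ℝ, (∀ s a, 0 ≤ k s a) ∧ (∀ s, ∑ a, k s a = 1) ∧
      (∀ s a, a ∉ M.avail s → k s a = 0) ∧ (∀ s a, (s, a) ∈ M.inner F → 0 < k s a) ∧
      ∀ s a b, (s, b) ∈ M.inner F → (s, a) ∉ M.inner F → k s a = 0 := by
  classical
  -- Uniform weights on the inner actions where there are some, and on all available actions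
  -- elsewhere.
  let T : M.State → Finset M.Action := fun s =>
    if ∃ a, (s, a) ∈ M.inner F then Finset.univ.filter fun a => (s, a) ∈ M.inner F else M.avail s
  have hT : ∀ s, (T s).Nonempty := by
    intro s
    by_cases h : ∃ a, (s, a) ∈ M.inner F
    · obtain ⟨a, ha⟩ := h
      exact ⟨a, by simp only [T, if_pos (⟨a, ha⟩ : ∃ a, (s, a) ∈ M.inner F)]; simpa using ha⟩
    · simp only [T, if_neg h]; exact M.avail_nonempty s
  have hc : ∀ s, 0 < ((T s).card : ℝ) := fun s => Nat.cast_pos.2 (Finset.card_pos.2 (hT s))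
  refine ⟨fun s a => if a ∈ T s then ((T s).card : ℝ)⁻¹ else 0, fun s a => ?_, fun s => ?_,
    fun s a ha => ?_, fun s a ha => ?_, fun s a b hb ha => ?_⟩
  · dsimp only; split_ifs
    exacts [(inv_pos.2 (hc s)).le, le_rfl]
  · rw [← Finset.sum_filter, Finset.sum_const, nsmul_eq_mul, Finset.filter_mem_eq_inter,
      Finset.univ_inter, mul_inv_cancel₀ (hc s).ne']
  · refine if_neg fun h => ha ?_
    by_cases h' : ∃ a, (s, a) ∈ M.inner F
    · simp only [T, if_pos h', Finset.mem_filter] at h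
      exact (M.isEndPairs_inner F s a h.2).1
    · simpa only [T, if_neg h'] using h
  · have : a ∈ T s := by
      simp only [T, if_pos (⟨a, ha⟩ : ∃ a, (s, a) ∈ M.inner F)]; simpa using ha
    simpa only [if_pos this] using inv_pos.2 (hc s)
  · refine if_neg fun h => ha ?_
    simpa only [T, if_pos (⟨b, hb⟩ : ∃ a, (s, a) ∈ M.inner F), Finset.mem_filter,
      Finset.mem_univ, true_and] using h

/-- The mass and the remaining plan at time `n`, under greedy exits and exploration with `k`. -/
noncomputable def greedyState (k x : M.State → M.Action → ℝ) :
    ℕ → (M.State → ℝ) × (M.State → M.Action → ℝ)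
  | 0 => (fun s => if s = M.init then 1 else 0, x)
  | n + 1 =>
    let m := (greedyState k x n).1
    let q := (greedyState k x n).2
    (fun s => ∑ t, ∑ a, (greedy m q t a + (m t - ∑ b, greedy m q t b) * k t a) * M.prob t a s,
      fun s a => q s a - greedy m q s a)

theorem greedyState_nonneg {k x : M.State → M.Action → ℝ} (hk : ∀ s a, 0 ≤ k s a)
    (hx : ∀ s a, 0 ≤ x s a) (n : ℕ) :
    (∀ s, 0 ≤ (greedyState k x n).1 s) ∧ ∀ s a, 0 ≤ (greedyState k x n).2 s a := by
  induction n with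
  | zero =>
    refine ⟨fun s => ?_, hx⟩
    simp only [greedyState]; split_ifs
    exacts [zero_le_one, le_rfl]
  | succ n ih =>
    refine ⟨fun s => ?_, fun s a => sub_nonneg.2 (greedy_le ih.2 s a)⟩
    simp only [greedyState]
    refine Finset.sum_nonneg fun t _ => Finset.sum_nonneg fun a _ =>
      mul_nonneg (add_nonneg (greedy_nonneg ih.1 ih.2 t a) (mul_nonneg ?_ (hk t a)))
        (M.prob_nonneg _ _ _)
    rw [sum_greedy ih.1 ih.2]
    exact sub_nonneg.2 (min_le_right _ _)

/-- The flow that realizes the plan `x` greedily. -/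
noncomputable def greedyFlow {k x : M.State → M.Action → ℝ} (hk : ∀ s a, 0 ≤ k s a)
    (hk1 : ∀ s, ∑ a, k s a = 1) (hka : ∀ s a, a ∉ M.avail s → k s a = 0)
    (hx : ∀ s a, 0 ≤ x s a) (hxa : ∀ s a, a ∉ M.avail s → x s a = 0) : Flow M where
  w n s a :=
    let m := (greedyState k x n).1
    let q := (greedyState k x n).2
    greedy m q s a + (m s - ∑ b, greedy m q s b) * k s a
  nonneg n s a := by
    have ih := greedyState_nonneg hk hx n
    refine add_nonneg (greedy_nonneg ih.1 ih.2 s a) (mul_nonneg ?_ (hk s a))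
    rw [sum_greedy ih.1 ih.2]
    exact sub_nonneg.2 (min_le_right _ _)
  unavailable n s a ha := by
    have h : ∀ n, (greedyState k x n).2 s a = 0 := by
      intro n
      induction n with
      | zero => exact hxa s a ha
      | succ n ih => simp [greedyState, greedy, ih]
    simp [greedy, h, hka s a ha]
  zero s := by
    simp only [Finset.sum_add_distrib, ← Finset.mul_sum, hk1, mul_one, add_sub_cancel]
    rfl
  succ n s := by
    simp only [Finset.sum_add_distrib (s := Finset.univ) (ι := M.Action), ← Finset.mul_sum, hk1,
      mul_one, add_sub_cancel]
    rfl

end MDP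

open MDP

/-- Every plan is realized by some flow. -/
theorem MDP.IsPlan.exists_flow {M : MDP} {F : Finset M.State} (hF : ∀ s ∈ F, M.Absorbing s)
    {x : M.State → M.Action → ℝ} (hx : M.IsPlan F x) :
    ∃ μ : Flow M, ∀ f ∈ F, Tendsto (fun n => μ.mass n f) atTop (𝓝 (M.inflow x f)) := by
  classical
  obtain ⟨k, hk, hk1, hka, hkin, hkout⟩ := exists_explorer M F
  let μ := greedyFlow hk hk1 hka hx.nonneg fun s a ha => hx.supp s a fun ho => ha ho.1
  let m : ℕ → M.State → ℝ := fun n => (greedyState k x n).1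
  let q : ℕ → M.State → M.Action → ℝ := fun n => (greedyState k x n).2
  let g : ℕ → M.State → M.Action → ℝ := fun n => greedy (m n) (q n)
  have hm0 : ∀ n s, 0 ≤ m n s := fun n => (greedyState_nonneg hk hx.nonneg n).1
  have hq0 : ∀ n s a, 0 ≤ q n s a := fun n => (greedyState_nonneg hk hx.nonneg n).2
  have hg0 : ∀ n s a, 0 ≤ g n s a := fun n => greedy_nonneg (hm0 n) (hq0 n)
  have hgsum : ∀ n s, ∑ a, g n s a = min (∑ a, q n s a) (m n s) :=
    fun n => sum_greedy (hm0 n) (hq0 n)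
  have hw : ∀ n s a, μ.w n s a = g n s a + (m n s - ∑ b, g n s b) * k s a := fun _ _ _ => rfl
  have hmass : ∀ n s, μ.mass n s = m n s := by
    intro n s
    simp only [Flow.mass, hw, Finset.sum_add_distrib, ← Finset.mul_sum, hk1, mul_one,
      add_sub_cancel]
  have hqx : ∀ n s a, q n s a = x s a - ∑ j ∈ Finset.range n, g j s a := by
    intro n s a
    induction n with
    | zero => simp [q, greedyState]
    | succ n ih =>
      rw [Finset.sum_range_succ, ← sub_sub, ← ih]; rfl
  have hgle : ∀ n s a, ∑ j ∈ Finset.range n, g j s a ≤ x s a := fun n s a => by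
    linarith [hqx n s a, hq0 n s a]
  have hgout : ∀ n s a, ¬ M.Outer F s a → g n s a = 0 := fun n s a h =>
    le_antisymm (((greedy_le (hq0 n) s a).trans (by
      rw [hqx]; exact sub_le_self _ (Finset.sum_nonneg fun j _ => hg0 j s a))).trans
        (hx.supp s a h).le) (hg0 n s a)
  -- states outside end components are left completely
  have hexits_of : ∀ n, (∀ s ∉ F, (∀ a, (s, a) ∉ M.inner F) → m n s ≤ ∑ a, q n s a) →
      ∀ s a, μ.exits F n s a = g n s a := by
    intro n hn s a
    unfold Flow.exits
    split_ifs with ho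
    · rw [hw]
      by_cases hs : ∃ b, (s, b) ∈ M.inner F
      · obtain ⟨b, hb⟩ := hs
        rw [hkout s a b hb ho.2.2, mul_zero, add_zero]
      · push Not at hs
        rw [hgsum, min_eq_right (hn s ho.2.1 hs), sub_self, zero_mul, add_zero]
    · exact (hgout n s a ho).symm
  -- Induction on time: earlier exits stayed within the plan, so the mass that has arrived is at
  -- most the planned inflow, and after subtraction of past exits at most the remaining plan. Thus
  -- greedy exits empty the state, and the explorer has nothing to send through outer actions.
  have hfull : ∀ n, ∀ s ∉ F, (∀ a, (s, a) ∉ M.inner F) → m n s ≤ ∑ a, q n s a := by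
    intro n
    induction n using Nat.strong_induction_on with
    | _ n ih =>
      intro s hs hin
      have h := μ.classSum_mass hF n s
      rw [classSum_of_forall_not_inner hin, classSum_of_forall_not_inner hin, hmass] at h
      have he : ∀ t a, ∑ j ∈ Finset.range n, μ.exits F j t a = ∑ j ∈ Finset.range n, g j t a :=
        fun t a => Finset.sum_congr rfl fun j hj =>
          hexits_of j (ih j (Finset.mem_range.1 hj)) t a
      simp only [he] at h
      rw [h]
      simp only [hqx, Finset.sum_sub_distrib]
      refine sub_le_sub_right ?_ _
      rw [hx.eq s hs hin]
      refine add_le_add_right (Finset.sum_le_sum fun t _ => Finset.sum_le_sum fun a _ =>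
        mul_le_mul_of_nonneg_right (hgle n t a) (M.prob_nonneg _ _ _)) _
  have hexits : ∀ n s a, μ.exits F n s a = g n s a := fun n => hexits_of n (hfull n)
  have hcount : ∀ s a, μ.exitCount F s a ≤ x s a := fun s a =>
    le_of_tendsto' (μ.hasSum_exits hF s a).tendsto_sum_nat fun n => by
      simp only [hexits]; exact hgle n s a
  -- the part of the plan that is never carried out
  let d : M.State → M.Action → ℝ := fun s a => x s a - μ.exitCount F s a
  have hd0 : ∀ s a, 0 ≤ d s a := fun s a => sub_nonneg.2 (hcount s a)
  have hdq : ∀ n s a, d s a ≤ q n s a := by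
    intro n s a
    rw [hqx]
    refine sub_le_sub_left ?_ _
    have := (μ.hasSum_exits hF s a).summable.sum_le_tsum (Finset.range n)
      fun j _ => μ.exits_nonneg j s a
    simpa only [Flow.exitCount, hexits] using this
  have hgz : ∀ s, Tendsto (fun n => ∑ a, g n s a) atTop (𝓝 0) := by
    intro s
    have h := tendsto_finsetSum Finset.univ fun a (_ : a ∈ Finset.univ) =>
      μ.exits_tendsto_zero hF s a
    simpa only [hexits, Finset.sum_const_zero] using h
  -- If part of the plan at `t` is never carried out, then eventually the mass and not the plan
  -- limits the exits at `t`; so the mass equals the exits and vanishes. This spreads backwards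
  -- along inner edges, as the explorer moves a fixed fraction of the non-exiting mass across each
  -- of them.
  have hempty : ∀ s t a, M.Conn F s t → 0 < d t a → Tendsto (fun n => m n s) atTop (𝓝 0) := by
    intro s t a hst hd
    induction hst using Relation.ReflTransGen.head_induction_on with
    | refl =>
      refine (hgz t).congr' ?_
      filter_upwards [(hgz t).eventually (gt_mem_nhds hd)] with n hn
      rw [hgsum] at hn ⊢
      refine min_eq_right (le_of_not_gt fun hlt => ?_)
      rw [min_eq_left hlt.le] at hn
      have := Finset.single_le_sum (f := fun a => q n t a) (fun a _ => hq0 n t a)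
        (Finset.mem_univ a)
      linarith [hdq n t a]
    | @head s u hsu _ ih =>
      obtain ⟨b, hb, hp⟩ := hsu
      have hc : 0 < k s b * M.prob s b u :=
        mul_pos (hkin s b hb) (lt_of_le_of_ne (M.prob_nonneg _ _ _) (Ne.symm hp))
      have hr0 : ∀ n, 0 ≤ m n s - ∑ a, g n s a := fun n => by
        rw [hgsum]; exact sub_nonneg.2 (min_le_right _ _)
      have hle : ∀ n, m n s - ∑ a, g n s a ≤ m (n + 1) u / (k s b * M.prob s b u) := by
        intro n
        rw [le_div_iff₀ hc, ← hmass (n + 1), Flow.mass, μ.succ]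
        have e1 : (m n s - ∑ a, g n s a) * (k s b * M.prob s b u) ≤
            μ.w n s b * M.prob s b u := by
          rw [← mul_assoc, hw]
          exact mul_le_mul_of_nonneg_right (le_add_of_nonneg_left (hg0 n s b))
            (M.prob_nonneg _ _ _)
        have h0 : ∀ t a, 0 ≤ μ.w n t a * M.prob t a u := fun t a =>
          mul_nonneg (μ.nonneg n t a) (M.prob_nonneg _ _ _)
        exact e1.trans ((Finset.single_le_sum (f := fun a => μ.w n s a * M.prob s a u)
          (fun a _ => h0 s a) (Finset.mem_univ b)).trans
          (Finset.single_le_sum (f := fun t => ∑ a, μ.w n t a * M.prob t a u)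
            (fun t _ => Finset.sum_nonneg fun a _ => h0 t a) (Finset.mem_univ s)))
      have h1 : Tendsto (fun n => m (n + 1) u / (k s b * M.prob s b u)) atTop (𝓝 0) := by
        simpa using ((tendsto_add_atTop_iff_nat 1).2 ih).div_const (k s b * M.prob s b u)
      simpa using (squeeze_zero hr0 hle h1).add (hgz s)
  -- Where some plan is left over, the mass of the class vanishes in the limit, so `exitCount`
  -- balances inflow and outflow exactly; subtracting this from the condition on the plan leaves the
  -- inequality for `d`. In the other classes the left side is not positive.
  have hclass : ∀ s, M.classSum F s (fun t => ∑ a, d t a) ≤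
      M.classSum F s (fun u => ∑ t, ∑ a, d t a * M.prob t a u) := by
    intro s
    by_cases hpos : ∃ t a, M.Conn F s t ∧ 0 < d t a
    · obtain ⟨t, a, hst, hd⟩ := hpos
      have hs : s ∉ F := by
        intro hs
        have hdz : d t a = 0 := by
          have ho : ¬ M.Outer F t a := fun ho => ho.2.1 (hst.mem_iff.1 hs)
          simp only [d, hx.supp t a ho, μ.exitCount_of_not_outer ho, sub_self]
        exact hd.ne' hdz
      have h1 := μ.tendsto_classSum_mass hF s
      have h2 : Tendsto (fun n => M.classSum F s (μ.mass n)) atTop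
          (𝓝 (M.classSum F s fun _ => 0)) := M.tendsto_classSum s fun u hu => by
        simpa only [hmass] using hempty u t a (hu.symm.trans hst) hd
      have h3 := tendsto_nhds_unique h1 h2
      have h4 : M.classSum F s (fun _ => 0) = 0 := Finset.sum_const_zero
      rw [h4, classSum_sub] at h3
      have h5 := hx.le s hs
      have e1 : M.classSum F s (fun t => ∑ a, d t a) = M.classSum F s (fun t => ∑ a, x t a) -
          M.classSum F s (fun t => ∑ a, μ.exitCount F t a) := by
        rw [← classSum_sub]; simp only [d, Finset.sum_sub_distrib]
      have e2 : M.classSum F s (fun u => ∑ t, ∑ a, d t a * M.prob t a u) =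
          M.classSum F s (M.inflow x) - M.classSum F s (M.inflow (μ.exitCount F)) := by
        rw [← classSum_sub]
        simp only [d, inflow, sub_mul, Finset.sum_sub_distrib, add_sub_add_left_eq_sub]
      rw [e1, e2]
      linarith
    · push Not at hpos
      refine (Finset.sum_nonpos fun t ht => Finset.sum_nonpos fun a _ =>
        hpos t a (Finset.mem_filter.1 ht).2).trans (classSum_nonneg fun u _ =>
          Finset.sum_nonneg fun t _ => Finset.sum_nonneg fun a _ =>
            mul_nonneg (hd0 t a) (M.prob_nonneg _ _ _))
  -- Weigh the class inequalities with `1 - φ`. Outer actions lower its expectation by at least `c`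
  -- per unit of `d`, so `c` times the total of `d` is at most zero.
  have hdzero : ∀ s a, d s a = 0 := by
    obtain ⟨φ, c, hc, hφ, hconn, -, hout⟩ := M.exists_potential F
    have h1 := sum_mul_le_of_classSum_le hclass (ψ := fun s => 1 - φ s)
      (fun s => sub_nonneg.2 (hφ s).2) (fun s t h => by simp only [hconn s t h])
    have h2 : ∑ u, (∑ t, ∑ a, d t a * M.prob t a u) * (1 - φ u) =
        ∑ t, ∑ a, d t a * (1 - ∑ u, M.prob t a u * φ u) := by
      simp only [Finset.sum_mul]
      rw [Finset.sum_comm]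
      refine Finset.sum_congr rfl fun t _ => ?_
      rw [Finset.sum_comm]
      refine Finset.sum_congr rfl fun a _ => ?_
      rw [← M.sum_prob t a, ← Finset.sum_sub_distrib, Finset.mul_sum]
      exact Finset.sum_congr rfl fun u _ => by rw [M.sum_prob]; ring
    have h3 : ∀ t a, d t a * (1 - ∑ u, M.prob t a u * φ u) ≤ d t a * (1 - φ t) - c * d t a := by
      intro t a
      by_cases ho : M.Outer F t a
      · nlinarith [hout t a ho, hd0 t a]
      · have hdz : d t a = 0 := by
          simp only [d, hx.supp t a ho, μ.exitCount_of_not_outer ho, sub_self]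
        simp [hdz]
    have h4 : ∑ t, ∑ a, d t a * (1 - ∑ u, M.prob t a u * φ u) ≤
        ∑ t, ∑ a, (d t a * (1 - φ t) - c * d t a) :=
      Finset.sum_le_sum fun t _ => Finset.sum_le_sum fun a _ => h3 t a
    simp only [Finset.sum_sub_distrib, ← Finset.mul_sum] at h4
    rw [h2] at h1
    simp only [Finset.sum_mul] at h1
    have h5 : ∑ t, ∑ a, d t a ≤ 0 := by
      have : c * ∑ t, ∑ a, d t a ≤ 0 := by linarith
      by_contra hn
      push Not at hn
      linarith [mul_pos hc hn]
    intro s a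
    refine le_antisymm ?_ (hd0 s a)
    exact ((Finset.single_le_sum (f := fun a => d s a) (fun a _ => hd0 s a)
      (Finset.mem_univ a)).trans (Finset.single_le_sum (f := fun t => ∑ a, d t a)
        (fun t _ => Finset.sum_nonneg fun a _ => hd0 t a) (Finset.mem_univ s))).trans h5
  have hxe : x = μ.exitCount F := by
    funext s a; linarith [hdzero s a]
  exact ⟨μ, fun f hf => hxe ▸ μ.tendsto_mass_target hF hf⟩

end CPTReach

namespace CPTReach

open Filter Topology

/-! ## The stopping MDP -/

namespace MDP

variable (M : MDP) (F : Finset M.State)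

open Classical in
/-- The actions of the collapsed MDP: an outer action from any state of the same maximal end
component, and, in end components, the last action, which stops. -/
noncomputable def collapseAvail :
    Fin (M.numStates + 1) → Finset (Fin (M.numStates * M.numActions + 1)) :=
  Fin.lastCases {Fin.last _} fun s => Finset.univ.filter fun b =>
    Fin.lastCases (motive := fun _ => Prop) (∃ a, (s, a) ∈ M.inner F) (fun p =>
      M.Conn F s (finProdFinEquiv.symm p).1 ∧
        (finProdFinEquiv.symm p).2 ∈ M.avail (finProdFinEquiv.symm p).1 ∧
        finProdFinEquiv.symm p ∉ M.inner F) b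

theorem collapseAvail_last : M.collapseAvail F (Fin.last _) = {Fin.last _} := by
  simp only [collapseAvail, Fin.lastCases_last]

theorem last_mem_collapseAvail {s : M.State} :
    Fin.last _ ∈ M.collapseAvail F (Fin.castSucc s) ↔ ∃ a, (s, a) ∈ M.inner F := by
  simp only [collapseAvail, Fin.lastCases_castSucc, Finset.mem_filter, Finset.mem_univ, true_and,
    Fin.lastCases_last]

theorem castSucc_mem_collapseAvail {s t : M.State} {a : M.Action} :
    Fin.castSucc (finProdFinEquiv (t, a)) ∈ M.collapseAvail F (Fin.castSucc s) ↔
      M.Conn F s t ∧ a ∈ M.avail t ∧ (t, a) ∉ M.inner F := by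
  simp only [collapseAvail, Fin.lastCases_castSucc, Finset.mem_filter, Finset.mem_univ, true_and,
    Equiv.symm_apply_apply]

/-- The effect of the actions of the collapsed MDP. -/
noncomputable def collapseTrans :
    Fin (M.numStates * M.numActions + 1) → PMF (Fin (M.numStates + 1)) :=
  Fin.lastCases (PMF.pure (Fin.last _)) fun p =>
    (M.trans (finProdFinEquiv.symm p).1 (finProdFinEquiv.symm p).2).map Fin.castSucc

theorem collapseTrans_last : M.collapseTrans (Fin.last _) = PMF.pure (Fin.last _) := by
  simp only [collapseTrans, Fin.lastCases_last]

theorem collapseTrans_castSucc (t : M.State) (a : M.Action) :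
    M.collapseTrans (Fin.castSucc (finProdFinEquiv (t, a))) =
      (M.trans t a).map Fin.castSucc := by
  simp only [collapseTrans, Fin.lastCases_castSucc, Equiv.symm_apply_apply]

/-- The MDP in which every state of a maximal end component may directly choose an action that
leaves the component from any of its states, or quit in a sink. -/
noncomputable def collapse : MDP where
  numStates := M.numStates + 1
  numActions := M.numStates * M.numActions + 1
  init := M.init.castSucc
  avail := M.collapseAvail F
  avail_nonempty s := by
    refine Fin.lastCases ?_ (fun s => ?_) s
    · rw [collapseAvail_last]; exact Finset.singleton_nonempty _
    · by_cases h : ∃ a, (s, a) ∈ M.inner F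
      · exact ⟨Fin.last _, (M.last_mem_collapseAvail F).2 h⟩
      · push Not at h
        obtain ⟨a, ha⟩ := M.avail_nonempty s
        exact ⟨_, (M.castSucc_mem_collapseAvail F).2 ⟨Conn.refl s, ha, h a⟩⟩
  trans _ := M.collapseTrans

/-! ### States, actions and transitions of the collapsed MDP -/

namespace collapse

/-- The copy of a state. -/
def st (s : M.State) : (M.collapse F).State := Fin.castSucc (n := M.numStates) s

/-- The sink. -/
def sink : (M.collapse F).State := Fin.last M.numStates

/-- The action that moves to the state `t` and chooses `a` there. -/
def act (t : M.State) (a : M.Action) : (M.collapse F).Action :=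
  Fin.castSucc (n := M.numStates * M.numActions) (finProdFinEquiv (t, a))

/-- The action that moves to the sink. -/
def quit : (M.collapse F).Action := Fin.last (M.numStates * M.numActions)

variable {M F}

theorem st_injective : Function.Injective (st M F) := Fin.castSucc_injective _

theorem st_ne_sink (s : M.State) : st M F s ≠ sink M F := Fin.castSucc_ne_last s

theorem state_cases (s : (M.collapse F).State) : s = sink M F ∨ ∃ t, s = st M F t :=
  Fin.lastCases (motive := fun s : Fin (M.numStates + 1) =>
    s = Fin.last _ ∨ ∃ t : Fin M.numStates, s = t.castSucc) (Or.inl rfl)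
    (fun t => Or.inr ⟨t, rfl⟩) s

theorem action_cases (b : (M.collapse F).Action) :
    b = quit M F ∨ ∃ t a, b = act M F t a :=
  Fin.lastCases (motive := fun b : Fin (M.numStates * M.numActions + 1) =>
    b = Fin.last _ ∨ ∃ (t : Fin M.numStates) (a : Fin M.numActions),
      b = Fin.castSucc (finProdFinEquiv (t, a))) (Or.inl rfl)
    (fun p => Or.inr ⟨_, _, by rw [Prod.mk.eta, Equiv.apply_symm_apply]⟩) b

theorem sum_state (f : (M.collapse F).State → ℝ) :
    ∑ s, f s = ∑ s, f (st M F s) + f (sink M F) := Fin.sum_univ_castSucc (n := M.numStates) f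

theorem sum_action (f : (M.collapse F).Action → ℝ) :
    ∑ b, f b = ∑ t, ∑ a, f (act M F t a) + f (quit M F) := by
  refine (Fin.sum_univ_castSucc (n := M.numStates * M.numActions) f).trans ?_
  congr 1
  rw [← Fintype.sum_prod_type', ← finProdFinEquiv.sum_comp]
  rfl

theorem act_mem_avail {s t : M.State} {a : M.Action} :
    act M F t a ∈ (M.collapse F).avail (st M F s) ↔
      M.Conn F s t ∧ a ∈ M.avail t ∧ (t, a) ∉ M.inner F :=
  M.castSucc_mem_collapseAvail F

theorem stop_mem_avail {s : M.State} :
    quit M F ∈ (M.collapse F).avail (st M F s) ↔ ∃ a, (s, a) ∈ M.inner F :=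
  M.last_mem_collapseAvail F

theorem avail_sink : (M.collapse F).avail (sink M F) = {quit M F} :=
  M.collapseAvail_last F

theorem trans_act (s : (M.collapse F).State) (t : M.State) (a : M.Action) :
    (M.collapse F).trans s (act M F t a) = (M.trans t a).map (st M F) :=
  M.collapseTrans_castSucc t a

theorem trans_stop (s : (M.collapse F).State) :
    (M.collapse F).trans s (quit M F) = PMF.pure (sink M F) :=
  M.collapseTrans_last

theorem trans_act_st (s : (M.collapse F).State) (t : M.State) (a : M.Action) (u : M.State) :
    (M.collapse F).trans s (act M F t a) (st M F u) = M.trans t a u := by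
  classical
  rw [trans_act, PMF.map_apply, tsum_fintype]
  refine (Finset.sum_eq_single u (fun v _ hv => ?_) (by simp)).trans (if_pos rfl)
  exact if_neg fun h => hv (st_injective h).symm

theorem prob_act_st (s : (M.collapse F).State) (t : M.State) (a : M.Action) (u : M.State) :
    (M.collapse F).prob s (act M F t a) (st M F u) = M.prob t a u := by
  rw [prob, prob, trans_act_st]

theorem prob_act_sink (s : (M.collapse F).State) (t : M.State) (a : M.Action) :
    (M.collapse F).prob s (act M F t a) (sink M F) = 0 := by
  classical
  rw [prob, trans_act, PMF.map_apply, tsum_fintype, ENNReal.toReal_eq_zero_iff]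
  exact Or.inl (Finset.sum_eq_zero fun v _ => if_neg (st_ne_sink v).symm)

theorem prob_stop_st (s : (M.collapse F).State) (u : M.State) :
    (M.collapse F).prob s (quit M F) (st M F u) = 0 := by
  rw [prob, trans_stop, PMF.pure_apply, if_neg (st_ne_sink u), ENNReal.toReal_zero]

theorem prob_stop_sink (s : (M.collapse F).State) :
    (M.collapse F).prob s (quit M F) (sink M F) = 1 := by
  rw [prob, trans_stop, PMF.pure_apply, if_pos rfl, ENNReal.toReal_one]

theorem absorbing_sink : (M.collapse F).Absorbing (sink M F) := by
  intro b hb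
  rw [avail_sink, Finset.mem_singleton] at hb
  rw [hb, trans_stop, PMF.pure_apply, if_pos rfl]

/-- A target is alone in its class and has no inner action, so its copy has only copies of its own
actions and cannot quit. -/
theorem absorbing_st {f : M.State} (hf : f ∈ F) (h : M.Absorbing f) :
    (M.collapse F).Absorbing (st M F f) := by
  classical
  intro b hb
  rcases action_cases b with rfl | ⟨t, a, rfl⟩
  · obtain ⟨a, ha⟩ := stop_mem_avail.1 hb
    exact absurd ha (not_inner_of_mem hf a)
  · obtain ⟨h1, h2, -⟩ := act_mem_avail.1 hb
    obtain rfl := h1.eq_of_mem hf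
    rw [trans_act_st, h a h2]

variable (M F) in
/-- The copies of the target states. -/
def copies : Finset (M.collapse F).State := F.map ⟨st M F, st_injective⟩

variable (M F) in
/-- The absorbing states: the copies of the targets, and the sink. -/
noncomputable def ends : Finset (M.collapse F).State := insert (sink M F) (copies M F)

theorem st_mem_copies {s : M.State} : st M F s ∈ copies M F ↔ s ∈ F :=
  Finset.mem_map' (⟨st M F, st_injective⟩ : M.State ↪ (M.collapse F).State)

theorem st_mem_ends {s : M.State} : st M F s ∈ ends M F ↔ s ∈ F := by
  rw [ends, Finset.mem_insert, st_mem_copies]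
  exact or_iff_right (st_ne_sink s)

theorem sink_mem_ends : sink M F ∈ ends M F := Finset.mem_insert_self _ _

theorem absorbing_copies (hF : ∀ s ∈ F, M.Absorbing s) :
    ∀ s ∈ copies M F, (M.collapse F).Absorbing s := by
  intro s hs
  obtain ⟨f, hf, rfl⟩ := Finset.mem_map.1 hs
  exact absorbing_st hf (hF f hf)

theorem absorbing_ends (hF : ∀ s ∈ F, M.Absorbing s) :
    ∀ s ∈ ends M F, (M.collapse F).Absorbing s := by
  intro s hs
  rcases Finset.mem_insert.1 hs with rfl | hs
  · exact absorbing_sink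
  · exact absorbing_copies hF s hs

/-- There are no end components outside the absorbing states. -/
theorem inner_eq_empty : (M.collapse F).inner (ends M F) = ∅ := by
  classical
  rw [Set.eq_empty_iff_forall_notMem]
  rintro ⟨s₀, b₀⟩ h₀
  obtain ⟨φ, c, hc, hφ, hconn, -, hout⟩ := M.exists_potential F
  have hsrc : ∀ s b, (s, b) ∈ (M.collapse F).inner (ends M F) → ∃ t, s = st M F t :=
    fun s b h => (state_cases s).resolve_left fun hs =>
      not_inner_of_mem sink_mem_ends b (hs ▸ h)
  obtain ⟨t₀, rfl⟩ := hsrc s₀ b₀ h₀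
  -- Among the states that still have an inner action, take one with the largest potential.
  obtain ⟨s, hs, hmax⟩ := Finset.exists_max_image (Finset.univ.filter fun t : M.State =>
    ∃ b, (st M F t, b) ∈ (M.collapse F).inner (ends M F)) φ ⟨t₀, by simpa using ⟨b₀, h₀⟩⟩
  obtain ⟨b, hb⟩ := (Finset.mem_filter.1 hs).2
  obtain ⟨hb1, hb2, hb3⟩ := (M.collapse F).isEndPairs_inner (ends M F) _ b hb
  rcases action_cases b with rfl | ⟨t, a, rfl⟩
  · have h := hb3 (sink M F) (by rw [prob_stop_sink]; exact one_ne_zero)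
    exact st_ne_sink s (Conn.eq_of_mem sink_mem_ends h)
  · obtain ⟨h1, h2, h3⟩ := act_mem_avail.1 hb1
    rw [st_mem_ends] at hb2
    have ho : M.Outer F t a := ⟨h2, fun ht => hb2 (h1.mem_iff.2 ht), h3⟩
    -- The outer action raises the potential in expectation, so some successor lies strictly higher.
    -- Since it can return to `s`, it has an inner action itself, contrary to maximality.
    have hu : ∃ u, M.prob t a u ≠ 0 ∧ φ s < φ u := by
      by_contra hn
      push Not at hn
      have : ∑ u, M.prob t a u * φ u ≤ ∑ u, M.prob t a u * φ s := by
        refine Finset.sum_le_sum fun u _ => ?_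
        by_cases hp : M.prob t a u = 0
        · simp [hp]
        · exact mul_le_mul_of_nonneg_left (hn u hp) (M.prob_nonneg _ _ _)
      rw [← Finset.sum_mul, M.sum_prob, one_mul] at this
      linarith [hout t a ho, hconn s t h1]
    obtain ⟨u, hu, hlt⟩ := hu
    rcases Relation.ReflTransGen.cases_head
      (hb3 (st M F u) (by rw [prob_act_st]; exact hu)) with h | ⟨_, ⟨b', hb', _⟩, _⟩
    · rw [st_injective h] at hlt; exact lt_irrefl _ hlt
    · exact not_lt_of_ge (hmax u (by simpa using ⟨b', hb'⟩)) hlt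

theorem not_inner (s : (M.collapse F).State) (b : (M.collapse F).Action) :
    (s, b) ∉ (M.collapse F).inner (ends M F) := by
  rw [inner_eq_empty]; exact Set.notMem_empty _

/-! ### Outer actions and plans of the collapsed MDP -/

theorem outer_act {s t : M.State} {a : M.Action} :
    (M.collapse F).Outer (ends M F) (st M F s) (act M F t a) ↔
      M.Conn F s t ∧ M.Outer F t a := by
  simp only [Outer, act_mem_avail, st_mem_ends, not_inner, not_false_eq_true, and_true]
  constructor
  · rintro ⟨⟨h1, h2, h3⟩, h4⟩
    exact ⟨h1, h2, fun ht => h4 (h1.mem_iff.2 ht), h3⟩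
  · rintro ⟨h1, h2, h4, h3⟩
    exact ⟨⟨h1, h2, h3⟩, fun ht => h4 (h1.mem_iff.1 ht)⟩

theorem not_outer_sink (b : (M.collapse F).Action) :
    ¬ (M.collapse F).Outer (ends M F) (sink M F) b := fun h => h.2.1 sink_mem_ends

theorem outer_stop {s : M.State} :
    (M.collapse F).Outer (ends M F) (st M F s) (quit M F) ↔ ∃ a, (s, a) ∈ M.inner F := by
  simp only [Outer, stop_mem_avail, st_mem_ends, not_inner, not_false_eq_true, and_true]
  exact ⟨fun h => h.1, fun ⟨a, ha⟩ => ⟨⟨a, ha⟩, (M.isEndPairs_inner F s a ha).2.1⟩⟩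

/-- Without inner pairs all classes are single states, and the class inequality follows from the
balance equation. -/
theorem isPlan_iff {x : (M.collapse F).State → (M.collapse F).Action → ℝ} :
    (M.collapse F).IsPlan (ends M F) x ↔ (∀ s b, 0 ≤ x s b) ∧
      (∀ s b, ¬ (M.collapse F).Outer (ends M F) s b → x s b = 0) ∧
      ∀ s ∉ F, ∑ b, x (st M F s) b = (M.collapse F).inflow x (st M F s) := by
  constructor
  · exact fun h => ⟨h.nonneg, h.supp,
      fun s hs => h.eq _ (fun h' => hs (st_mem_ends.1 h')) (not_inner _)⟩
  · rintro ⟨h1, h2, h3⟩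
    have h4 : ∀ s ∉ ends M F, ∑ b, x s b = (M.collapse F).inflow x s := by
      intro s hs
      rcases state_cases s with rfl | ⟨s, rfl⟩
      · exact absurd sink_mem_ends hs
      · exact h3 s fun h => hs (st_mem_ends.2 h)
    refine ⟨h1, h2, fun s hs => ?_, fun s hs _ => h4 s hs⟩
    rw [classSum_of_forall_not_inner (not_inner s), classSum_of_forall_not_inner (not_inner s),
      h4 s hs]

/-- An exit `(t, a)` has the same effect wherever it is called, so only the total over the calling
states matters; quitting feeds the sink alone. -/
theorem inflow_st {x : (M.collapse F).State → (M.collapse F).Action → ℝ}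
    (hx : ∀ b, x (sink M F) b = 0) (s : M.State) :
    (M.collapse F).inflow x (st M F s) =
      M.inflow (fun t a => ∑ u, x (st M F u) (act M F t a)) s := by
  unfold inflow
  congr 1
  · exact if_congr (st_injective (M := M) (F := F)).eq_iff rfl rfl
  · rw [sum_state]
    simp only [sum_action, hx, zero_mul, Finset.sum_const_zero, add_zero, prob_stop_st, mul_zero,
      prob_act_st, Finset.sum_mul]
    rw [Finset.sum_comm]
    exact Finset.sum_congr rfl fun t _ => Finset.sum_comm

/-- Caller and owner of an exit lie in the same class, so within a class it may be booked at either
of them. -/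
theorem classSum_sum_comm (s : M.State) {G : M.State → M.State → ℝ}
    (hG : ∀ u t, ¬ M.Conn F u t → G u t = 0) :
    M.classSum F s (fun t => ∑ u, G u t) = M.classSum F s (fun u => ∑ t, G u t) := by
  classical
  simp only [classSum, Finset.sum_filter]
  have h1 : ∀ t, (if M.Conn F s t then ∑ u, G u t else 0) =
      ∑ u, if M.Conn F s t then G u t else 0 := fun t => by split_ifs <;> simp
  have h2 : ∀ u, (if M.Conn F s u then ∑ t, G u t else 0) =
      ∑ t, if M.Conn F s u then G u t else 0 := fun t => by split_ifs <;> simp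
  simp only [h1, h2]
  rw [Finset.sum_comm]
  refine Finset.sum_congr rfl fun u _ => Finset.sum_congr rfl fun t _ => ?_
  by_cases h : M.Conn F u t
  · have : M.Conn F s t ↔ M.Conn F s u := ⟨fun h' => h'.trans h.symm, fun h' => h'.trans h⟩
    simp only [this]
  · simp [hG u t h]

/-- A plan for the collapsed MDP yields a plan for the original one. -/
theorem isPlan_of_isPlan {x : (M.collapse F).State → (M.collapse F).Action → ℝ}
    (hx : (M.collapse F).IsPlan (ends M F) x) :
    M.IsPlan F (fun t a => ∑ u, x (st M F u) (act M F t a)) := by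
  obtain ⟨h0, hs, he⟩ := isPlan_iff.1 hx
  have hz : ∀ b, x (sink M F) b = 0 := fun b => hs _ b (not_outer_sink b)
  -- The balance equations summed over a class: what exits is the inflow without the mass that
  -- quits.
  have hcl : ∀ s ∉ F, M.classSum F s (fun t => ∑ a, ∑ u, x (st M F u) (act M F t a)) =
      M.classSum F s (fun u => M.inflow (fun t a => ∑ u, x (st M F u) (act M F t a)) u -
        x (st M F u) (quit M F)) := by
    intro s hsF
    have e1 := classSum_sum_comm (F := F) s
      (G := fun u t => ∑ a, x (st M F u) (act M F t a)) (fun u t hut =>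
        Finset.sum_eq_zero fun a _ => hs _ _ fun ho => hut (outer_act.1 ho).1)
    rw [classSum_congr (g := fun t => ∑ u, ∑ a, x (st M F u) (act M F t a))
      fun t _ => Finset.sum_comm, e1]
    refine classSum_congr fun u hu => ?_
    rw [← inflow_st hz, ← he u fun huF => hsF (hu.mem_iff.2 huF), sum_action]
    ring
  refine ⟨fun t a => Finset.sum_nonneg fun u _ => h0 _ _, fun t a ho =>
    Finset.sum_eq_zero fun u _ => hs _ _ fun h => ho (outer_act.1 h).2, fun s hsF => ?_,
    fun s hsF hin => ?_⟩
  · rw [hcl s hsF]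
    exact classSum_mono fun u _ => sub_le_self _ (h0 _ _)
  · have h := hcl s hsF
    rw [classSum_of_forall_not_inner hin, classSum_of_forall_not_inner hin,
      hs _ _ fun ho => (outer_stop.1 ho).elim hin, sub_zero] at h
    exact h

open Classical in
variable (M F) in
/-- A plan for the original MDP, distributed over the states of each maximal end component in
proportion to the inflow. -/
noncomputable def splitAux (x : M.State → M.Action → ℝ) :
    Fin (M.numStates + 1) → Fin (M.numStates * M.numActions + 1) → ℝ := fun s b =>
  Fin.lastCases (motive := fun _ => ℝ) 0 (fun s => Fin.lastCases (motive := fun _ => ℝ)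
    (if s ∈ F then 0 else M.inflow x s -
      M.classSum F s (fun t => ∑ a, x t a) * (M.inflow x s / M.classSum F s (M.inflow x)))
    (fun p => if M.Conn F s (finProdFinEquiv.symm p).1 then
      x (finProdFinEquiv.symm p).1 (finProdFinEquiv.symm p).2 *
        (M.inflow x s / M.classSum F s (M.inflow x)) else 0) b) s

variable (M F) in
/-- A plan for the original MDP as one for the collapsed MDP. -/
noncomputable def split (x : M.State → M.Action → ℝ) :
    (M.collapse F).State → (M.collapse F).Action → ℝ := splitAux M F x

theorem split_sink (x : M.State → M.Action → ℝ) (b : (M.collapse F).Action) :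
    split M F x (sink M F) b = 0 := by
  change splitAux M F x (Fin.last _) b = 0
  simp only [splitAux, Fin.lastCases_last]

open Classical in
theorem split_stop (x : M.State → M.Action → ℝ) (s : M.State) :
    split M F x (st M F s) (quit M F) = if s ∈ F then 0 else M.inflow x s -
      M.classSum F s (fun t => ∑ a, x t a) *
        (M.inflow x s / M.classSum F s (M.inflow x)) := by
  change splitAux M F x (Fin.castSucc s) (Fin.last _) = _
  simp only [splitAux, Fin.lastCases_castSucc, Fin.lastCases_last]

open Classical in
theorem split_act (x : M.State → M.Action → ℝ) (s t : M.State) (a : M.Action) :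
    split M F x (st M F s) (act M F t a) = if M.Conn F s t then
      x t a * (M.inflow x s / M.classSum F s (M.inflow x)) else 0 := by
  change splitAux M F x (Fin.castSucc s) (Fin.castSucc (finProdFinEquiv (t, a))) = _
  simp only [splitAux, Fin.lastCases_castSucc, Equiv.symm_apply_apply]

theorem inflow_nonneg {x : M.State → M.Action → ℝ} (hx : ∀ s a, 0 ≤ x s a) (s : M.State) :
    0 ≤ M.inflow x s := by
  refine add_nonneg (by split_ifs <;> simp) (Finset.sum_nonneg fun t _ =>
    Finset.sum_nonneg fun a _ => mul_nonneg (hx t a) (M.prob_nonneg _ _ _))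

/-- The shares of the inflow add up to one over the class. In a class without inflow they are `0` by
the convention on division, but there the plan has no exits either. -/
theorem sum_split_act {x : M.State → M.Action → ℝ} (hx : M.IsPlan F x) (t : M.State)
    (a : M.Action) : ∑ u, split M F x (st M F u) (act M F t a) = x t a := by
  classical
  have hy := inflow_nonneg hx.nonneg
  simp only [split_act]
  have e1 : ∀ u, (if M.Conn F u t then x t a * (M.inflow x u / M.classSum F u (M.inflow x))
      else 0) = x t a / M.classSum F t (M.inflow x) *
        (if M.Conn F t u then M.inflow x u else 0) := by
    intro u
    rw [conn_comm (s := t)]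
    split_ifs with h
    · rw [classSum_eq_of_conn h]; ring
    · rw [mul_zero]
  rw [Finset.sum_congr rfl fun u _ => e1 u, ← Finset.mul_sum, ← Finset.sum_filter]
  change _ * M.classSum F t (M.inflow x) = _
  by_cases hY : M.classSum F t (M.inflow x) = 0
  · rw [hY, mul_zero]
    by_cases ho : M.Outer F t a
    · have h1 := hx.le t ho.2.1
      have h2 : ∑ a, x t a ≤ M.classSum F t (fun t => ∑ a, x t a) :=
        le_classSum (f := fun t => ∑ a, x t a)
          (fun u _ => Finset.sum_nonneg fun a _ => hx.nonneg u a) (Conn.refl t)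
      have h3 : x t a ≤ ∑ a, x t a :=
        Finset.single_le_sum (fun a _ => hx.nonneg t a) (Finset.mem_univ a)
      linarith [hx.nonneg t a]
    · exact (hx.supp t a ho).symm
  · rw [div_mul_cancel₀ _ hY]

/-- A plan for the original MDP yields a plan for the collapsed one. -/
theorem isPlan_split {x : M.State → M.Action → ℝ} (hx : M.IsPlan F x) :
    (M.collapse F).IsPlan (ends M F) (split M F x) := by
  classical
  have hy := inflow_nonneg hx.nonneg
  have hY : ∀ s, 0 ≤ M.classSum F s (M.inflow x) := fun s => classSum_nonneg fun t _ => hy t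
  refine isPlan_iff.2 ⟨fun s b => ?_, fun s b ho => ?_, fun s hs => ?_⟩
  · rcases state_cases s with rfl | ⟨s, rfl⟩
    · rw [split_sink]
    rcases action_cases b with rfl | ⟨t, a, rfl⟩
    · rw [split_stop]
      split_ifs with hs
      · exact le_rfl
      · have h1 := hx.le s hs
        rw [← mul_div_assoc, mul_comm, mul_div_assoc, sub_nonneg]
        exact mul_le_of_le_one_right (hy s) (div_le_one_of_le₀ h1 (hY s))
    · rw [split_act]
      split_ifs
      · exact mul_nonneg (hx.nonneg t a) (div_nonneg (hy s) (hY s))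
      · exact le_rfl
  · rcases state_cases s with rfl | ⟨s, rfl⟩
    · rw [split_sink]
    rcases action_cases b with rfl | ⟨t, a, rfl⟩
    · rw [split_stop]
      split_ifs with hs
      · rfl
      · rw [outer_stop] at ho
        push Not at ho
        -- A state without inner actions is its own class and the plan leaves it completely, so
        -- nothing remains for quitting.
        rw [classSum_of_forall_not_inner ho, classSum_of_forall_not_inner ho, hx.eq s hs ho]
        by_cases h0 : M.inflow x s = 0
        · simp [h0]
        · rw [div_self h0, mul_one, sub_self]
    · rw [split_act]
      rw [outer_act] at ho
      split_ifs with h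
      · rw [hx.supp t a fun ho' => ho ⟨h, ho'⟩, zero_mul]
      · rfl
  · rw [inflow_st (split_sink x)]
    simp only [sum_split_act hx]
    rw [sum_action, split_stop, if_neg hs]
    simp only [split_act]
    have e1 : ∑ t, ∑ a, (if M.Conn F s t then
        x t a * (M.inflow x s / M.classSum F s (M.inflow x)) else 0) =
        M.classSum F s (fun t => ∑ a, x t a) *
          (M.inflow x s / M.classSum F s (M.inflow x)) := by
      have e2 : M.classSum F s (fun t => ∑ a, x t a) =
          ∑ t, if M.Conn F s t then ∑ a, x t a else 0 := Finset.sum_filter _ _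
      rw [e2, Finset.sum_mul]
      refine Finset.sum_congr rfl fun t _ => ?_
      split_ifs
      · rw [Finset.sum_mul]
      · rw [zero_mul, Finset.sum_const_zero]
    rw [e1, add_sub_cancel]

/-- Every strategy of the original MDP has a counterpart in the collapsed one. -/
theorem exists_strategy_collapse (hF : ∀ s ∈ F, M.Absorbing s) (σ : Strategy M) :
    ∃ τ : Strategy (M.collapse F), ∀ f ∈ F,
      τ.law.real ((M.collapse F).reach {st M F f}) = σ.law.real (M.reach {f}) := by
  have hx := σ.flow.isPlan_exitCount hF
  -- The exit counts of `σ` are split, and the split plan is realized. By `sum_split_act` its totals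
  -- over callers are the original counts, so the inflow into targets is the same.
  obtain ⟨ν, hν⟩ := (isPlan_split hx).exists_flow (absorbing_ends hF)
  refine ⟨ν.strategy, fun f hf => ?_⟩
  have h1 := ν.strategy.tendsto_mass_reach (T := {st M F f})
    (by simpa using absorbing_st hf (hF f hf))
  have h2 := σ.tendsto_mass_reach (T := {f}) (by simpa using hF f hf)
  simp only [Finset.sum_singleton] at h1 h2
  have h3 := hν (st M F f) (st_mem_ends.2 hf)
  rw [inflow_st (split_sink _)] at h3
  simp only [sum_split_act hx] at h3
  have h4 := tendsto_nhds_unique h2 (σ.flow.tendsto_mass_target hF hf)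
  rw [h4]
  refine tendsto_nhds_unique h1 (h3.congr fun n => ?_)
  simp only [Flow.mass, Flow.strategy_flow_w]

/-- Every strategy of the collapsed MDP has a counterpart in the original one. -/
theorem exists_strategy_original (hF : ∀ s ∈ F, M.Absorbing s) (τ : Strategy (M.collapse F)) :
    ∃ σ : Strategy M, ∀ f ∈ F,
      τ.law.real ((M.collapse F).reach {st M F f}) = σ.law.real (M.reach {f}) := by
  have hx := τ.flow.isPlan_exitCount (absorbing_ends hF)
  obtain ⟨μ, hμ⟩ := (isPlan_of_isPlan hx).exists_flow hF
  refine ⟨μ.strategy, fun f hf => ?_⟩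
  have h1 := τ.tendsto_mass_reach (T := {st M F f})
    (by simpa using absorbing_st hf (hF f hf))
  have h2 := μ.strategy.tendsto_mass_reach (T := {f}) (by simpa using hF f hf)
  simp only [Finset.sum_singleton] at h1 h2
  have h3 := hμ f hf
  rw [← inflow_st fun b => hx.supp _ b (not_outer_sink b)] at h3
  rw [tendsto_nhds_unique h1 (τ.flow.tendsto_mass_target (absorbing_ends hF)
    (st_mem_ends.2 hf))]
  refine (tendsto_nhds_unique h2 (h3.congr fun n => ?_)).symm
  simp only [Flow.mass, Flow.strategy_flow_w]

/-- The collapsed MDP is stopping. -/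
theorem law_reach_ends (hF : ∀ s ∈ F, M.Absorbing s) (τ : Strategy (M.collapse F)) :
    τ.law ((M.collapse F).reach (ends M F)) = 1 :=
  τ.law_reach_eq_one (absorbing_ends hF) fun s hs =>
    τ.flow.mass_tendsto_zero (absorbing_ends hF) hs (not_inner s)

end collapse

end MDP

end CPTReach

namespace CPTReach

open MDP

/-! ## The reduction and its correctness -/

namespace Problem

variable (I : Problem)

/-- The objective, transported to the collapsed MDP. -/
noncomputable def collapseObj : WRObjective (I.mdp.collapse I.obj.targets) where
  targets := collapse.copies I.mdp I.obj.targets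
  reward := Fin.lastCases (n := I.mdp.numStates) (motive := fun _ => ℚ) 0 I.obj.reward
  absorbing := collapse.absorbing_copies I.obj.absorbing
  reward_ne_zero s hs := by
    obtain ⟨t, ht, rfl⟩ := Finset.mem_map.1 hs
    refine ne_of_eq_of_ne ?_ (I.obj.reward_ne_zero t ht)
    exact Fin.lastCases_castSucc (motive := fun _ => ℚ) _

theorem collapseObj_reward (s : I.mdp.State) :
    I.collapseObj.reward (collapse.st I.mdp I.obj.targets s) = I.obj.reward s :=
  Fin.lastCases_castSucc (motive := fun _ => ℚ) _

/-- The query: for each outcome, the states that obtain it. -/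
noncomputable def query (i : Fin I.obj.numOutcomes) : Finset (I.mdp.collapse I.obj.targets).State :=
  I.collapseObj.obtainSet (collapse.sink I.mdp I.obj.targets) (I.obj.outcomeVec i)

theorem sameObjective : SameObjective I.obj I.collapseObj := by
  refine ⟨(Equiv.ofBijective (fun s : {s // s ∈ I.obj.targets} =>
    (⟨collapse.st I.mdp I.obj.targets s, collapse.st_mem_copies.2 s.2⟩ :
      {s // s ∈ I.collapseObj.targets})) ⟨fun s t h => ?_, fun s => ?_⟩), fun s => ?_⟩
  · exact Subtype.ext (collapse.st_injective (congrArg Subtype.val h))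
  · obtain ⟨t, ht, h⟩ := Finset.mem_map.1 s.2
    exact ⟨⟨t, ht⟩, Subtype.ext h⟩
  · exact I.collapseObj_reward s

theorem sink_not_mem : collapse.sink I.mdp I.obj.targets ∉ I.collapseObj.targets := fun h => by
  obtain ⟨t, -, h⟩ := Finset.mem_map.1 h
  exact collapse.st_ne_sink t h

theorem query_absorbing (i : Fin I.obj.numOutcomes) :
    ∀ s ∈ I.query i, (I.mdp.collapse I.obj.targets).Absorbing s := by
  intro s hs
  unfold query WRObjective.obtainSet at hs
  split_ifs at hs
  · rw [Finset.mem_singleton.1 hs]; exact collapse.absorbing_sink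
  · exact I.collapseObj.absorbing s (Finset.mem_filter.1 hs).1

/-- The reachability probabilities of the query under a strategy. -/
noncomputable def queryProb (τ : Strategy (I.mdp.collapse I.obj.targets)) (i : Fin I.obj.numOutcomes) : ℝ :=
  τ.law.real ((I.mdp.collapse I.obj.targets).reach (I.query i))

theorem queryProb_of_ne_zero (τ : Strategy (I.mdp.collapse I.obj.targets)) {i : Fin I.obj.numOutcomes}
    (hi : I.obj.outcomeVec i ≠ 0) :
    I.queryProb τ i = ∑ s ∈ I.obj.targets with I.obj.reward s = I.obj.outcomeVec i,
      τ.law.real ((I.mdp.collapse I.obj.targets).reach {collapse.st I.mdp I.obj.targets s}) := by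
  classical
  rw [queryProb, τ.law_real_reach (I.query_absorbing i)]
  have h : I.query i = (I.obj.targets.filter fun s => I.obj.reward s =
      I.obj.outcomeVec i).map ⟨collapse.st I.mdp I.obj.targets, collapse.st_injective⟩ := by
    rw [query, WRObjective.obtainSet, if_neg hi]
    change Finset.filter _ (Finset.map _ _) = _
    rw [Finset.filter_map]
    congr 1
    exact Finset.filter_congr fun s _ => by
      simp only [Function.comp_apply, Function.Embedding.coeFn_mk, I.collapseObj_reward]
  rw [h, Finset.sum_map]
  rfl

theorem exists_outcomeVec_eq {o : ℚ} (ho : o ∈ I.obj.outcomes) :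
    ∃ i, I.obj.outcomeVec i = o := by
  rw [← I.obj.image_outcomeVec, Finset.mem_map] at ho
  obtain ⟨i, -, hi⟩ := ho
  exact ⟨i, hi⟩

/-- The query sets partition the absorbing end states, one of which is reached almost surely. -/
theorem sum_queryProb (τ : Strategy (I.mdp.collapse I.obj.targets)) : ∑ i, I.queryProb τ i = 1 := by
  classical
  have h1 : ∀ i, I.queryProb τ i = ∑ s ∈ I.query i, τ.law.real ((I.mdp.collapse I.obj.targets).reach {s}) :=
    fun i => τ.law_real_reach (I.query_absorbing i)
  -- A state determines the outcome that it obtains, which gives disjointness.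
  have hval : ∀ i, ∀ s ∈ I.query i, I.obj.outcomeVec i =
      if s = collapse.sink I.mdp I.obj.targets then 0 else I.collapseObj.reward s := by
    intro i s hs
    unfold query WRObjective.obtainSet at hs
    split_ifs at hs with h0
    · rw [h0, if_pos (Finset.mem_singleton.1 hs)]
    · obtain ⟨hs1, hs2⟩ := Finset.mem_filter.1 hs
      rw [if_neg (fun h : s = collapse.sink I.mdp I.obj.targets => I.sink_not_mem (h ▸ hs1)), hs2]
  have hdisj : Set.PairwiseDisjoint (↑(Finset.univ : Finset (Fin I.obj.numOutcomes)))
      I.query := by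
    intro i _ j _ hij
    refine Finset.disjoint_left.2 fun s hi hj => hij ?_
    exact I.obj.outcomeVec_strictMono.injective ((hval i s hi).trans (hval j s hj).symm)
  have hunion : Finset.univ.biUnion I.query =
      collapse.ends I.mdp I.obj.targets := by
    ext s
    simp only [Finset.mem_biUnion, Finset.mem_univ, true_and, collapse.ends, Finset.mem_insert]
    constructor
    · rintro ⟨i, hs⟩
      unfold query WRObjective.obtainSet at hs
      split_ifs at hs
      · exact Or.inl (Finset.mem_singleton.1 hs)
      · exact Or.inr (Finset.mem_filter.1 hs).1
    · rintro (rfl | hs)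
      · obtain ⟨i, hi⟩ := I.exists_outcomeVec_eq (o := 0) (Finset.mem_insert_self _ _)
        refine ⟨i, ?_⟩
        rw [query, WRObjective.obtainSet, if_pos hi]
        exact Finset.mem_singleton_self _
      · obtain ⟨t, ht, rfl⟩ := Finset.mem_map.1 hs
        obtain ⟨i, hi⟩ := I.exists_outcomeVec_eq (o := I.obj.reward t)
          (Finset.mem_insert_of_mem (Finset.mem_image_of_mem _ ht))
        refine ⟨i, ?_⟩
        rw [query, WRObjective.obtainSet, if_neg (hi ▸ I.obj.reward_ne_zero t ht)]
        exact Finset.mem_filter.2 ⟨hs, (I.collapseObj_reward t).trans hi.symm⟩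
  rw [Finset.sum_congr rfl fun i _ => h1 i, ← Finset.sum_biUnion hdisj, hunion]
  have h2 := τ.law_real_reach (collapse.absorbing_ends I.obj.absorbing)
  refine h2.symm.trans ?_
  rw [measureReal_def, ENNReal.toReal_eq_one_iff]
  exact collapse.law_reach_ends I.obj.absorbing τ

theorem stopping : I.collapseObj.Stopping (collapse.sink I.mdp I.obj.targets) := fun τ =>
  collapse.law_reach_ends I.obj.absorbing τ

/-- The outcome distributions of matching strategies agree. -/
theorem outcomeProb_eq_queryProb {σ : Strategy I.mdp} {τ : Strategy (I.mdp.collapse I.obj.targets)}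
    (h : ∀ f ∈ I.obj.targets,
      τ.law.real ((I.mdp.collapse I.obj.targets).reach {collapse.st I.mdp I.obj.targets f}) =
        σ.law.real (I.mdp.reach {f})) : I.obj.outcomeProb σ = I.queryProb τ := by
  classical
  have h1 : ∀ i, I.obj.outcomeVec i ≠ 0 → I.obj.outcomeProb σ i = I.queryProb τ i := by
    intro i hi
    rw [I.obj.outcomeProb_eq σ i hi, I.queryProb_of_ne_zero τ hi]
    exact Finset.sum_congr rfl fun s hs => (h s (Finset.mem_filter.1 hs).1).symm
  funext i
  by_cases hi : I.obj.outcomeVec i = 0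
  · have e1 := I.obj.sum_outcomeProb σ
    have e2 := I.sum_queryProb τ
    rw [← Finset.add_sum_erase _ _ (Finset.mem_univ i)] at e1 e2
    have e3 : ∑ j ∈ Finset.univ.erase i, I.obj.outcomeProb σ j =
        ∑ j ∈ Finset.univ.erase i, I.queryProb τ j :=
      Finset.sum_congr rfl fun j hj => h1 j fun h0 => (Finset.mem_erase.1 hj).1
        (I.obj.outcomeVec_strictMono.injective (h0.trans hi.symm))
    linarith
  · exact h1 i hi

theorem range_queryProb : Set.range I.queryProb = Set.range I.obj.outcomeProb := by
  ext p
  constructor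
  · rintro ⟨τ, rfl⟩
    obtain ⟨σ, hσ⟩ := collapse.exists_strategy_original I.obj.absorbing τ
    exact ⟨σ, I.outcomeProb_eq_queryProb hσ⟩
  · rintro ⟨σ, rfl⟩
    obtain ⟨τ, hτ⟩ := collapse.exists_strategy_collapse I.obj.absorbing σ
    exact ⟨τ, (I.outcomeProb_eq_queryProb hτ).symm⟩

/-- All vectors of query probabilities have the same sum, so one can dominate another only by being
equal to it. Conversely, a maximal point coincides with the vector of any strategy that achieves it.
-/
theorem paretoFrontier_eq :
    paretoFrontier (I.mdp.collapse I.obj.targets) I.query = Set.range I.obj.outcomeProb := by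
  rw [← I.range_queryProb]
  have hach : ∀ τ, I.queryProb τ ∈ achievable (I.mdp.collapse I.obj.targets) I.query :=
    fun τ => ⟨τ, fun _ => le_rfl⟩
  ext p
  constructor
  · rintro ⟨⟨τ, hτ⟩, hmax⟩
    refine ⟨τ, ?_⟩
    by_contra hne
    exact hmax ⟨_, hach τ, Ne.symm hne, hτ⟩
  · rintro ⟨τ, rfl⟩
    refine ⟨hach τ, ?_⟩
    rintro ⟨q, ⟨τ', hq⟩, hne, hle⟩
    apply hne
    have h1 : ∀ i, I.queryProb τ i ≤ I.queryProb τ' i := fun i => (hle i).trans (hq i)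
    have h2 : ∑ i, I.queryProb τ i = ∑ i, I.queryProb τ' i := by
      rw [sum_queryProb, sum_queryProb]
    funext i
    have h3 := (Finset.sum_eq_sum_iff_of_le fun i _ => h1 i).1 h2 i (Finset.mem_univ i)
    exact le_antisymm (hle i) ((hq i).trans h3.symm.le)

theorem image_cpt_paretoFrontier (C : CPT) :
    (fun p => C.cpt (fun i => (I.obj.outcomeVec i : ℝ)) p) ''
      paretoFrontier (I.mdp.collapse I.obj.targets) I.query =
    Set.range fun σ : Strategy I.mdp => C.strategyValue I.obj σ := by
  rw [paretoFrontier_eq, ← Set.range_comp]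
  congr 1
  funext σ
  exact (C.strategyValue_eq_cpt I.obj σ).symm

theorem bddAbove_strategyValue (C : CPT) :
    BddAbove (Set.range fun σ : Strategy I.mdp => C.strategyValue I.obj σ) := by
  refine ⟨∑ i, |C.u (I.obj.outcomeVec i)|, ?_⟩
  rintro _ ⟨σ, rfl⟩
  simp only [C.strategyValue_eq_cpt]
  exact C.cpt_le _ (I.obj.outcomeProb_nonneg σ) (I.obj.sum_outcomeProb σ)

/-- The reduction from the CPT-value to multi-objective reachability. -/
noncomputable def reduct : Reduct I.obj.numOutcomes where
  mdp := I.mdp.collapse I.obj.targets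
  obj := I.collapseObj
  sink := collapse.sink I.mdp I.obj.targets
  query := I.query

end Problem

end CPTReach

namespace CPTReach

/-! ## Polynomial-time functions on coded data -/

/-- Writing a result is charged, so running time bounds its size. This lets time bounds compose. -/
theorem Runs.size_le {P : Prog} {v w : Val} {t : ℕ} (h : Runs P v w t) : w.size ≤ t := by
  induction h with
  | prim op v => omega
  | seq _ _ _ ih => omega
  | fork _ _ ih₁ ih₂ => simp only [Val.size]; omega
  | cond_true _ _ _ _ ih => omega
  | cond_false _ _ _ ih => omega
  | loop_stop _ _ => omega
  | loop_step _ _ _ _ _ _ ih => omega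

theorem Val.one_le_size (v : Val) : 1 ≤ v.size := by
  cases v <;> simp only [Val.size] <;> omega

theorem eval_mono (p : Polynomial ℕ) {a b : ℕ} (h : a ≤ b) : p.eval a ≤ p.eval b := by
  rw [Polynomial.eval_eq_sum, Polynomial.eval_eq_sum]
  exact Finset.sum_le_sum fun i _ => Nat.mul_le_mul_left _ (Nat.pow_le_pow_left h i)

/-- Types whose elements are coded as data of the machine. -/
class Code (α : Type) where
  code : α → Val

open CPTReach.Code (code)

instance : Code ℤ := ⟨Val.int⟩

instance : Code ℕ := ⟨fun n => Val.int n⟩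

instance : Code Bool := ⟨fun b => Val.int (if b then 1 else 0)⟩

instance {α β : Type} [Code α] [Code β] : Code (α × β) := ⟨fun x => .pair (code x.1) (code x.2)⟩

instance {α : Type} [Code α] : Code (List α) := ⟨fun l => Val.list (l.map code)⟩

/-- Optional pairs are coded without a marker. -/
instance {α β : Type} [Code α] [Code β] : Code (Option (α × β)) :=
  ⟨fun o => o.elim (.int 0) code⟩

/-- The bit size of the code. -/
def csize {α : Type} [Code α] (a : α) : ℕ := (code a).size

/-- Functions that some program computes on codes in polynomial time. -/
@[fun_prop]
def PT {α β : Type} [Code α] [Code β] (f : α → β) : Prop :=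
  ∃ (P : Prog) (p : Polynomial ℕ), ∀ a, ∃ t, Runs P (code a) (code (f a)) t ∧ t ≤ p.eval (csize a)

theorem csize_pair {α β : Type} [Code α] [Code β] (a : α) (b : β) :
    csize (a, b) = 1 + csize a + csize b := rfl

theorem csize_cons {α : Type} [Code α] (a : α) (l : List α) :
    csize (a :: l) = 1 + csize a + csize l := rfl

theorem csize_nil {α : Type} [Code α] : csize ([] : List α) = 1 := rfl

theorem one_le_csize {α : Type} [Code α] (a : α) : 1 ≤ csize a := Val.one_le_size _

theorem csize_bool (b : Bool) : csize b ≤ 2 := by cases b <;> decide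

theorem csize_nat_le (n : ℕ) : csize n ≤ 1 + n := by
  have : Nat.size n ≤ n := Nat.size_le.2 n.lt_two_pow_self
  change 1 + (Int.natAbs n).size ≤ _
  rw [Int.natAbs_natCast]; omega

theorem length_le_csize {α : Type} [Code α] (l : List α) : l.length + 1 ≤ csize l := by
  induction l with
  | nil => exact le_rfl
  | cons a l ih => rw [csize_cons, List.length_cons]; omega

theorem csize_le_of_mem {α : Type} [Code α] {l : List α} {a : α} (h : a ∈ l) :
    csize a ≤ csize l := by
  induction l with
  | nil => cases h
  | cons b l ih =>
    rw [csize_cons]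
    rcases List.mem_cons.1 h with rfl | h
    · omega
    · have := ih h; omega

theorem csize_le_of_forall {α : Type} [Code α] (l : List α) {B : ℕ} (h : ∀ a ∈ l, csize a ≤ B) :
    csize l ≤ 1 + l.length * (1 + B) := by
  induction l with
  | nil => simp [csize_nil]
  | cons b l ih =>
    rw [csize_cons, List.length_cons, add_mul]
    have := h b List.mem_cons_self
    have := ih fun a ha => h a (List.mem_cons_of_mem _ ha)
    omega

theorem csize_append {α : Type} [Code α] (l l' : List α) :
    csize (l ++ l') + 1 = csize l + csize l' := by
  induction l with
  | nil => rw [List.nil_append, csize_nil]; omega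
  | cons b l ih => rw [List.cons_append, csize_cons, csize_cons]; omega

theorem csize_reverse {α : Type} [Code α] (l : List α) : csize l.reverse = csize l := by
  induction l with
  | nil => rfl
  | cons b l ih =>
    have := csize_append l.reverse [b]
    rw [csize_cons, csize_nil] at this
    rw [List.reverse_cons, csize_cons]; omega

namespace PT

variable {α β γ δ : Type} [Code α] [Code β] [Code γ] [Code δ]

/-- A bound for the size of the result. -/
theorem exists_csize_le {f : α → β} (hf : PT f) :
    ∃ p : Polynomial ℕ, ∀ a, csize (f a) ≤ p.eval (csize a) := by
  obtain ⟨P, p, h⟩ := hf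
  refine ⟨p, fun a => ?_⟩
  obtain ⟨t, h1, h2⟩ := h a
  exact h1.size_le.trans h2

/-- A program sees only codes, so functions whose values have the same codes share their programs,
even when the types differ. -/
theorem congr_code {f : α → β} {g : α → γ} (hf : PT f) (h : ∀ a, code (g a) = code (f a)) :
    PT g := by
  obtain ⟨P, p, hp⟩ := hf
  exact ⟨P, p, fun a => by rw [h]; exact hp a⟩

theorem of_prim (op : PrimOp) {f : α → β} (p : Polynomial ℕ)
    (h : ∀ a, op.eval (code a) = code (f a)) (hp : ∀ a, csize (f a) ≤ p.eval (csize a)) :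
    PT f := by
  refine ⟨.prim op, 1 + Polynomial.X + p, fun a => ⟨_, h a ▸ Runs.prim op (code a), ?_⟩⟩
  simp only [Polynomial.eval_add, Polynomial.eval_one, Polynomial.eval_X]
  have := hp a
  exact Nat.add_le_add_left this _

@[fun_prop]
theorem id' : PT fun x : α => x :=
  of_prim .id Polynomial.X (fun _ => rfl) fun a => by simp

@[fun_prop]
theorem const (b : β) : PT fun _ : α => b :=
  of_prim (.const (code b)) (Polynomial.C (csize b)) (fun _ => rfl) fun a => by simp

@[fun_prop]
theorem comp {g : β → γ} {f : α → β} (hg : PT g) (hf : PT f) : PT fun x => g (f x) := by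
  obtain ⟨P, p, hp⟩ := hf
  obtain ⟨Q, q, hq⟩ := hg
  refine ⟨.seq P Q, 1 + p + q.comp p, fun a => ?_⟩
  obtain ⟨t₁, h1, h2⟩ := hp a
  obtain ⟨t₂, h3, h4⟩ := hq (f a)
  refine ⟨_, Runs.seq h1 h3, ?_⟩
  have := eval_mono q (h1.size_le.trans h2)
  simp only [Polynomial.eval_add, Polynomial.eval_one, Polynomial.eval_comp]
  unfold csize at h4
  omega

@[fun_prop]
theorem prodMk {f : α → β} {g : α → γ} (hf : PT f) (hg : PT g) : PT fun x => (f x, g x) := by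
  obtain ⟨P, p, hp⟩ := hf
  obtain ⟨Q, q, hq⟩ := hg
  refine ⟨.fork P Q, 1 + Polynomial.X + p + q, fun a => ?_⟩
  obtain ⟨t₁, h1, h2⟩ := hp a
  obtain ⟨t₂, h3, h4⟩ := hq a
  refine ⟨_, Runs.fork h1 h3, ?_⟩
  simp only [Polynomial.eval_add, Polynomial.eval_one, Polynomial.eval_X]
  unfold csize at h2 h4 ⊢
  omega

@[fun_prop]
theorem fst : PT fun x : α × β => x.1 :=
  of_prim .fst Polynomial.X (fun _ => rfl) fun ⟨a, b⟩ => by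
    rw [Polynomial.eval_X, csize_pair]; dsimp only; omega

@[fun_prop]
theorem snd : PT fun x : α × β => x.2 :=
  of_prim .snd Polynomial.X (fun _ => rfl) fun ⟨a, b⟩ => by
    rw [Polynomial.eval_X, csize_pair]; dsimp only; omega

theorem natSize_add_le (a b : ℕ) : Nat.size (a + b) ≤ Nat.size a + Nat.size b + 1 := by
  rw [Nat.size_le]
  have ha := Nat.lt_size_self a
  have hb := Nat.lt_size_self b
  have h1 : 2 ^ Nat.size a ≤ 2 ^ (Nat.size a + Nat.size b) := Nat.pow_le_pow_right (by omega) (by omega)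
  have h2 : 2 ^ Nat.size b ≤ 2 ^ (Nat.size a + Nat.size b) := Nat.pow_le_pow_right (by omega) (by omega)
  rw [pow_succ]; omega

theorem natSize_mul_le (a b : ℕ) : Nat.size (a * b) ≤ Nat.size a + Nat.size b := by
  rw [Nat.size_le, pow_add]
  exact Nat.mul_lt_mul'' (Nat.lt_size_self a) (Nat.lt_size_self b)

theorem intMul : PT fun x : ℤ × ℤ => x.1 * x.2 := by
  refine of_prim .mul Polynomial.X (fun _ => rfl) fun ⟨x, y⟩ => ?_
  have := natSize_mul_le x.natAbs y.natAbs
  rw [Polynomial.eval_X, csize_pair]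
  change 1 + (x * y).natAbs.size ≤ 1 + (1 + _) + (1 + _)
  rw [Int.natAbs_mul]; omega

@[fun_prop]
theorem mul {f g : α → ℤ} (hf : PT f) (hg : PT g) : PT fun x => f x * g x :=
  intMul.comp (hf.prodMk hg)

theorem intLe : PT fun x : ℤ × ℤ => decide (x.1 ≤ x.2) := by
  refine of_prim .le 2 (fun ⟨x, y⟩ => ?_) fun _ => ?_
  · change Val.int _ = Val.int _
    simp only [decide_eq_true_eq]
  · exact (csize_bool _).trans (by simp)

@[fun_prop]
theorem le {f g : α → ℤ} (hf : PT f) (hg : PT g) : PT fun x => decide (f x ≤ g x) :=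
  intLe.comp (hf.prodMk hg)

theorem natAdd : PT fun x : ℕ × ℕ => x.1 + x.2 := by
  refine of_prim .add Polynomial.X (fun ⟨x, y⟩ => ?_) fun ⟨x, y⟩ => ?_
  · change Val.int _ = Val.int _
    simp
  · have := natSize_add_le x y
    rw [Polynomial.eval_X, csize_pair]
    change 1 + (Int.natAbs ((x + y : ℕ) : ℤ)).size ≤
      1 + (1 + (Int.natAbs (x : ℤ)).size) + (1 + (Int.natAbs (y : ℤ)).size)
    simp only [Int.natAbs_natCast]
    omega

@[fun_prop]
theorem add {f g : α → ℕ} (hf : PT f) (hg : PT g) : PT fun x => f x + g x :=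
  natAdd.comp (hf.prodMk hg)

theorem natMul : PT fun x : ℕ × ℕ => x.1 * x.2 := by
  refine of_prim .mul Polynomial.X (fun ⟨x, y⟩ => ?_) fun ⟨x, y⟩ => ?_
  · change Val.int _ = Val.int _
    simp
  · have := natSize_mul_le x y
    rw [Polynomial.eval_X, csize_pair]
    change 1 + (Int.natAbs ((x * y : ℕ) : ℤ)).size ≤
      1 + (1 + (Int.natAbs (x : ℤ)).size) + (1 + (Int.natAbs (y : ℤ)).size)
    simp only [Int.natAbs_natCast]
    omega

@[fun_prop]
theorem nat_mul {f g : α → ℕ} (hf : PT f) (hg : PT g) : PT fun x => f x * g x :=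
  natMul.comp (hf.prodMk hg)

@[fun_prop]
theorem natCast {f : α → ℕ} (hf : PT f) : PT fun x => (f x : ℤ) :=
  hf.congr_code fun _ => rfl

@[fun_prop]
theorem ite {c : α → Bool} {f g : α → β} (hc : PT c) (hf : PT f) (hg : PT g) :
    PT fun x => bif c x then f x else g x := by
  obtain ⟨P, p, hp⟩ := hc
  obtain ⟨Q, q, hq⟩ := hf
  obtain ⟨R, r, hr⟩ := hg
  refine ⟨.cond P Q R, 1 + Polynomial.X + p + q + r, fun a => ?_⟩
  obtain ⟨t₁, h1, h2⟩ := hp a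
  obtain ⟨t₂, h3, h4⟩ := hq a
  obtain ⟨t₃, h5, h6⟩ := hr a
  simp only [Polynomial.eval_add, Polynomial.eval_one, Polynomial.eval_X]
  cases hca : c a with
  | true =>
    rw [hca] at h1
    refine ⟨_, Runs.cond_true h1 (fun h => by injection h with h; simp at h) h3, ?_⟩
    unfold csize at *; omega
  | false =>
    rw [hca] at h1
    refine ⟨_, Runs.cond_false h1 h5, ?_⟩
    unfold csize at *; omega

@[fun_prop]
theorem and {f g : α → Bool} (hf : PT f) (hg : PT g) : PT fun x => f x && g x := by
  have h := ite hf hg (const false)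
  simpa only [Bool.cond_false_right] using h

@[fun_prop]
theorem or {f g : α → Bool} (hf : PT f) (hg : PT g) : PT fun x => f x || g x := by
  have h := ite hf (const true) hg
  simpa only [Bool.cond_true_left] using h

@[fun_prop]
theorem not {f : α → Bool} (hf : PT f) : PT fun x => !f x := by
  have h := ite hf (const false) (const true)
  refine h.congr_code fun a => ?_
  cases f a <;> rfl

@[fun_prop]
theorem int_eq {f g : α → ℤ} (hf : PT f) (hg : PT g) : PT fun x => decide (f x = g x) := by
  refine ((hf.le hg).and (hg.le hf)).congr_code fun a => ?_
  rw [← Bool.decide_and]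
  simp only [le_antisymm_iff]

@[fun_prop]
theorem nat_eq {f g : α → ℕ} (hf : PT f) (hg : PT g) : PT fun x => decide (f x = g x) := by
  refine (int_eq hf.natCast hg.natCast).congr_code fun a => ?_
  simp only [Nat.cast_inj]

/-- Case distinction on an optional pair. -/
theorem option_elim {o : α → Option (β × γ)} {d : α → δ} {f : α → β × γ → δ} (ho : PT o)
    (hd : PT d) (hf : PT fun x : α × (β × γ) => f x.1 x.2) :
    PT fun x => (o x).elim (d x) (f x) := by
  obtain ⟨P, p, hp⟩ := ho
  obtain ⟨Q, q, hq⟩ := hd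
  obtain ⟨R, r, hr⟩ := hf
  -- A present value is coded as a pair and `none` as an integer, so `isPair` decides the case; the
  -- fork hands the original input to `R` together with the value.
  refine ⟨.cond (.seq P (.prim .isPair)) (.seq (.fork (.prim .id) P) R) Q,
    10 + 4 * Polynomial.X + 4 * p + q + r.comp (1 + Polynomial.X + p), fun a => ?_⟩
  obtain ⟨t₁, h1, h2⟩ := hp a
  have h0 : Runs (.prim .id) (code a) (code a) (1 + (code a).size + (code a).size) :=
    Runs.prim .id (code a)
  simp only [Polynomial.eval_add, Polynomial.eval_mul, Polynomial.eval_X, Polynomial.eval_comp,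
    Polynomial.eval_ofNat, Polynomial.eval_one]
  have hs := h1.size_le
  cases hoa : o a with
  | none =>
    obtain ⟨t₂, h3, h4⟩ := hq a
    rw [hoa] at h1 hs
    refine ⟨_, Runs.cond_false (Runs.seq h1 (Runs.prim .isPair _)) h3, ?_⟩
    change 1 + (code a).size + (1 + t₁ + (1 + (code (none : Option (β × γ))).size + 1)) + t₂ ≤ _
    unfold csize at *
    omega
  | some y =>
    rw [hoa] at h1 hs
    obtain ⟨t₂, h3, h4⟩ := hr (a, y)
    refine ⟨_, Runs.cond_true (Runs.seq h1 (Runs.prim .isPair _))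
      (show Val.int 1 ≠ Val.int 0 from fun h => by injection h with h; simp at h)
      (Runs.seq (Runs.fork h0 h1) h3), ?_⟩
    have h5 : csize (a, y) ≤ 1 + csize a + p.eval (csize a) := by
      rw [csize_pair]
      exact Nat.add_le_add_left (hs.trans h2) _
    have h6 := eval_mono r h5
    change 1 + (code a).size + (1 + t₁ + (1 + (code (some y)).size + 2)) +
      (1 + (1 + (code a).size + (1 + (code a).size + (code a).size) + t₁) + t₂) ≤ _
    unfold csize at *
    omega

/-- All intermediate states need a common size bound `B`, because iterating a step of polynomial
growth need not give polynomial growth. -/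
theorem loop {c : α → Bool} {f : α → α} (hc : PT c) (hf : PT f) :
    ∃ (P : Prog) (p : Polynomial ℕ), ∀ (n B : ℕ) (a : α), (∀ i < n, c (f^[i] a) = true) →
      c (f^[n] a) = false → (∀ i ≤ n, csize (f^[i] a) ≤ B) →
      ∃ t, Runs P (code a) (code (f^[n] a)) t ∧ t ≤ (n + 1) * p.eval B := by
  obtain ⟨P, p, hp⟩ := hc
  obtain ⟨Q, q, hq⟩ := hf
  refine ⟨.loop P Q, 1 + Polynomial.X + p + q, fun n B => ?_⟩
  simp only [Polynomial.eval_add, Polynomial.eval_one, Polynomial.eval_X]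
  induction n with
  | zero =>
    intro a _ h2 h3
    obtain ⟨t₁, r1, r2⟩ := hp a
    have hB := h3 0 le_rfl
    have := eval_mono p hB
    have h2' : c a = false := h2
    rw [h2'] at r1
    refine ⟨_, Runs.loop_stop r1, ?_⟩
    simp only [Function.iterate_zero, id_eq] at *
    unfold csize at *; omega
  | succ n ih =>
    intro a h1 h2 h3
    obtain ⟨t₁, r1, r2⟩ := hp a
    obtain ⟨t₂, r3, r4⟩ := hq a
    obtain ⟨t₃, r5, r6⟩ := ih (f a) (fun i hi => h1 (i + 1) (by omega)) h2
      fun i hi => h3 (i + 1) (by omega)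
    have hB := h3 0 (by omega)
    have e1 := eval_mono p hB
    have e2 := eval_mono q hB
    have h1' : c a = true := h1 0 (by omega)
    rw [h1'] at r1
    refine ⟨_, Runs.loop_step r1 (by intro h; injection h with h; simp at h) r3 r5, ?_⟩
    rw [add_mul (n + 1) 1]
    simp only [Function.iterate_zero, id_eq] at *
    unfold csize at *; omega

@[fun_prop]
theorem cons {f : α → β} {g : α → List β} (hf : PT f) (hg : PT g) : PT fun x => f x :: g x :=
  (hf.prodMk hg).congr_code fun _ => rfl

/-- Head and tail of a list. -/
def uncons {β : Type} : List β → Option (β × List β)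
  | [] => none
  | a :: l => some (a, l)

@[fun_prop]
theorem pt_uncons : PT (uncons : List β → _) :=
  PT.id'.congr_code fun l => by cases l <;> rfl

/-- The loop runs on the parameter, the rest of the list and the accumulator. After `i` rounds the
accumulator is the fold of a prefix, which `hB` keeps polynomial. -/
theorem foldl {b : α → β} {l : α → List γ} {f : α → β → γ → β} (hb : PT b) (hl : PT l)
    (hf : PT fun x : α × β × γ => f x.1 x.2.1 x.2.2) (B : Polynomial ℕ)
    (hB : ∀ x l', l' <+: l x → csize (l'.foldl (f x) (b x)) ≤ B.eval (csize x)) :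
    PT fun x => (l x).foldl (f x) (b x) := by
  let F : α × List γ × β → α × List γ × β := fun s =>
    (uncons s.2.1).elim s fun y => (s.1, y.2, f s.1 s.2.2 y.1)
  have hF : PT F := by
    refine option_elim (by fun_prop) (by fun_prop) ?_
    have : PT fun x : (α × List γ × β) × γ × List γ => (x.1.1, x.1.2.2, x.2.1) := by fun_prop
    have := hf.comp this
    fun_prop
  have hC : PT fun s : α × List γ × β => (uncons s.2.1).elim false fun _ => true :=
    option_elim (by fun_prop) (by fun_prop) (by fun_prop)
  obtain ⟨P, p, hP⟩ := loop hC hF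
  obtain ⟨q, hq⟩ := hl.exists_csize_le
  have hinit : PT fun x => (x, l x, b x) := by fun_prop
  have hout : PT fun s : α × List γ × β => s.2.2 := by fun_prop
  obtain ⟨Q, r, hQ⟩ := hinit
  have hloop : ∀ x, ∃ t, Runs P (code (x, l x, b x)) (code (x, ([] : List γ), (l x).foldl (f x) (b x)))
      t ∧ t ≤ (q.eval (csize x) + 1) * p.eval (2 + csize x + q.eval (csize x) + B.eval (csize x)) := by
    intro x
    have hit : ∀ (n : ℕ), n ≤ (l x).length → F^[n] (x, l x, b x) =
        (x, (l x).drop n, ((l x).take n).foldl (f x) (b x)) := by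
      intro n
      induction n with
      | zero => intro _; simp
      | succ n ih =>
        intro hn
        rw [Function.iterate_succ_apply', ih (by omega), List.drop_eq_getElem_cons (by omega),
          List.take_succ_eq_append_getElem (by omega), List.foldl_append]
        rfl
    have hend := hit _ le_rfl
    rw [List.drop_length, List.take_length] at hend
    obtain ⟨t, h1, h2⟩ := hP (l x).length (2 + csize x + q.eval (csize x) + B.eval (csize x))
      (x, l x, b x) (fun i hi => by
        rw [hit i hi.le, List.drop_eq_getElem_cons hi]; rfl) (by rw [hend]; rfl)
      (fun i hi => by
        rw [hit i hi, csize_pair, csize_pair]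
        have e1 := hB x _ ((l x).take_prefix i)
        have e2 := hq x
        have e3 := csize_append ((l x).take i) ((l x).drop i)
        rw [List.take_append_drop] at e3
        have e4 := one_le_csize ((l x).take i)
        omega)
    rw [hend] at h1
    refine ⟨t, h1, h2.trans (Nat.mul_le_mul_right _ ?_)⟩
    have := length_le_csize (l x)
    have := hq x
    omega
  obtain ⟨R, u, hR⟩ := hout
  refine ⟨.seq Q (.seq P R), 2 + r + (q + 1) * p.comp (2 + Polynomial.X + q + B) +
    u.comp (4 + Polynomial.X + B), fun x => ?_⟩
  obtain ⟨t₁, a1, a2⟩ := hQ x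
  obtain ⟨t₂, b1, b2⟩ := hloop x
  obtain ⟨t₃, c1, c2⟩ := hR (x, [], (l x).foldl (f x) (b x))
  refine ⟨_, Runs.seq a1 (Runs.seq b1 c1), ?_⟩
  have h3 : csize (x, ([] : List γ), (l x).foldl (f x) (b x)) ≤
      4 + csize x + B.eval (csize x) := by
    have := hB x _ List.prefix_rfl
    rw [csize_pair, csize_pair, csize_nil]; omega
  have h4 := eval_mono u h3
  simp only [Polynomial.eval_add, Polynomial.eval_mul, Polynomial.eval_X, Polynomial.eval_comp,
    Polynomial.eval_ofNat, Polynomial.eval_one]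
  omega

end PT

end CPTReach

namespace CPTReach

open CPTReach.Code (code)

/-! ## Polynomial-time list functions -/

namespace PT

variable {α β γ δ : Type} [Code α] [Code β] [Code γ] [Code δ]

theorem foldl_flip_cons {β : Type} (l : List β) :
    l.foldl (fun acc y => y :: acc) [] = l.reverse := by
  simp

@[fun_prop]
theorem reverse {l : α → List β} (hl : PT l) : PT fun x => (l x).reverse := by
  obtain ⟨p, hp⟩ := hl.exists_csize_le
  refine (foldl (b := fun _ => []) (f := fun _ acc y => y :: acc) (const _) hl (by fun_prop) p
    fun x l' h => ?_).congr_code fun x => by rw [foldl_flip_cons]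
  obtain ⟨l'', hl''⟩ := h
  have := csize_append l' l''
  have := one_le_csize l''
  rw [foldl_flip_cons, csize_reverse]
  exact (hl'' ▸ hp x).trans' (by omega)

/-- A left fold over the reversed list, so the size bound is needed for suffixes. -/
theorem foldr {b : α → β} {l : α → List γ} {f : α → γ → β → β} (hb : PT b) (hl : PT l)
    (hf : PT fun x : α × γ × β => f x.1 x.2.1 x.2.2) (B : Polynomial ℕ)
    (hB : ∀ x l', l' <:+ l x → csize (l'.foldr (f x) (b x)) ≤ B.eval (csize x)) :
    PT fun x => (l x).foldr (f x) (b x) := by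
  have h1 : PT fun x : α × β × γ => (x.1, x.2.2, x.2.1) := by fun_prop
  refine (foldl (f := fun x acc y => f x y acc) hb hl.reverse (hf.comp h1) B
    fun x l' h => ?_).congr_code fun x => by rw [List.foldl_reverse]
  have := hB x l'.reverse (by
    rw [← List.reverse_prefix, List.reverse_reverse]; exact h)
  rwa [List.foldr_reverse] at this

@[fun_prop]
theorem map {l : α → List β} {f : α → β → γ} (hl : PT l)
    (hf : PT fun x : α × β => f x.1 x.2) : PT fun x => (l x).map (f x) := by
  obtain ⟨p, hp⟩ := hl.exists_csize_le
  obtain ⟨q, hq⟩ := hf.exists_csize_le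
  have h1 : PT fun x : α × β × List γ => (x.1, x.2.1) := by fun_prop
  have h2 : PT fun x : α × β × List γ => f x.1 x.2.1 := hf.comp h1
  refine (foldr (b := fun _ => []) (f := fun x y acc => f x y :: acc) (const _) hl (by fun_prop)
    (1 + p * (1 + q.comp (1 + Polynomial.X + p))) fun x l' h => ?_).congr_code
    fun x => by rw [List.map_eq_foldr]
  rw [← List.map_eq_foldr]
  simp only [Polynomial.eval_add, Polynomial.eval_mul, Polynomial.eval_X, Polynomial.eval_comp,
    Polynomial.eval_one]
  have h3 : l'.length ≤ p.eval (csize x) := by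
    have := h.length_le
    have := length_le_csize (l x)
    have := hp x
    omega
  refine (csize_le_of_forall (B := q.eval (1 + csize x + p.eval (csize x))) _ fun a ha => ?_).trans
    ?_
  · obtain ⟨y, hy, rfl⟩ := List.mem_map.1 ha
    refine (hq (x, y)).trans (eval_mono q ?_)
    rw [csize_pair]
    exact Nat.add_le_add_left ((csize_le_of_mem (h.mem hy)).trans (hp x)) _
  · rw [List.length_map]
    exact Nat.add_le_add_left (Nat.mul_le_mul_right _ h3) _

@[fun_prop]
theorem append {l l' : α → List β} (hl : PT l) (hl' : PT l') : PT fun x => l x ++ l' x := by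
  obtain ⟨p, hp⟩ := hl.exists_csize_le
  obtain ⟨q, hq⟩ := hl'.exists_csize_le
  refine (foldr (f := fun _ y acc => y :: acc) hl' hl (by fun_prop)
    (p + q) fun x m h => ?_).congr_code fun x => by rw [List.foldr_cons_eq_append']
  rw [List.foldr_cons_eq_append', Polynomial.eval_add]
  obtain ⟨m', hm'⟩ := h
  have h1 := csize_append m (l' x)
  have h2 := csize_append m' m
  rw [hm'] at h2
  have := one_le_csize m'
  have := hp x
  have := hq x
  omega

theorem csize_filter_le (p : β → Bool) (l : List β) : csize (l.filter p) ≤ csize l := by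
  induction l with
  | nil => exact le_rfl
  | cons a l ih =>
    rw [List.filter_cons]
    split_ifs
    · rw [csize_cons, csize_cons]; omega
    · rw [csize_cons]; omega

@[fun_prop]
theorem filter {l : α → List β} {f : α → β → Bool} (hl : PT l)
    (hf : PT fun x : α × β => f x.1 x.2) : PT fun x => (l x).filter (f x) := by
  obtain ⟨p, hp⟩ := hl.exists_csize_le
  have h1 : PT fun x : α × β × List β => (x.1, x.2.1) := by fun_prop
  have h2 : PT fun x : α × β × List β => f x.1 x.2.1 := hf.comp h1
  have heq : ∀ x (m : List β),
      m.foldr (fun y acc => bif f x y then y :: acc else acc) [] = m.filter (f x) := by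
    intro x m
    induction m with
    | nil => rfl
    | cons a m ih => rw [List.foldr_cons, ih, List.filter_cons]; cases f x a <;> rfl
  refine (foldr (b := fun _ => []) (f := fun x y acc => bif f x y then y :: acc else acc)
    (const _) hl (by fun_prop) p fun x m h => ?_).congr_code fun x => by rw [heq]
  rw [heq]
  obtain ⟨m', hm'⟩ := h
  have h3 := csize_append m' m
  rw [hm'] at h3
  have := csize_filter_le (f x) m
  have := one_le_csize m'
  have := hp x
  omega

@[fun_prop]
theorem flatten {l : α → List (List β)} (hl : PT l) : PT fun x => (l x).flatten := by
  obtain ⟨p, hp⟩ := hl.exists_csize_le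
  have heq : ∀ m : List (List β), m.foldr (fun y acc => y ++ acc) [] = m.flatten := by
    intro m
    induction m with
    | nil => rfl
    | cons a m ih => rw [List.foldr_cons, ih, List.flatten_cons]
  have hle : ∀ m : List (List β), csize m.flatten ≤ csize m := by
    intro m
    induction m with
    | nil => exact le_rfl
    | cons a m ih =>
      have := csize_append a m.flatten
      rw [List.flatten_cons, csize_cons]; omega
  refine (foldr (b := fun _ => []) (f := fun _ y acc => y ++ acc) (const _) hl (by fun_prop) p
    fun x m h => ?_).congr_code fun x => by rw [heq]
  rw [heq]
  obtain ⟨m', hm'⟩ := h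
  have h3 := csize_append m' m
  rw [hm'] at h3
  have := hle m
  have := one_le_csize m'
  have := hp x
  omega

@[fun_prop]
theorem any {l : α → List β} {f : α → β → Bool} (hl : PT l)
    (hf : PT fun x : α × β => f x.1 x.2) : PT fun x => (l x).any (f x) := by
  have h1 : PT fun x : α × β × Bool => (x.1, x.2.1) := by fun_prop
  have h2 : PT fun x : α × β × Bool => f x.1 x.2.1 := hf.comp h1
  refine (foldr (b := fun _ => false) (f := fun x y acc => f x y || acc) (const _) hl (by fun_prop)
    2 fun x m h => (csize_bool _).trans (by simp)).congr_code fun x => ?_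
  congr 1
  induction l x with
  | nil => rfl
  | cons a m ih => rw [List.any_cons, List.foldr_cons, ih]

@[fun_prop]
theorem all {l : α → List β} {f : α → β → Bool} (hl : PT l)
    (hf : PT fun x : α × β => f x.1 x.2) : PT fun x => (l x).all (f x) := by
  have h1 : PT fun x : α × β × Bool => (x.1, x.2.1) := by fun_prop
  have h2 : PT fun x : α × β × Bool => f x.1 x.2.1 := hf.comp h1
  refine (foldr (b := fun _ => true) (f := fun x y acc => f x y && acc) (const _) hl (by fun_prop)
    2 fun x m h => (csize_bool _).trans (by simp)).congr_code fun x => ?_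
  congr 1
  induction l x with
  | nil => rfl
  | cons a m ih => rw [List.all_cons, List.foldr_cons, ih]

/-- The indices of the entries of a list. -/
@[fun_prop]
theorem range_length {l : α → List β} (hl : PT l) : PT fun x => List.range (l x).length := by
  obtain ⟨p, hp⟩ := hl.exists_csize_le
  have heq : ∀ m : List β, m.foldl (fun acc _ => (acc.1 + 1, acc.1 :: acc.2)) (0, []) =
      (m.length, (List.range m.length).reverse) := by
    intro m
    induction m using List.reverseRecOn with
    | nil => rfl
    | append_singleton m a ih =>
      rw [List.foldl_append, ih, List.length_append, List.length_singleton, List.range_succ,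
        List.reverse_append]
      rfl
  have h1 : PT fun x => (l x).foldl (fun acc _ => (acc.1 + 1, acc.1 :: acc.2))
      ((0, []) : ℕ × List ℕ) := by
    refine foldl (b := fun _ => ((0, []) : ℕ × List ℕ))
      (f := fun _ acc _ => (acc.1 + 1, acc.1 :: acc.2)) (const _) hl (by fun_prop)
      (3 + p + p * (2 + p)) fun x m h => ?_
    rw [heq, csize_pair, csize_reverse]
    have h2 : m.length + 1 ≤ p.eval (csize x) :=
      (Nat.add_le_add_right h.length_le 1).trans ((length_le_csize _).trans (hp x))
    have h3 := csize_le_of_forall (List.range m.length) (B := 1 + p.eval (csize x)) fun a ha => by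
      have := csize_nat_le a
      have := List.mem_range.1 ha
      omega
    rw [List.length_range] at h3
    have h4 := csize_nat_le m.length
    have h5 : m.length * (1 + (1 + p.eval (csize x))) ≤
        p.eval (csize x) * (2 + p.eval (csize x)) := Nat.mul_le_mul (by omega) (by omega)
    simp only [Polynomial.eval_add, Polynomial.eval_mul, Polynomial.eval_ofNat]
    omega
  have h2 : PT fun x => ((l x).foldl (fun acc _ => (acc.1 + 1, acc.1 :: acc.2))
      ((0, []) : ℕ × List ℕ)).2.reverse := by fun_prop
  exact h2.congr_code fun x => by rw [heq, List.reverse_reverse]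

-- The fold counts positions and replaces the default once the position is `i x`.
@[fun_prop]
theorem getD {l : α → List β} {i : α → ℕ} {d : α → β} (hl : PT l) (hi : PT i) (hd : PT d) :
    PT fun x => (l x).getD (i x) (d x) := by
  obtain ⟨p, hp⟩ := hl.exists_csize_le
  obtain ⟨q, hq⟩ := hd.exists_csize_le
  have heq : ∀ x (m : List β), m.foldl
      (fun acc y => (acc.1 + 1, bif decide (acc.1 = i x) then y else acc.2)) (0, d x) =
      (m.length, m.getD (i x) (d x)) := by
    intro x m
    induction m using List.reverseRecOn with
    | nil => rfl
    | append_singleton m a ih =>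
      rw [List.foldl_append, ih]
      simp only [List.foldl_cons, List.foldl_nil, List.length_append, List.length_singleton,
        List.getD_eq_getElem?_getD]
      rcases lt_trichotomy (i x) m.length with h | h | h
      · rw [List.getElem?_append_left h, decide_eq_false (by omega)]; rfl
      · rw [List.getElem?_append_right (by omega), decide_eq_true h.symm]; simp [h]
      · rw [List.getElem?_append_right (by omega), decide_eq_false (by omega),
          List.getElem?_eq_none (by omega), List.getElem?_eq_none (by simp; omega)]; rfl
  have h1 : PT fun x => (l x).foldl
      (fun acc y => (acc.1 + 1, bif decide (acc.1 = i x) then y else acc.2)) (0, d x) := by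
    refine foldl (b := fun x => (0, d x))
      (f := fun x acc y => (acc.1 + 1, bif decide (acc.1 = i x) then y else acc.2))
      (by fun_prop) hl (by fun_prop) (2 + 2 * p + q) fun x m h => ?_
    rw [heq, csize_pair]
    have h2 : m.length + 1 ≤ p.eval (csize x) :=
      (Nat.add_le_add_right h.length_le 1).trans ((length_le_csize _).trans (hp x))
    have h3 : csize (m.getD (i x) (d x)) ≤ p.eval (csize x) + q.eval (csize x) := by
      by_cases hlt : i x < m.length
      · rw [List.getD_eq_getElem _ _ hlt]
        exact ((csize_le_of_mem (h.mem (List.getElem_mem hlt))).trans (hp x)).trans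
          (Nat.le_add_right _ _)
      · rw [List.getD_eq_default _ _ (by omega)]
        exact (hq x).trans (Nat.le_add_left _ _)
    have h4 := csize_nat_le m.length
    simp only [Polynomial.eval_add, Polynomial.eval_mul, Polynomial.eval_ofNat]
    omega
  have h2 : PT fun x => ((l x).foldl
      (fun acc y => (acc.1 + 1, bif decide (acc.1 = i x) then y else acc.2)) (0, d x)).2 := by
    fun_prop
  exact h2.congr_code fun x => by rw [heq]

/-- Iteration, as often as a list has entries, of a function with results of bounded size. -/
theorem iterate {b : α → β} {l : α → List γ} {f : α → β → β} (hb : PT b) (hl : PT l)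
    (hf : PT fun x : α × β => f x.1 x.2) (B : Polynomial ℕ)
    (hB : ∀ x y, csize (f x y) ≤ B.eval (csize x)) :
    PT fun x => (f x)^[(l x).length] (b x) := by
  obtain ⟨p, hp⟩ := hb.exists_csize_le
  have h1 : PT fun x : α × β × γ => (x.1, x.2.1) := by fun_prop
  refine (foldl (f := fun x y _ => f x y) hb hl (hf.comp h1) (p + B) fun x m _ => ?_).congr_code
    fun x => by rw [List.foldl_const]
  rw [Polynomial.eval_add]
  induction m using List.reverseRecOn with
  | nil => exact (hp x).trans (Nat.le_add_right _ _)
  | append_singleton m a _ =>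
    rw [List.foldl_append]
    exact (hB x _).trans (Nat.le_add_left _ _)

theorem csize_boolTable_le {β γ : Type} (r : List β) (c : List γ) (f : β → γ → Bool) :
    csize (r.map fun i => c.map (f i)) ≤ 1 + r.length * (2 + c.length * 3) := by
  refine (csize_le_of_forall (B := 1 + c.length * 3) _ fun a ha => ?_).trans ?_
  · obtain ⟨i, -, rfl⟩ := List.mem_map.1 ha
    refine (csize_le_of_forall (B := 2) _ fun b _ => csize_bool b).trans ?_
    rw [List.length_map]
  · rw [List.length_map]
    exact le_of_eq (by ring)

/-- Iteration of a function on tables of truth values. -/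
theorem iterate_boolTable {l : α → List δ} {r : α → List β} {c : α → List γ}
    {f : α → List (List Bool) → β → γ → Bool} {b : α → List (List Bool)} (hb : PT b) (hl : PT l)
    (hr : PT r) (hc : PT c)
    (hf : PT fun x : ((α × List (List Bool)) × β) × γ => f x.1.1.1 x.1.1.2 x.1.2 x.2) :
    PT fun x => (fun T => (r x).map fun i => (c x).map fun j => f x T i j)^[(l x).length] (b x) := by
  obtain ⟨p, hp⟩ := hr.exists_csize_le
  obtain ⟨q, hq⟩ := hc.exists_csize_le
  refine iterate hb hl (f := fun x T => (r x).map fun i => (c x).map fun j => f x T i j) ?_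
    (1 + p * (2 + q * 3)) fun x T => ?_
  · refine map (hr.comp fst) (map (hc.comp (fst.comp fst)) ?_)
    exact hf
  · refine (csize_boolTable_le _ _ _).trans ?_
    have h1 := (length_le_csize (r x)).trans (hp x)
    have h2 := (length_le_csize (c x)).trans (hq x)
    simp only [Polynomial.eval_add, Polynomial.eval_mul, Polynomial.eval_ofNat,
      Polynomial.eval_one]
    exact Nat.add_le_add_left (Nat.mul_le_mul (by omega) (by omega)) _

@[fun_prop]
theorem some {f : α → β × γ} (hf : PT f) : PT fun x => Option.some (f x) :=
  hf.congr_code fun _ => rfl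

end PT

end CPTReach

namespace CPTReach

/-! ## The algorithm -/

namespace Algo

/-- Unavailable, or available with the list of the transition probabilities. -/
abbrev Entry : Type := Option (Bool × List (ℤ × ℤ))

/-- Numbers of states and actions, initial state, transition table, and a terminating `0`. -/
abbrev MDPData : Type := ℕ × ℕ × ℕ × List (List Entry) × ℕ

/-- The MDP and the rewards of the target states. -/
abbrev Input : Type := MDPData × List (Option (ℤ × ℤ))

/-- A table of truth values. -/
abbrev BoolTable : Type := List (List Bool)

def states (D : Input) : List ℕ := List.range D.1.2.2.2.1.length

def actions (D : Input) : List ℕ := List.range (D.1.2.2.2.1.getD 0 []).length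

def entry (D : Input) (s a : ℕ) : Entry := (D.1.2.2.2.1.getD s []).getD a none

def isAvail (D : Input) (s a : ℕ) : Bool := (entry D s a).elim false fun _ => true

def isTarget (D : Input) (s : ℕ) : Bool := (D.2.getD s none).elim false fun _ => true

def isSucc (D : Input) (s a t : ℕ) : Bool :=
  (entry D s a).elim false fun y => !decide ((y.2.getD t (0, 1)).1 = 0)

def get (T : BoolTable) (i j : ℕ) : Bool := (T.getD i []).getD j false

def isEdge (D : Input) (E : BoolTable) (s t : ℕ) : Bool :=
  (actions D).any fun a => get E s a && isSucc D s a t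

/-- One more step of reachability along the edges of `E`. -/
def reachStep (D : Input) (E R : BoolTable) : BoolTable :=
  (states D).map fun s => (states D).map fun t =>
    get R s t || (states D).any fun u => get R s u && isEdge D E u t

def reachTable (D : Input) (E : BoolTable) : BoolTable :=
  (reachStep D E)^[(states D).length]
    ((states D).map fun s => (states D).map fun t => decide (s = t))

/-- Removes the actions with a successor that cannot get back. -/
def pruneStep (D : Input) (E : BoolTable) : BoolTable :=
  (states D).map fun s => (actions D).map fun a =>
    get E s a && (states D).all fun t => !isSucc D s a t || get (reachTable D E) t s

/-- The state-action pairs that belong to end components. -/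
def innerTable (D : Input) : BoolTable :=
  (pruneStep D)^[D.1.2.2.2.1.flatten.length]
    ((states D).map fun s => (actions D).map fun a => isAvail D s a && !isTarget D s)

def extend (e : Entry) : Entry := e.elim none fun y => some (y.1, y.2 ++ [(0, 1)])

def stopEntry (D : Input) : Entry :=
  some (true, (states D).map (fun _ => ((0, 1) : ℤ × ℤ)) ++ [(1, 1)])

def newRow (D : Input) (E R : BoolTable) (s : ℕ) : List Entry :=
  ((states D).map fun t => (actions D).map fun a =>
    bif get R s t && !get E t a then extend (entry D t a) else none).flatten ++
    [bif (actions D).any fun a => get E s a then stopEntry D else none]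

def sinkRow (D : Input) : List Entry :=
  ((states D).map fun _ => (actions D).map fun _ => none).flatten ++ [stopEntry D]

def newMDP (D : Input) : MDPData :=
  (D.1.1 + 1, D.1.1 * D.1.2.1 + 1, D.1.2.2.1,
    (states D).map (newRow D (innerTable D) (reachTable D (innerTable D))) ++ [sinkRow D], 0)

def newRewards (D : Input) : List (Option (ℤ × ℤ)) := D.2 ++ [none]

def ratLe (p q : ℤ × ℤ) : Bool := decide (p.1 * q.2 ≤ q.1 * p.2)

/-- Insertion into an increasing list of fractions. -/
def insertRat (q : ℤ × ℤ) (l : List (ℤ × ℤ)) : List (ℤ × ℤ) :=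
  (l.filter fun p => !ratLe q p) ++ q :: l.filter fun p => !ratLe p q

/-- The outcomes in increasing order. -/
def outcomeList (D : Input) : List (ℤ × ℤ) :=
  D.2.foldr (fun o acc => o.elim acc fun q => insertRat q acc) [(0, 1)]

def queryTable (D : Input) : BoolTable :=
  (outcomeList D).map fun q => (List.range (newRewards D).length).map fun s =>
    ((newRewards D).getD s none).elim (decide (s = D.1.1) && decide (q.1 = 0))
      fun r => ratLe r q && ratLe q r

/-- The reduction on codes. -/
def run (D : Input) : MDPData × List (Option (ℤ × ℤ)) × ℕ × BoolTable × ℕ :=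
  (newMDP D, newRewards D, D.1.1, queryTable D, 0)

/-! ### Running time of the algorithm -/

variable {α : Type} [Code α]

@[fun_prop]
theorem pt_states {D : α → Input} (hD : PT D) : PT fun x => states (D x) := by
  unfold states; fun_prop

@[fun_prop]
theorem pt_actions {D : α → Input} (hD : PT D) : PT fun x => actions (D x) := by
  unfold actions; fun_prop

@[fun_prop]
theorem pt_entry {D : α → Input} {s a : α → ℕ} (hD : PT D) (hs : PT s) (ha : PT a) :
    PT fun x => entry (D x) (s x) (a x) := by
  unfold entry; fun_prop

@[fun_prop]
theorem pt_isAvail {D : α → Input} {s a : α → ℕ} (hD : PT D) (hs : PT s) (ha : PT a) :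
    PT fun x => isAvail (D x) (s x) (a x) :=
  PT.option_elim (by fun_prop) (by fun_prop) (by fun_prop)

@[fun_prop]
theorem pt_isTarget {D : α → Input} {s : α → ℕ} (hD : PT D) (hs : PT s) :
    PT fun x => isTarget (D x) (s x) :=
  PT.option_elim (by fun_prop) (by fun_prop) (by fun_prop)

@[fun_prop]
theorem pt_isSucc {D : α → Input} {s a t : α → ℕ} (hD : PT D) (hs : PT s) (ha : PT a)
    (ht : PT t) : PT fun x => isSucc (D x) (s x) (a x) (t x) :=
  PT.option_elim (by fun_prop) (by fun_prop) (by fun_prop)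

@[fun_prop]
theorem pt_get {T : α → BoolTable} {i j : α → ℕ} (hT : PT T) (hi : PT i) (hj : PT j) :
    PT fun x => get (T x) (i x) (j x) := by
  unfold get; fun_prop

@[fun_prop]
theorem pt_isEdge {D : α → Input} {E : α → BoolTable} {s t : α → ℕ} (hD : PT D) (hE : PT E)
    (hs : PT s) (ht : PT t) : PT fun x => isEdge (D x) (E x) (s x) (t x) := by
  unfold isEdge; fun_prop

@[fun_prop]
theorem pt_reachTable {D : α → Input} {E : α → BoolTable} (hD : PT D) (hE : PT E) :
    PT fun x => reachTable (D x) (E x) :=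
  PT.iterate_boolTable (f := fun x R s t => get R s t || (states (D x)).any fun u =>
    get R s u && isEdge (D x) (E x) u t) (by fun_prop) (by fun_prop) (by fun_prop) (by fun_prop)
    (by fun_prop)

@[fun_prop]
theorem pt_innerTable {D : α → Input} (hD : PT D) : PT fun x => innerTable (D x) :=
  PT.iterate_boolTable (f := fun x E s a => get E s a && (states (D x)).all fun t =>
    !isSucc (D x) s a t || get (reachTable (D x) E) t s) (by fun_prop) (by fun_prop) (by fun_prop)
    (by fun_prop) (by fun_prop)

@[fun_prop]
theorem pt_extend {e : α → Entry} (he : PT e) : PT fun x => extend (e x) :=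
  PT.option_elim he (by fun_prop) (by fun_prop)

@[fun_prop]
theorem pt_stopEntry {D : α → Input} (hD : PT D) : PT fun x => stopEntry (D x) := by
  unfold stopEntry; fun_prop

@[fun_prop]
theorem pt_newRow {D : α → Input} {E R : α → BoolTable} {s : α → ℕ} (hD : PT D) (hE : PT E)
    (hR : PT R) (hs : PT s) : PT fun x => newRow (D x) (E x) (R x) (s x) := by
  unfold newRow; fun_prop

@[fun_prop]
theorem pt_sinkRow {D : α → Input} (hD : PT D) : PT fun x => sinkRow (D x) := by
  unfold sinkRow; fun_prop

@[fun_prop]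
theorem pt_newMDP {D : α → Input} (hD : PT D) : PT fun x => newMDP (D x) := by
  unfold newMDP; fun_prop

@[fun_prop]
theorem pt_ratLe {p q : α → ℤ × ℤ} (hp : PT p) (hq : PT q) : PT fun x => ratLe (p x) (q x) := by
  unfold ratLe; fun_prop

@[fun_prop]
theorem pt_insertRat {q : α → ℤ × ℤ} {l : α → List (ℤ × ℤ)} (hq : PT q) (hl : PT l) :
    PT fun x => insertRat (q x) (l x) := by
  unfold insertRat; fun_prop

/-- The filters select disjoint entries; the extra `1` pays for the second end marker. -/
theorem csize_filter_add_filter_le {β : Type} [Code β] {f g : β → Bool}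
    (h : ∀ b, f b = true → g b = false) (l : List β) :
    csize (l.filter f) + csize (l.filter g) ≤ csize l + 1 := by
  induction l with
  | nil => exact le_rfl
  | cons a l ih =>
    rw [List.filter_cons, List.filter_cons, csize_cons]
    cases hf : f a with
    | true =>
      rw [h a hf, if_pos rfl, if_neg (by simp), csize_cons]; omega
    | false =>
      rw [if_neg (by simp)]
      split_ifs
      · rw [csize_cons]; omega
      · omega

/-- Entries strictly below and strictly above `q` are disjoint, so an insertion adds a constant and
the size of `q`. Repeated insertion therefore grows only additively. -/
theorem csize_insertRat_le (q : ℤ × ℤ) (l : List (ℤ × ℤ)) :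
    csize (insertRat q l) ≤ csize l + 1 + csize q := by
  have h1 := csize_append (l.filter fun p => !ratLe q p) (q :: l.filter fun p => !ratLe p q)
  have h2 := csize_filter_add_filter_le (f := fun p => !ratLe q p) (g := fun p => !ratLe p q)
    (fun p hp => by
      simp only [ratLe, Bool.not_eq_true', Bool.not_eq_false', decide_eq_false_iff_not,
        decide_eq_true_eq] at hp ⊢
      omega) l
  rw [csize_cons] at h1
  unfold insertRat
  omega

@[fun_prop]
theorem pt_outcomeList {D : α → Input} (hD : PT D) : PT fun x => outcomeList (D x) := by
  have hD2 : PT fun x => (D x).2 := by fun_prop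
  obtain ⟨p, hp⟩ := hD2.exists_csize_le
  refine PT.foldr (b := fun _ => [(0, 1)])
    (f := fun _ o acc => o.elim acc fun q => insertRat q acc) (by fun_prop) hD2
    (PT.option_elim (by fun_prop) (by fun_prop) (by fun_prop))
    (p + Polynomial.C (csize [((0, 1) : ℤ × ℤ)])) fun x m h => ?_
  have hle : ∀ m : List (Option (ℤ × ℤ)), csize (m.foldr (fun o acc =>
      o.elim acc fun q => insertRat q acc) [((0, 1) : ℤ × ℤ)]) ≤
      csize m + csize [((0, 1) : ℤ × ℤ)] := by
    intro m
    induction m with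
    | nil => exact Nat.le_add_left _ _
    | cons o m ih =>
      rw [List.foldr_cons, csize_cons]
      cases o with
      | none => rw [Option.elim_none]; omega
      | some q =>
        have h1 := csize_insertRat_le q (m.foldr (fun o acc =>
          o.elim acc fun q => insertRat q acc) [((0, 1) : ℤ × ℤ)])
        have h2 : csize (some q) = csize q := rfl
        rw [Option.elim_some]; omega
  obtain ⟨m', hm'⟩ := h
  have h3 := csize_append m' m
  rw [hm'] at h3
  have := hle m
  have := one_le_csize m'
  have := hp x
  rw [Polynomial.eval_add, Polynomial.eval_C]
  omega

@[fun_prop]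
theorem pt_newRewards {D : α → Input} (hD : PT D) : PT fun x => newRewards (D x) := by
  unfold newRewards; fun_prop

theorem pt_ratEntry {D : α → Input} {q : α → ℤ × ℤ} {s : α → ℕ} (hD : PT D) (hq : PT q)
    (hs : PT s) : PT fun x => ((newRewards (D x)).getD (s x) none).elim
      (decide (s x = (D x).1.1) && decide ((q x).1 = 0))
      fun r => ratLe r (q x) && ratLe (q x) r :=
  PT.option_elim (by fun_prop) (by fun_prop) (by fun_prop)

@[fun_prop]
theorem pt_queryTable {D : α → Input} (hD : PT D) : PT fun x => queryTable (D x) := by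
  refine PT.map (by fun_prop) (PT.map (by fun_prop) ?_)
  exact pt_ratEntry (by fun_prop) (by fun_prop) (by fun_prop)

/-- The reduction takes polynomial time. -/
theorem pt_run : PT run := by
  unfold run
  fun_prop

end Algo

end CPTReach

namespace CPTReach

open Relation MDP
open CPTReach.Code (code)

/-! ## Correctness of the algorithm -/

theorem map_range_eq_ofFn {α : Type*} (n : ℕ) (f : ℕ → α) :
    (List.range n).map f = List.ofFn fun i : Fin n => f i := by
  refine List.ext_getElem (by simp) fun i h1 h2 => by simp

theorem getD_ofFn {α : Type*} {n : ℕ} (f : Fin n → α) (i : Fin n) (d : α) :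
    (List.ofFn f).getD i d = f i := by
  simp

theorem getD_map_range {α : Type*} {n i : ℕ} (hi : i < n) (f : ℕ → α) (d : α) :
    ((List.range n).map f).getD i d = f i := by
  rw [map_range_eq_ofFn]
  exact getD_ofFn (fun i : Fin n => f i) ⟨i, hi⟩ d

/-- Decreasing iterations on subsets of a finite type become stationary. -/
theorem iterate_card_fixed_of_subset {α : Type*} [Fintype α] [DecidableEq α]
    {T : Finset α → Finset α} (hT : ∀ X, T X ⊆ X) (X : Finset α) :
    T (T^[Fintype.card α] X) = T^[Fintype.card α] X := by
  -- On complements the iteration is increasing.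
  have h1 : ∀ k, (fun Y => (T Yᶜ)ᶜ)^[k] Xᶜ = (T^[k] X)ᶜ := by
    intro k
    induction k with
    | zero => rfl
    | succ k ih => rw [Function.iterate_succ_apply', ih, Function.iterate_succ_apply',
        compl_compl]
  have h2 := iterate_card_fixed (T := fun Y => (T Yᶜ)ᶜ)
    (fun Y => Finset.subset_compl_comm.1 (hT Yᶜ)) Xᶜ
  rw [h1] at h2
  simpa using h2

open Classical in
/-- Adjunction of the successors of a set. -/
noncomputable def adjoin {α : Type*} [Fintype α] (r : α → α → Prop) (X : Finset α) : Finset α :=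
  X ∪ Finset.univ.filter fun t => ∃ u ∈ X, r u t

theorem mem_adjoin {α : Type*} [Fintype α] {r : α → α → Prop} {X : Finset α} {t : α} :
    t ∈ adjoin r X ↔ t ∈ X ∨ ∃ u ∈ X, r u t := by
  classical
  simp [adjoin]

/-- Each round adds only reachable points, and after as many rounds as there are points the set is
closed under `r`. -/
theorem mem_iterate_adjoin_iff {α : Type*} [Fintype α] (r : α → α → Prop) (s t : α) :
    t ∈ (adjoin r)^[Fintype.card α] {s} ↔ ReflTransGen r s t := by
  constructor
  · generalize Fintype.card α = k
    intro h
    induction k generalizing t with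
    | zero => rw [Finset.mem_singleton.1 h]
    | succ k ih =>
      rw [Function.iterate_succ_apply', mem_adjoin] at h
      rcases h with h | ⟨u, hu, hr⟩
      · exact ih t h
      · exact (ih u hu).tail hr
  · intro h
    have hsub : ∀ X, X ⊆ adjoin r X := fun X t ht => mem_adjoin.2 (Or.inl ht)
    have hfix := iterate_card_fixed hsub {s}
    induction h with
    | refl =>
      have : ∀ k, s ∈ (adjoin r)^[k] {s} := by
        intro k
        induction k with
        | zero => exact Finset.mem_singleton_self s
        | succ k ih => rw [Function.iterate_succ_apply']; exact hsub _ ih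
      exact this _
    | tail _ hr ih =>
      rw [← hfix]
      exact mem_adjoin.2 (Or.inr ⟨_, ih, hr⟩)

namespace Algo

/-- The entry of a transition table. -/
def IsEntry (M : MDP) (s : M.State) (a : M.Action) (e : Entry) : Prop :=
  (a ∉ M.avail s ∧ e = none) ∨ (a ∈ M.avail s ∧ ∃ q : M.State → ℤ × ℤ,
    (∀ t, 0 < (q t).2 ∧ M.prob s a t = ((q t).1 : ℝ) / ((q t).2 : ℝ)) ∧
    e = some (true, List.ofFn q))

/-- The entry of a reward table. -/
def IsReward {M : MDP} (Φ : WRObjective M) (s : M.State) (o : Option (ℤ × ℤ)) : Prop :=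
  (s ∉ Φ.targets ∧ o = none) ∨ (s ∈ Φ.targets ∧ ∃ q : ℤ × ℤ,
    0 < q.2 ∧ Φ.reward s = (q.1 : ℚ) / (q.2 : ℚ) ∧ o = some q)

/-- The input that consists of the given tables. -/
def input (M : MDP) (e : M.State → M.Action → Entry) (r : M.State → Option (ℤ × ℤ)) : Input :=
  ((M.numStates, M.numActions, (M.init : ℕ), List.ofFn fun s => List.ofFn (e s), 0), List.ofFn r)

theorem code_list_ofFn {α : Type} [Code α] {n : ℕ} (f : Fin n → α) :
    code (List.ofFn f) = Val.list (List.ofFn fun i => code (f i)) := by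
  change Val.list ((List.ofFn f).map code) = _
  rw [List.map_ofFn]; rfl

theorem exists_isEntry {M : MDP} {s : M.State} {a : M.Action} {v : Val}
    (h : CodesTrans M s a v) : ∃ e, IsEntry M s a e ∧ v = code e := by
  rcases h with ⟨h1, rfl⟩ | ⟨h1, w, rfl, c, hc, rfl⟩
  · exact ⟨none, Or.inl ⟨h1, rfl⟩, rfl⟩
  · choose x y hy hxy hp using hc
    refine ⟨some (true, List.ofFn fun t => (x t, y t)), Or.inr ⟨h1, fun t => (x t, y t),
      fun t => ⟨hy t, hp t⟩, rfl⟩, ?_⟩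
    change _ = Val.pair (.int 1) (code (List.ofFn fun t => (x t, y t)))
    rw [code_list_ofFn, funext hxy]
    rfl

theorem exists_isReward {M : MDP} {Φ : WRObjective M} {s : M.State} {v : Val}
    (h : (s ∉ Φ.targets ∧ v = .int 0) ∨ (s ∈ Φ.targets ∧ CodesReal v (Φ.reward s))) :
    ∃ o, IsReward Φ s o ∧ v = code o := by
  rcases h with ⟨h1, rfl⟩ | ⟨h1, x, y, hy, rfl, hp⟩
  · exact ⟨none, Or.inl ⟨h1, rfl⟩, rfl⟩
  · exact ⟨some (x, y), Or.inr ⟨h1, (x, y), hy, by exact_mod_cast hp, rfl⟩, rfl⟩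

/-- A code only asserts that suitable fractions exist; choosing them turns the raw datum into the
code of typed data, to which the `PT` results apply. -/
theorem exists_input {I : Problem} {v : Val} (h : CodesProblem v I) :
    ∃ e r, (∀ s a, IsEntry I.mdp s a (e s a)) ∧ (∀ s, IsReward I.obj s (r s)) ∧
      v = code (input I.mdp e r) := by
  obtain ⟨_, _, ⟨_, ⟨c, hc, rfl⟩, rfl⟩, ⟨d, hd, rfl⟩, rfl⟩ := h
  choose c' hc' hcc' using hc
  choose e he hce using fun s a => exists_isEntry (hc' s a)
  choose r hr hdr using fun s => exists_isReward (hd s)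
  refine ⟨e, r, he, hr, ?_⟩
  have h1 : ∀ s, c s = code (List.ofFn (e s)) := fun s => by
    rw [hcc' s, code_list_ofFn]
    exact congrArg _ (congrArg _ (funext fun a => hce s a))
  have h2 : code (List.ofFn fun s => List.ofFn (e s)) = Val.list (List.ofFn c) := by
    rw [code_list_ofFn]
    exact congrArg _ (congrArg _ (funext fun s => (h1 s).symm))
  have h3 : code (List.ofFn r) = Val.list (List.ofFn d) := by
    rw [code_list_ofFn]
    exact congrArg _ (congrArg _ (funext fun s => (hdr s).symm))
  rw [← h2, ← h3]
  rfl

section Tables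

variable {I : Problem} {e : I.mdp.State → I.mdp.Action → Entry}
  {r : I.mdp.State → Option (ℤ × ℤ)}

theorem states_input : states (input I.mdp e r) = List.range I.mdp.numStates := by
  simp [states, input]

theorem actions_input : actions (input I.mdp e r) = List.range I.mdp.numActions := by
  -- The number of actions is read off row `0`, which exists because there is an initial state.
  have h := getD_ofFn (fun s => List.ofFn (e s)) ⟨0, I.mdp.init.pos⟩ []
  simp only at h
  simp only [actions, input]
  rw [h, List.length_ofFn]

theorem entry_input (s : I.mdp.State) (a : I.mdp.Action) :
    entry (input I.mdp e r) s a = e s a := by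
  simp only [entry, input]
  rw [getD_ofFn (fun s => List.ofFn (e s)), getD_ofFn]

theorem isAvail_input (he : ∀ s a, IsEntry I.mdp s a (e s a)) (s : I.mdp.State)
    (a : I.mdp.Action) : isAvail (input I.mdp e r) s a = true ↔ a ∈ I.mdp.avail s := by
  rw [isAvail, entry_input]
  rcases he s a with ⟨h1, h2⟩ | ⟨h1, q, -, h2⟩ <;> simp [h1, h2]

theorem isTarget_input (hr : ∀ s, IsReward I.obj s (r s)) (s : I.mdp.State) :
    isTarget (input I.mdp e r) s = true ↔ s ∈ I.obj.targets := by
  simp only [isTarget, input]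
  rw [getD_ofFn]
  rcases hr s with ⟨h1, h2⟩ | ⟨h1, q, -, -, h2⟩ <;> simp [h1, h2]

/-- Denominators are positive, so the support shows in the numerators, without reducing fractions.
-/
theorem isSucc_input (he : ∀ s a, IsEntry I.mdp s a (e s a)) (s : I.mdp.State)
    (a : I.mdp.Action) (t : I.mdp.State) :
    isSucc (input I.mdp e r) s a t = true ↔ a ∈ I.mdp.avail s ∧ I.mdp.prob s a t ≠ 0 := by
  rw [isSucc, entry_input]
  rcases he s a with ⟨h1, h2⟩ | ⟨h1, q, hq, h2⟩
  · simp [h1, h2]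
  · rw [h2, Option.elim_some, getD_ofFn]
    have h3 : ((q t).2 : ℝ) ≠ 0 := Int.cast_ne_zero.2 (hq t).1.ne'
    simp [h1, (hq t).2, h3]

theorem get_map_range {n m : ℕ} (f : ℕ → ℕ → Bool) (i : Fin n) (j : Fin m) :
    get ((List.range n).map fun i => (List.range m).map fun j => f i j) i j = f i j := by
  rw [get, getD_map_range i.isLt, getD_map_range j.isLt]

theorem exists_mem_range {n : ℕ} {p : ℕ → Prop} :
    (∃ i ∈ List.range n, p i) ↔ ∃ i : Fin n, p i :=
  ⟨fun ⟨i, hi, h⟩ => ⟨⟨i, List.mem_range.1 hi⟩, h⟩, fun ⟨i, h⟩ => ⟨i, List.mem_range.2 i.isLt, h⟩⟩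

theorem forall_mem_range {n : ℕ} {p : ℕ → Prop} :
    (∀ i ∈ List.range n, p i) ↔ ∀ i : Fin n, p i :=
  ⟨fun h i => h i (List.mem_range.2 i.isLt), fun h i hi => h ⟨i, List.mem_range.1 hi⟩⟩

/-- The set of pairs in a table. -/
def pairs (M : MDP) (T : BoolTable) : Set (M.State × M.Action) := {p | get T p.1 p.2 = true}

theorem isEdge_input (he : ∀ s a, IsEntry I.mdp s a (e s a)) {T : BoolTable}
    (hT : ∀ (s : I.mdp.State) (a : I.mdp.Action), get T s a = true → a ∈ I.mdp.avail s)
    (s t : I.mdp.State) :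
    isEdge (input I.mdp e r) T s t = true ↔ I.mdp.Edge (pairs I.mdp T) s t := by
  rw [isEdge, List.any_eq_true, actions_input, exists_mem_range]
  simp only [Bool.and_eq_true, isSucc_input he]
  exact exists_congr fun a => ⟨fun h => ⟨h.1, h.2.2⟩, fun h => ⟨h.1, hT s a h.1, h.2⟩⟩

/-- Row `s` of the `k`-th table is the `k`-th iterate of `adjoin` from `{s}`, and the number of
rounds is the number of states. -/
theorem get_reachTable (he : ∀ s a, IsEntry I.mdp s a (e s a)) {T : BoolTable}
    (hT : ∀ (s : I.mdp.State) (a : I.mdp.Action), get T s a = true → a ∈ I.mdp.avail s)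
    (s t : I.mdp.State) : get (reachTable (input I.mdp e r) T) s t = true ↔
      ReflTransGen (I.mdp.Edge (pairs I.mdp T)) s t := by
  classical
  rw [← mem_iterate_adjoin_iff, reachTable]
  have hlen : (states (input I.mdp e r)).length = Fintype.card I.mdp.State := by
    rw [states_input, List.length_range, Fintype.card_fin]
  rw [hlen]
  generalize Fintype.card I.mdp.State = k
  induction k generalizing s t with
  | zero =>
    rw [Function.iterate_zero, id, states_input, get_map_range]
    simp [Fin.ext_iff, eq_comm]
  | succ k ih =>
    set R := (reachStep (input I.mdp e r) T)^[k] ((states (input I.mdp e r)).map fun s =>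
      (states (input I.mdp e r)).map fun t => decide (s = t)) with hR
    have ih' : ∀ s t : I.mdp.State, get R s t = true ↔
        t ∈ (adjoin (I.mdp.Edge (pairs I.mdp T)))^[k] {s} := ih
    rw [Function.iterate_succ_apply', Function.iterate_succ_apply', ← hR, reachStep]
    clear_value R
    rw [states_input, get_map_range, Bool.or_eq_true, List.any_eq_true, exists_mem_range, mem_adjoin]
    simp only [Bool.and_eq_true, ih', isEdge_input he hT]

open Classical in
/-- One round of the removal of actions that leave end components. -/
noncomputable def prune (M : MDP) (X : Finset (M.State × M.Action)) :
    Finset (M.State × M.Action) :=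
  X.filter fun p => ∀ t, M.prob p.1 p.2 t ≠ 0 → ReflTransGen (M.Edge ↑X) t p.1

/-- Inner pairs survive every round because their return paths consist of inner pairs. A stationary
set contains return paths for all its pairs, so it is itself a union of end components. -/
theorem iterate_prune_eq_inner (M : MDP) (F : Finset M.State)
    (X : Finset (M.State × M.Action)) (hX : ∀ p, p ∈ X ↔ p.2 ∈ M.avail p.1 ∧ p.1 ∉ F) :
    ↑((prune M)^[Fintype.card (M.State × M.Action)] X) = M.inner F := by
  classical
  set Y := (prune M)^[Fintype.card (M.State × M.Action)] X with hY
  have hfix : prune M Y = Y :=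
    iterate_card_fixed_of_subset (T := prune M) (fun X => Finset.filter_subset _ _) X
  have hsub : ∀ k, (prune M)^[k] X ⊆ X := by
    intro k
    induction k with
    | zero => exact fun _ h => h
    | succ k ih =>
      rw [Function.iterate_succ_apply']
      exact (Finset.filter_subset _ _).trans ih
  have hsup : ∀ k, M.inner F ⊆ ↑((prune M)^[k] X) := by
    intro k
    induction k with
    | zero =>
      rintro ⟨s, a⟩ h
      obtain ⟨h1, h2, -⟩ := M.isEndPairs_inner F s a h
      exact (hX (s, a)).2 ⟨h1, h2⟩
    | succ k ih =>
      rintro ⟨s, a⟩ h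
      rw [Function.iterate_succ_apply']
      refine Finset.mem_coe.2 (Finset.mem_filter.2 ⟨ih h, fun t ht => ?_⟩)
      exact ReflTransGen.mono (fun _ _ => Edge.mono ih) _ _
        ((M.isEndPairs_inner F s a h).2.2 t ht)
  refine Set.Subset.antisymm (IsEndPairs.subset_inner ?_) (hsup _)
  intro s a h
  have h1 := (hX (s, a)).1 (hsub _ h)
  have h2 : (s, a) ∈ prune M Y := by rw [hfix]; exact h
  exact ⟨h1.1, h1.2, (Finset.mem_filter.1 h2).2⟩

theorem get_innerTable (he : ∀ s a, IsEntry I.mdp s a (e s a))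
    (hr : ∀ s, IsReward I.obj s (r s)) (s : I.mdp.State) (a : I.mdp.Action) :
    get (innerTable (input I.mdp e r)) s a = true ↔ (s, a) ∈ I.mdp.inner I.obj.targets := by
  classical
  let X : Finset (I.mdp.State × I.mdp.Action) :=
    Finset.univ.filter fun p => p.2 ∈ I.mdp.avail p.1 ∧ p.1 ∉ I.obj.targets
  rw [← iterate_prune_eq_inner I.mdp I.obj.targets X (fun p => by simp [X])]
  -- The table has one entry for each state-action pair, which is the number of rounds that pruning
  -- may need.
  have hlen : (input I.mdp e r).1.2.2.2.1.flatten.length =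
      Fintype.card (I.mdp.State × I.mdp.Action) := by
    rw [Fintype.card_prod, Fintype.card_fin, Fintype.card_fin]
    simp [input, List.length_flatten, List.map_ofFn, Function.comp_def]
  rw [innerTable, hlen]
  generalize Fintype.card (I.mdp.State × I.mdp.Action) = k
  have hXk : ∀ k, (prune I.mdp)^[k] X ⊆ X := by
    intro k
    induction k with
    | zero => exact fun _ h => h
    | succ k ih =>
      rw [Function.iterate_succ_apply']
      exact (Finset.filter_subset _ _).trans ih
  induction k generalizing s a with
  | zero =>
    rw [Function.iterate_zero, id, states_input, actions_input, get_map_range, Bool.and_eq_true,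
      isAvail_input he, Bool.not_eq_true', ← Bool.not_eq_true, isTarget_input hr]
    simp [X]
  | succ k ih =>
    set T := (pruneStep (input I.mdp e r))^[k] ((states (input I.mdp e r)).map fun s =>
      (actions (input I.mdp e r)).map fun a =>
        isAvail (input I.mdp e r) s a && !isTarget (input I.mdp e r) s) with hTdef
    have ih' : ∀ (s : I.mdp.State) (a : I.mdp.Action), get T s a = true ↔
        (s, a) ∈ (prune I.mdp)^[k] X := ih
    have hT : ∀ (s : I.mdp.State) (a : I.mdp.Action), get T s a = true → a ∈ I.mdp.avail s :=
      fun s a h => (Finset.mem_filter.1 (hXk k ((ih' s a).1 h))).2.1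
    have hpairs : pairs I.mdp T = ↑((prune I.mdp)^[k] X) := by
      ext ⟨s, a⟩; exact ih' s a
    rw [Function.iterate_succ_apply', Function.iterate_succ_apply', ← hTdef, pruneStep]
    clear_value T
    rw [states_input, actions_input, get_map_range, Bool.and_eq_true, List.all_eq_true, forall_mem_range, ih',
      Finset.mem_coe, prune, Finset.mem_filter, ← hpairs]
    simp only [Bool.or_eq_true, get_reachTable he hT, Bool.not_eq_true', ← Bool.not_eq_true,
      isSucc_input he]
    refine and_congr_right fun hmem => forall_congr' fun t => ?_
    have ha := (Finset.mem_filter.1 (hXk k hmem)).2.1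
    simp only at ha
    simp only [ha, true_and]
    tauto

theorem get_connTable (he : ∀ s a, IsEntry I.mdp s a (e s a))
    (hr : ∀ s, IsReward I.obj s (r s)) (s t : I.mdp.State) :
    get (reachTable (input I.mdp e r) (innerTable (input I.mdp e r))) s t = true ↔
      I.mdp.Conn I.obj.targets s t := by
  rw [get_reachTable he fun s a h =>
    (I.mdp.isEndPairs_inner _ s a ((get_innerTable he hr s a).1 h)).1]
  have : pairs I.mdp (innerTable (input I.mdp e r)) = I.mdp.inner I.obj.targets := by
    ext ⟨s, a⟩; exact get_innerTable he hr s a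
  rw [this]; rfl

end Tables

end Algo

end CPTReach

namespace CPTReach

open MDP
open CPTReach.Code (code)

/-! ## The algorithm computes the reduction -/

theorem Val.list_injective : Function.Injective Val.list := by
  intro l
  induction l with
  | nil => intro l' h; cases l' with
    | nil => rfl
    | cons b l' => cases h
  | cons a l ih => intro l' h; cases l' with
    | nil => cases h
    | cons b l' =>
      obtain ⟨h1, h2⟩ := Val.pair.inj h
      rw [h1, ih h2]

/-! ### Codes of concatenated and flattened tables -/

section IsTable

variable {α : Type} [Code α]

theorem isTable_ofFn {n : ℕ} {R : Fin n → Val → Prop} {f : Fin n → α}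
    (h : ∀ i, R i (code (f i))) : IsTable R (code (List.ofFn f)) :=
  ⟨fun i => code (f i), h, Algo.code_list_ofFn f⟩

theorem isTable_map_range {n : ℕ} {R : Fin n → Val → Prop} {f : ℕ → α}
    (h : ∀ i : Fin n, R i (code (f i))) : IsTable R (code ((List.range n).map f)) := by
  rw [map_range_eq_ofFn]
  exact isTable_ofFn h

theorem isTable_concat {n : ℕ} {R : Fin (n + 1) → Val → Prop} {l : List α} {x : α}
    (h : IsTable (fun i => R i.castSucc) (code l)) (hx : R (Fin.last n) (code x)) :
    IsTable R (code (l ++ [x])) := by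
  obtain ⟨c, hc, hl⟩ := h
  have hl' : l.map code = List.ofFn c := Val.list_injective hl
  refine ⟨Fin.snoc (α := fun _ => Val) c (code x), fun i => ?_, ?_⟩
  · refine Fin.lastCases ?_ (fun i => ?_) i
    · rw [Fin.snoc_last]; exact hx
    · rw [Fin.snoc_castSucc]; exact hc i
  · change Val.list ((l ++ [x]).map code) = _
    rw [List.ofFn_succ', List.concat_eq_append, List.map_append, hl']
    simp only [Fin.snoc_castSucc, Fin.snoc_last]
    rfl

/-- `finProdFinEquiv` numbers the pairs row by row, in the order in which flattening lists them. -/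
theorem isTable_flatten {n m : ℕ} {R : Fin (n * m) → Val → Prop} {g : ℕ → ℕ → α}
    (h : ∀ (i : Fin n) (j : Fin m), R (finProdFinEquiv (i, j)) (code (g i j))) :
    IsTable R (code ((List.range n).map fun i => (List.range m).map (g i)).flatten) := by
  have hlist : ((List.range n).map fun i => (List.range m).map (g i)).flatten =
      List.ofFn fun p : Fin (n * m) =>
        g (finProdFinEquiv.symm p).1 (finProdFinEquiv.symm p).2 := by
    rw [List.ofFn_mul, map_range_eq_ofFn]
    congr 2
    funext i
    rw [map_range_eq_ofFn]
    congr 1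
    funext j
    have : (⟨i * m + j, by
        calc (i : ℕ) * m + j < (i + 1) * m := by rw [add_mul, one_mul]; omega
          _ ≤ _ := Nat.mul_le_mul_right _ i.isLt⟩ : Fin (n * m)) = finProdFinEquiv (i, j) :=
      Fin.ext (by simp [mul_comm, add_comm])
    rw [this, Equiv.symm_apply_apply]
  rw [hlist]
  refine isTable_ofFn fun p => ?_
  have := h (finProdFinEquiv.symm p).1 (finProdFinEquiv.symm p).2
  rwa [Prod.mk.eta, Equiv.apply_symm_apply] at this

end IsTable

theorem codesReal_code {q : ℤ × ℤ} {x : ℝ} (h : 0 < q.2) (hx : x = (q.1 : ℝ) / (q.2 : ℝ)) :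
    CodesReal (code q) x :=
  ⟨q.1, q.2, h, rfl, hx⟩

namespace Algo

section Tables

variable {I : Problem} {e : I.mdp.State → I.mdp.Action → Entry}
  {r : I.mdp.State → Option (ℤ × ℤ)}

/-- The old list of probabilities is reused with a `0` appended for the sink. Unavailability shows
either in the test or in the old entry, which is then `none`. -/
theorem codesTrans_act (he : ∀ s a, IsEntry I.mdp s a (e s a))
    (hr : ∀ s, IsReward I.obj s (r s)) (s t : I.mdp.State) (a : I.mdp.Action) :
    CodesTrans (I.mdp.collapse I.obj.targets) (collapse.st _ _ s) (collapse.act _ _ t a)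
      (code (bif get (reachTable (input I.mdp e r) (innerTable (input I.mdp e r))) s t &&
          !get (innerTable (input I.mdp e r)) t a
        then extend (entry (input I.mdp e r) t a) else none)) := by
  rw [CodesTrans, collapse.act_mem_avail, entry_input]
  cases hc : get (reachTable (input I.mdp e r) (innerTable (input I.mdp e r))) s t &&
      !get (innerTable (input I.mdp e r)) t a with
  | false =>
    refine Or.inl ⟨fun h => ?_, rfl⟩
    rw [← Bool.not_eq_true, Bool.and_eq_true, get_connTable he hr, Bool.not_eq_true',
      ← Bool.not_eq_true, get_innerTable he hr] at hc
    exact hc ⟨h.1, h.2.2⟩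
  | true =>
    rw [Bool.and_eq_true, get_connTable he hr, Bool.not_eq_true',
      ← Bool.not_eq_true, get_innerTable he hr] at hc
    rcases he t a with ⟨h1, h2⟩ | ⟨h1, q, hq, h2⟩
    · exact Or.inl ⟨fun h => h1 h.2.1, by rw [h2]; rfl⟩
    · refine Or.inr ⟨⟨hc.1, h1, hc.2⟩, code (List.ofFn q ++ [(0, 1)]), by rw [h2]; rfl, ?_⟩
      refine isTable_concat (n := I.mdp.numStates) (isTable_ofFn fun u => ?_) ?_
      · exact codesReal_code (hq u).1 ((collapse.prob_act_st _ t a u).trans (hq u).2)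
      · exact codesReal_code one_pos ((collapse.prob_act_sink _ t a).trans (by simp))

theorem codesTrans_stopEntry {s : (I.mdp.collapse I.obj.targets).State}
    (hs : collapse.quit _ _ ∈ (I.mdp.collapse I.obj.targets).avail s) :
    CodesTrans (I.mdp.collapse I.obj.targets) s (collapse.quit _ _)
      (code (stopEntry (input I.mdp e r))) := by
  refine Or.inr ⟨hs, _, rfl, ?_⟩
  rw [states_input]
  refine isTable_concat (n := I.mdp.numStates) (isTable_map_range fun u => ?_) ?_
  · exact codesReal_code one_pos ((collapse.prob_stop_st _ u).trans (by simp))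
  · exact codesReal_code one_pos ((collapse.prob_stop_sink _).trans (by simp))

theorem codes_newMDP (he : ∀ s a, IsEntry I.mdp s a (e s a))
    (hr : ∀ s, IsReward I.obj s (r s)) :
    CodesMDP (code (newMDP (input I.mdp e r))) (I.mdp.collapse I.obj.targets) := by
  refine ⟨code ((states (input I.mdp e r)).map (newRow (input I.mdp e r)
    (innerTable (input I.mdp e r)) (reachTable (input I.mdp e r) (innerTable (input I.mdp e r)))) ++
      [sinkRow (input I.mdp e r)]), ?_, rfl⟩
  rw [states_input]
  refine isTable_concat (n := I.mdp.numStates) (isTable_map_range fun s => ?_) ?_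
  · rw [newRow, states_input, actions_input]
    refine isTable_concat (n := I.mdp.numStates * I.mdp.numActions)
      (isTable_flatten fun t a => codesTrans_act he hr s t a) ?_
    have hiff : ((List.range I.mdp.numActions).any
        fun a => get (innerTable (input I.mdp e r)) s a) = true ↔
        collapse.quit _ _ ∈ (I.mdp.collapse I.obj.targets).avail (collapse.st _ _ s) := by
      rw [collapse.stop_mem_avail, List.any_eq_true, exists_mem_range]
      exact exists_congr fun a => get_innerTable he hr s a
    cases hc : (List.range I.mdp.numActions).any
        fun a => get (innerTable (input I.mdp e r)) s a with
    | false => exact Or.inl ⟨fun h => Bool.noConfusion (hc.symm.trans (hiff.2 h)), rfl⟩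
    | true => exact codesTrans_stopEntry (hiff.1 hc)
  · rw [sinkRow, states_input, actions_input]
    refine isTable_concat (n := I.mdp.numStates * I.mdp.numActions)
      (isTable_flatten fun t a => Or.inl ⟨fun h => ?_, rfl⟩) (codesTrans_stopEntry ?_)
    · have h' := Finset.mem_singleton.1 (collapse.avail_sink.subset h)
      exact Fin.castSucc_ne_last _ h'
    · exact collapse.avail_sink.symm.subset (Finset.mem_singleton_self _)

theorem codes_newRewards (hr : ∀ s, IsReward I.obj s (r s)) :
    CodesObjective (code (newRewards (input I.mdp e r))) I.collapseObj := by
  refine isTable_concat (n := I.mdp.numStates) (isTable_ofFn fun s => ?_)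
    (Or.inl ⟨I.sink_not_mem, rfl⟩)
  rcases hr s with ⟨h1, h2⟩ | ⟨h1, q, hq, hv, h2⟩
  · exact Or.inl ⟨fun h => h1 (collapse.st_mem_copies.1 h), by rw [h2]; rfl⟩
  · refine Or.inr ⟨collapse.st_mem_copies.2 h1, ?_⟩
    rw [h2]
    refine codesReal_code hq ?_
    have h3 := (I.collapseObj_reward s).trans hv
    exact (congrArg (Rat.cast (K := ℝ)) h3).trans (by push_cast; rfl)

end Tables

/-- The value of a fraction. -/
def frac (q : ℤ × ℤ) : ℚ := q.1 / q.2

theorem ratLe_iff {p q : ℤ × ℤ} (hp : 0 < p.2) (hq : 0 < q.2) :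
    ratLe p q = true ↔ frac p ≤ frac q := by
  rw [ratLe, decide_eq_true_eq, frac, frac,
    div_le_div_iff₀ (by exact_mod_cast hp) (by exact_mod_cast hq)]
  exact_mod_cast Iff.rfl

/-- Increasing lists of fractions with positive denominators. -/
def IsIncreasing (l : List (ℤ × ℤ)) : Prop :=
  (∀ q ∈ l, 0 < q.2) ∧ l.Pairwise fun p q => frac p < frac q

theorem isIncreasing_insertRat {q : ℤ × ℤ} {l : List (ℤ × ℤ)} (hq : 0 < q.2)
    (hl : IsIncreasing l) : IsIncreasing (insertRat q l) := by
  have h1 : ∀ p ∈ l.filter (fun p => !ratLe q p), p ∈ l ∧ frac p < frac q := by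
    intro p hp
    rw [List.mem_filter, Bool.not_eq_true', ← Bool.not_eq_true] at hp
    rw [ratLe_iff hq (hl.1 p hp.1), not_le] at hp
    exact hp
  have h2 : ∀ p ∈ l.filter (fun p => !ratLe p q), p ∈ l ∧ frac q < frac p := by
    intro p hp
    rw [List.mem_filter, Bool.not_eq_true', ← Bool.not_eq_true] at hp
    rw [ratLe_iff (hl.1 p hp.1) hq, not_le] at hp
    exact hp
  constructor
  · intro p hp
    rw [insertRat, List.mem_append, List.mem_cons] at hp
    rcases hp with hp | rfl | hp
    · exact hl.1 p (h1 p hp).1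
    · exact hq
    · exact hl.1 p (h2 p hp).1
  · rw [insertRat, List.pairwise_append, List.pairwise_cons]
    refine ⟨hl.2.filter _, ⟨fun p hp => (h2 p hp).2, hl.2.filter _⟩, fun p hp p' hp' => ?_⟩
    rcases List.mem_cons.1 hp' with rfl | hp'
    · exact (h1 p hp).2
    · exact (h1 p hp).2.trans (h2 p' hp').2

theorem exists_frac_insertRat {q : ℤ × ℤ} {l : List (ℤ × ℤ)} (hq : 0 < q.2)
    (hl : IsIncreasing l) (x : ℚ) :
    (∃ p ∈ insertRat q l, frac p = x) ↔ x = frac q ∨ ∃ p ∈ l, frac p = x := by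
  constructor
  · rintro ⟨p, hp, rfl⟩
    rw [insertRat, List.mem_append, List.mem_cons] at hp
    rcases hp with hp | rfl | hp
    · exact Or.inr ⟨p, (List.mem_filter.1 hp).1, rfl⟩
    · exact Or.inl rfl
    · exact Or.inr ⟨p, (List.mem_filter.1 hp).1, rfl⟩
  · rintro (rfl | ⟨p, hp, rfl⟩)
    · exact ⟨q, by simp [insertRat], rfl⟩
    · rcases lt_trichotomy (frac p) (frac q) with h | h | h
      · refine ⟨p, List.mem_append_left _ (List.mem_filter.2 ⟨hp, ?_⟩), rfl⟩
        rw [Bool.not_eq_true', ← Bool.not_eq_true, ratLe_iff hq (hl.1 p hp)]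
        exact not_le.2 h
      -- Both filters drop `p`; its value survives in the possibly different fraction `q`.
      · exact ⟨q, by simp [insertRat], h.symm⟩
      · refine ⟨p, List.mem_append_right _ (List.mem_cons_of_mem _
          (List.mem_filter.2 ⟨hp, ?_⟩)), rfl⟩
        rw [Bool.not_eq_true', ← Bool.not_eq_true, ratLe_iff (hl.1 p hp) hq]
        exact not_le.2 h

/-! ### The outcomes in increasing order, and the query -/

section Outcomes

variable {I : Problem} {e : I.mdp.State → I.mdp.Action → Entry}
  {r : I.mdp.State → Option (ℤ × ℤ)}

theorem outcomeList_spec (hr : ∀ s, IsReward I.obj s (r s)) :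
    IsIncreasing (outcomeList (input I.mdp e r)) ∧
      ∀ x, (∃ q ∈ outcomeList (input I.mdp e r), frac q = x) ↔ x ∈ I.obj.outcomes := by
  have key : ∀ m : List (Option (ℤ × ℤ)), (∀ q, some q ∈ m → 0 < q.2) →
      IsIncreasing (m.foldr (fun o acc => o.elim acc fun q => insertRat q acc) [(0, 1)]) ∧
      ∀ x, (∃ q ∈ m.foldr (fun o acc => o.elim acc fun q => insertRat q acc) [((0, 1) : ℤ × ℤ)],
        frac q = x) ↔ x = 0 ∨ ∃ q, some q ∈ m ∧ frac q = x := by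
    intro m
    induction m with
    | nil =>
      intro _
      refine ⟨⟨by simp, by simp⟩, fun x => ?_⟩
      simp [frac, eq_comm]
    | cons o m ih =>
      intro h
      obtain ⟨h1, h2⟩ := ih fun q hq => h q (List.mem_cons_of_mem _ hq)
      cases o with
      | none => exact ⟨h1, fun x => (h2 x).trans (by simp)⟩
      | some q =>
        have hq := h q List.mem_cons_self
        refine ⟨isIncreasing_insertRat hq h1, fun x => ?_⟩
        rw [List.foldr_cons, Option.elim_some, exists_frac_insertRat hq h1, h2]
        simp only [List.mem_cons, Option.some.injEq, or_and_right, exists_or, exists_eq_left,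
          eq_comm (a := x)]
        tauto
  have hmem : ∀ q, some q ∈ List.ofFn r ↔ ∃ s, r s = some q := fun q => by
    simp only [List.mem_ofFn]
  have hsome : ∀ s q, r s = some q → s ∈ I.obj.targets ∧ 0 < q.2 ∧ I.obj.reward s = frac q := by
    intro s q h
    rcases hr s with ⟨-, h2⟩ | ⟨h1, q', hq, hv, h2⟩
    · rw [h2] at h; cases h
    · obtain rfl := Option.some.inj (h2.symm.trans h)
      exact ⟨h1, hq, hv⟩
  obtain ⟨h1, h2⟩ := key (List.ofFn r) fun q hq => by
    obtain ⟨s, hs⟩ := (hmem q).1 hq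
    exact (hsome s q hs).2.1
  refine ⟨h1, fun x => (h2 x).trans ?_⟩
  rw [WRObjective.outcomes, Finset.mem_insert, Finset.mem_image]
  refine or_congr Iff.rfl ⟨?_, ?_⟩
  · rintro ⟨q, hq, rfl⟩
    obtain ⟨s, hs⟩ := (hmem q).1 hq
    exact ⟨s, (hsome s q hs).1, (hsome s q hs).2.2⟩
  · rintro ⟨s, hs, rfl⟩
    rcases hr s with ⟨h, -⟩ | ⟨-, q, -, hv, h⟩
    · exact absurd hs h
    · exact ⟨q, (hmem q).2 ⟨s, h⟩, hv.symm⟩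

/-- A finite set has only one increasing enumeration, so the sorted list of fractions agrees entry
by entry with `outcomeVec`. -/
theorem exists_outcomeList (hr : ∀ s, IsReward I.obj s (r s)) :
    ∃ q : Fin I.obj.numOutcomes → ℤ × ℤ, outcomeList (input I.mdp e r) = List.ofFn q ∧
      ∀ i, 0 < (q i).2 ∧ frac (q i) = I.obj.outcomeVec i := by
  obtain ⟨⟨hpos, hlt⟩, hmem⟩ := outcomeList_spec (e := e) hr
  generalize outcomeList (input I.mdp e r) = L at *
  have hnodup : (L.map frac).Nodup :=
    List.pairwise_map.2 (hlt.imp fun h => ne_of_lt h)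
  have hset : (L.map frac).toFinset = I.obj.outcomes := by
    ext x
    rw [List.mem_toFinset, List.mem_map, hmem]
  have hlen : I.obj.numOutcomes = L.length := by
    rw [WRObjective.numOutcomes, ← hset, List.toFinset_card_of_nodup hnodup, List.length_map]
  refine ⟨fun i => L.get (i.cast hlen), ?_, fun i => ⟨hpos _ (List.get_mem _ _), ?_⟩⟩
  · refine List.ext_getElem (by simp [hlen]) fun i h1 h2 => by simp
  refine congrFun (Finset.orderEmbOfFin_unique (s := I.obj.outcomes) rfl
    (f := fun i : Fin I.obj.numOutcomes => frac (L.get (i.cast hlen))) (fun i => ?_) ?_) i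
  · exact (hmem _).1 ⟨_, List.get_mem _ _, rfl⟩
  · exact fun i j hij => List.pairwise_iff_get.1 hlt _ _ hij

theorem codes_queryTable (hr : ∀ s, IsReward I.obj s (r s)) :
    IsTable (fun i x => CodesSet x (I.query i)) (code (queryTable (input I.mdp e r))) := by
  obtain ⟨Q, hQ, hL⟩ := exists_outcomeList (e := e) hr
  have hbit : ∀ (b : Bool) (p : Prop) (_ : Decidable p), (b = true ↔ p) →
      code b = .int (if p then 1 else 0) := by
    intro b p _ h
    change Val.int (if b = true then 1 else 0) = _
    simp only [h]
  have hsink : (newRewards (input I.mdp e r)).length = I.mdp.numStates + 1 := by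
    simp [newRewards, input]
  rw [queryTable, hQ, hsink, List.map_ofFn]
  refine isTable_ofFn fun i => ?_
  obtain ⟨hq, hv⟩ := hL i
  rw [Function.comp_apply]
  generalize Q i = q at hq hv ⊢
  have hq0 : q.1 = 0 ↔ I.obj.outcomeVec i = 0 := by
    rw [← hv, frac, div_eq_zero_iff, Int.cast_eq_zero, Int.cast_eq_zero]
    exact ⟨Or.inl, fun h => h.resolve_right hq.ne'⟩
  refine isTable_map_range (n := I.mdp.numStates + 1) fun s => hbit _ _ _ ?_
  refine Fin.lastCases ?_ (fun s => ?_) s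
  -- The sink has the index `numStates` and no reward; it is the only state that passes the index
  -- test.
  · have h1 : (newRewards (input I.mdp e r)).getD (Fin.last I.mdp.numStates : ℕ) none = none := by
      simp [newRewards, input]
    rw [h1, Option.elim_none, Bool.and_eq_true, decide_eq_true_eq, decide_eq_true_eq, hq0]
    refine (and_iff_right rfl).trans ?_
    change _ ↔ collapse.sink _ _ ∈ I.query i
    rw [Problem.query, WRObjective.obtainSet]
    split_ifs with h
    · exact iff_of_true h (Finset.mem_singleton_self _)
    · exact iff_of_false h fun h' => I.sink_not_mem (Finset.mem_filter.1 h').1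
  · have h1 : (newRewards (input I.mdp e r)).getD (s.castSucc : ℕ) none = r s := by
      rw [newRewards, List.getD_append _ _ _ _ (by simp [input])]
      exact getD_ofFn r s none
    rw [h1]
    change _ ↔ collapse.st _ _ s ∈ I.query i
    have h2 : collapse.st _ _ s ∈ I.query i ↔
        s ∈ I.obj.targets ∧ I.obj.reward s = I.obj.outcomeVec i := by
      rw [Problem.query, WRObjective.obtainSet]
      split_ifs with h
      · rw [Finset.mem_singleton, h]
        exact iff_of_false (collapse.st_ne_sink s) fun h' => I.obj.reward_ne_zero s h'.1 h'.2
      · rw [Finset.mem_filter, I.collapseObj_reward]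
        exact and_congr_left' collapse.st_mem_copies
    rw [h2]
    rcases hr s with ⟨h3, h4⟩ | ⟨h3, p, hp, hpv, h4⟩
    · rw [h4, Option.elim_none]
      refine iff_of_false (fun h => ?_) fun h => h3 h.1
      rw [Bool.and_eq_true, decide_eq_true_eq] at h
      exact s.isLt.ne h.1
    · rw [h4, Option.elim_some, Bool.and_eq_true, ratLe_iff hp hq, ratLe_iff hq hp, hv, hpv,
        ← le_antisymm_iff, and_iff_right h3]
      rfl

end Outcomes

theorem codes_run {I : Problem} {e : I.mdp.State → I.mdp.Action → Entry}
    {r : I.mdp.State → Option (ℤ × ℤ)} (he : ∀ s a, IsEntry I.mdp s a (e s a))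
    (hr : ∀ s, IsReward I.obj s (r s)) :
    CodesReduct (code (run (input I.mdp e r))) I.reduct :=
  ⟨_, _, _, codes_newMDP he hr, codes_newRewards hr, codes_queryTable hr, rfl⟩

end Algo

/-- The reduction is computable in polynomial time. -/
theorem Problem.polyTimeComputable_reduct :
    PolyTimeComputable CodesProblem (fun _ => CodesReduct) Problem.reduct := by
  obtain ⟨P, p, h⟩ := Algo.pt_run
  refine ⟨P, p, fun I v hv => ?_⟩
  obtain ⟨e, r, he, hr, rfl⟩ := Algo.exists_input hv
  obtain ⟨t, h1, h2⟩ := h (Algo.input I.mdp e r)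
  exact ⟨_, t, h1, h2, Algo.codes_run he hr⟩

end CPTReach

theorem mainTheorem1 :
    ∃ red : (I : Problem) → Reduct I.obj.numOutcomes,
      -- the construction takes polynomial time
      PolyTimeComputable CodesProblem (fun _ => CodesReduct) red ∧
      ∀ I : Problem,
        -- the constructed MDP carries the same objective, and it is stopping
        SameObjective I.obj (red I).obj ∧
        (red I).sink ∉ (red I).obj.targets ∧
        (red I).obj.Stopping (red I).sink ∧
        -- the query consists of the sets of states that obtain the outcomes, in increasing order
        (∀ i, (red I).query i = (red I).obj.obtainSet (red I).sink (I.obj.outcomeVec i)) ∧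
        -- all targets of the query are absorbing
        (∀ i, ∀ s ∈ (red I).query i, (red I).mdp.Absorbing s) ∧
        -- both suprema are suprema of non-empty bounded sets, and they agree
        ∀ C : CPT,
          Nonempty (Strategy I.mdp) ∧
          BddAbove (Set.range fun σ : Strategy I.mdp => C.strategyValue I.obj σ) ∧
          (paretoFrontier (red I).mdp (red I).query).Nonempty ∧
          BddAbove ((fun p => C.cpt (fun i => (I.obj.outcomeVec i : ℝ)) p) ''
            paretoFrontier (red I).mdp (red I).query) ∧
          C.val I.obj =
            sSup ((fun p => C.cpt (fun i => (I.obj.outcomeVec i : ℝ)) p) ''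
              paretoFrontier (red I).mdp (red I).query) := by
  refine ⟨Problem.reduct, Problem.polyTimeComputable_reduct, fun I => ⟨I.sameObjective,
    I.sink_not_mem, I.stopping, fun i => rfl, I.query_absorbing, fun C => ?_⟩⟩
  have himg := I.image_cpt_paretoFrontier C
  refine ⟨I.mdp.exists_strategy, I.bddAbove_strategyValue C, ?_, ?_, ?_⟩
  · obtain ⟨σ⟩ := I.mdp.exists_strategy
    exact I.paretoFrontier_eq ▸ Set.range_nonempty_iff_nonempty.2 ⟨σ⟩
  · exact himg ▸ I.bddAbove_strategyValue C
  · exact (congrArg sSup himg).symm
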